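/- For a finite group $G$ and $n\ge 0$, let $\mu_n(G)$ be the minimum of $(-1)^n\chi(\mathscr F)=f_n-f_{n-1}+\dots+(-1)^nf_0$ over all exact sequences $F_n\to\dots\to F_1\to F_0\to\mathbb Z\to 0$ of $\mathbb Z G$-modules with $F_i$ free of finite rank $f_i$ and $\mathbb Z$ the trivial module. Let $e_n(G)$ be the least integer greater than or equal to all the numbers $$h^n(G,\mathbb F)-2\bigl(h^{n-1}(G,\mathbb F)-h^{n-2}(G,\mathbb F)+\dots+(-1)^{n-1}h^0(G,\mathbb F)\bigr),\qquad h^i(G,\mathbb F)=\dim_{\mathbb F} H^i(G;\mathbb F),$$ where $\mathbb F$ ranges over $\mathbb Q$ and $\mathbb F_q$ for all primes $q$. Let $p$ be an odd prime, $k>1$, $E_k=(\mathbb Z/p)^k$, and let $C$ be a finite cyclic group of order prime to $p$ acting on $E_k$ by automorphisms. Let $U_k=E_k\rtimes C$ be the semidirect product. Let $\mathbb K_p$ be an algebraically closed field of characteristic $p$, and suppose that the $\mathbb K_p[C]$-module $H^1(E_k;\mathbb K_p)=\operatorname{Hom}(E_k,\mathbb K_p)$ is isomorphic to a direct sum of $k$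 copies of $L(\alpha)$, the one-dimensional module given by a character $\alpha\colon C\to\mathbb K_p^\times$. 1. If $\alpha^2\neq 1$, then $e_2(U_k)=2$, $\mu_2(U_k)=\frac{k(k-1)}2$ and $\mu_2(U_k)-\mu_1(U_k)=\frac{k(k-3)}2$. 2. If $\alpha^2=1$, then $\mu_2(U_k)=\frac{k(k-1)}2+1$; and if moreover $\alpha\neq 1$ (so that $\alpha$ has order $2$), then $e_2(U_k)=\frac{k(k-1)}2+2$ and $\mu_2(U_k)-\mu_1(U_k)=\frac{k(k-3)}2+1$. -/

import Mathlib

/-! ## Swan's invariants `μ_n(G)` -/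

/-- An `n`-step resolution `F_n → F_{n-1} → ⋯ → F_1 → F_0 → ℤ → 0` of the trivial `ℤ[G]`-module `ℤ`
by finitely generated free `ℤ[G]`-modules `F_i = ℤ[G]^(rank i)`, exact at `ℤ, F_0, …, F_{n-1}`.
The data `rank i`, `d i` with `i` beyond the range `i ≤ n`, respectively `i + 1 ≤ n`,
are irrelevant and unconstrained. -/
structure FreeStepResolution (G : Type) [Group G] (n : ℕ) where
  /-- The rank of `F_i`. -/
  rank : ℕ → ℕ
  /-- The differential `F_{i+1} → F_i`. -/
  d : ∀ i : ℕ, (Fin (rank (i + 1)) → MonoidAlgebra ℤ G) →ₗ[MonoidAlgebra ℤ G]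
    (Fin (rank i) → MonoidAlgebra ℤ G)
  /-- The augmentation `F_0 → ℤ`. -/
  aug : (Fin (rank 0) → MonoidAlgebra ℤ G) →ₗ[MonoidAlgebra ℤ G]
    (Representation.trivial ℤ G ℤ).asModule
  aug_surjective : Function.Surjective aug
  exact_zero : 0 < n → Function.Exact (d 0) aug
  exact_succ : ∀ i : ℕ, i + 1 < n → Function.Exact (d (i + 1)) (d i)

/-- The signed Euler characteristic
`(-1)^n χ(F) = rank F_n - rank F_{n-1} + ⋯ + (-1)^n rank F_0`. -/
def FreeStepResolution.signedChi {G : Type} [Group G] {n : ℕ} (F : FreeStepResolution G n) : ℤ :=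
  ∑ i ∈ Finset.range (n + 1), (-1 : ℤ) ^ (n - i) * (F.rank i : ℤ)

/-- `m` is Swan's invariant `μ_n(G)`: the minimum of `(-1)^n χ(F)` over all `n`-step resolutions `F`
of `ℤ` by finitely generated free `ℤ[G]`-modules. -/
def IsSwanMu (n : ℕ) (G : Type) [Group G] (m : ℤ) : Prop :=
  IsLeast (Set.range fun F : FreeStepResolution G n => F.signedChi) m

/-! ## The invariants `e_n(G)` -/

/-- `h^i(G, F) = dim_F H^i(G, F)`, group cohomology with trivial coefficients in a field. -/
noncomputable def cohomDim (F : Type) [Field F] (G : Type) [Group G] (i : ℕ) : ℕ :=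
  Module.finrank F (groupCohomology (Rep.trivial F G F) i)

/-- `h^n(G, F) - 2 (h^{n-1}(G, F) - h^{n-2}(G, F) + ⋯ + (-1)^{n-1} h^0(G, F))`. -/
noncomputable def eNumber (F : Type) [Field F] (G : Type) [Group G] (n : ℕ) : ℤ :=
  (cohomDim F G n : ℤ) -
    2 * ∑ i ∈ Finset.range n, (-1 : ℤ) ^ (n - 1 - i) * (cohomDim F G i : ℤ)

/-- `m` is the invariant `e_n(G)` of the finite group `G`: the least integer that is greater than
or equal to `eNumber F G n` for `F = ℚ` and for `F = 𝔽_q`, `q` any prime. -/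
def IsEInvariant (n : ℕ) (G : Type) [Group G] (m : ℤ) : Prop :=
  IsLeast {b : ℤ | eNumber ℚ G n ≤ b ∧ ∀ (q : ℕ) [Fact q.Prime], eNumber (ZMod q) G n ≤ b} m

/-! ## Isotypic actions on elementary abelian groups -/

/-- The elementary abelian group `E_k = (ℤ/p)^k`, written multiplicatively. -/
abbrev ElemAb (p k : ℕ) : Type := Multiplicative (Fin k → ZMod p)

/-- The `K[C]`-module `H^1(E; K) = Hom(E, K)` of an action `φ` of `C` on the group `E`:
`(c • f)(x) = f(c⁻¹ • x)`. -/
def homRep (K : Type*) [Field K] {C E : Type*} [Group C] [CommGroup E] (φ : C →* MulAut E) :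
    Representation K C (Additive E →+ K) where
  toFun c :=
    { toFun := fun f => f.comp (MonoidHom.toAdditive (φ c⁻¹).toMonoidHom)
      map_add' := fun _ _ => rfl
      map_smul' := fun _ _ => rfl }
  map_one' := by
    ext f x
    simp
  map_mul' c d := by
    ext f x
    simp [mul_inv_rev]

/-- The one-dimensional `K[C]`-module `L(α)` of a character `α : C → Kˣ`. -/
def charRep {K : Type*} [Field K] {C : Type*} [Group C] (α : C →* Kˣ) : Representation K C K where
  toFun c := (α c : K) • LinearMap.id
  map_one' := by
    ext
    simp
  map_mul' c d := by
    ext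
    simp [mul_comm]

/-- The action `φ` of `C` on `E_k = (ℤ/p)^k` is isotypic with character `α`: the `K[C]`-module
`Hom(E_k, K)` is isomorphic to the direct sum of `k` copies of `L(α)`. -/
def IsIsotypicAction {p k : ℕ} {K : Type*} [Field K] {C : Type*} [Group C]
    (φ : C →* MulAut (ElemAb p k)) (α : C →* Kˣ) : Prop :=
  Nonempty ((homRep K φ).Equiv (Representation.directSum fun _ : Fin k => charRep α))

/-! Let `C` be generated by `y`, of order `m`, and let the `x i` be the standard generators of
`E_k`. The isotypic hypothesis says that `C` acts on `E_k` through scalars of the prime field, by a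
character `a` with `a c` corresponding to `α c⁻¹`. Choose exponents with `s / t = a c` for the
generator, so that `y x ^ t = x ^ s y`. Below, A, B, D, Y denote the Fox derivatives of the
relations `x x' = x' x`, `x ^ p = 1`, `y x ^ t = x ^ s y`, `y ^ m = 1`.

Upper bounds. A family of elements spanning the kernel of the Fox boundary of the `k + 1` generators
gives a partial resolution, so only module generation matters. It suffices to show that in every
module where a small family of modified relators vanishes, all relators vanish
(`relatorsVanish_of_trivial`, `relatorsVanish_of_involutive`, `relatorsVanish_of_generic`). For a
nontrivial action one takes `t = s + 1`. Then D = 0 gives `t y B = s B`, so B dies as soon as `y`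
fixes it; this allows the B's to be added to the A's and to Y at no cost. For a trivial action the
coprimality of `m` and `p` plays this role. If `α ^ 2 ≠ 1`, the A's satisfy, up to augmentation, `(t
^ 2 - s ^ 2) A = 0` with `t ^ 2 - s ^ 2 = s + t` prime to `p`, and Y can be absorbed into one
commutator relator, saving one more relator. This is `relators_eq_zero_of_pair`: a computation
modulo `p`-power torsion, followed by Nakayama's lemma.

Lower bounds. Mapping a resolution into the one-dimensional module of a character gives Swan's
inequalities `μ_1 ≥ h^1 - h^0` and `μ_2 ≥ h^2 - h^1 + h^0`. For the character `a ≠ 1` the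
coordinates of `E_k` give `k` classes in `H^1`. For `a ^ 2` the products of two coordinates give
`k.choose 2` classes in `H^2`, while `h^1 = 0` if `a ≠ 1`, and `h^0 = 1` if `a ^ 2 = 1`. When `a =
1` there are `k` further Bockstein classes, balanced by `h^1 = k`.

The invariant `e_2`. A 2-cocycle is controlled by its values on relators, and the same identities
among relators bound `H^2` over every prime field and over `ℚ`. -/

section

open Finset

/-! ### Geometric sums and norm elements in a noncommutative ring. -/

section GeomSum

variable {R : Type*} [Ring R]

/-- The geometric sum `1 + x + ⋯ + x ^ (n - 1)`. -/
def gsum (n : ℕ) (x : R) : R := ∑ j ∈ range n, x ^ j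

@[simp] theorem gsum_zero (x : R) : gsum 0 x = 0 := by simp [gsum]

@[simp] theorem gsum_one_left (x : R) : gsum 1 x = 1 := by simp [gsum]

theorem gsum_succ (n : ℕ) (x : R) : gsum (n + 1) x = gsum n x + x ^ n := by
  simp [gsum, sum_range_succ]

theorem gsum_one_right (n : ℕ) : gsum n (1 : R) = n := by simp [gsum]

theorem sub_one_mul_gsum (n : ℕ) (x : R) : (x - 1) * gsum n x = x ^ n - 1 := mul_geom_sum x n

theorem gsum_mul_sub_one (n : ℕ) (x : R) : gsum n x * (x - 1) = x ^ n - 1 := geom_sum_mul x n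

theorem gsum_add (a b : ℕ) (x : R) : gsum (a + b) x = gsum a x + x ^ a * gsum b x := by
  simp [gsum, sum_range_add, mul_sum, pow_add]

theorem gsum_mul (a b : ℕ) (x : R) : gsum (a * b) x = gsum b (x ^ a) * gsum a x := by
  induction b with
  | zero => simp
  | succ b ih => rw [Nat.mul_succ, gsum_add, ih, gsum_succ, add_mul, pow_mul]

theorem SemiconjBy.gsum {y u w : R} (h : SemiconjBy y u w) (n : ℕ) :
    SemiconjBy y (gsum n u) (_root_.gsum n w) := by
  simp only [SemiconjBy, _root_.gsum, mul_sum, sum_mul]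
  exact sum_congr rfl fun j _ => h.pow_right j

theorem Commute.gsum_right {y u : R} (h : Commute y u) (n : ℕ) : Commute y (gsum n u) :=
  SemiconjBy.gsum h n

theorem Commute.gsum_gsum {y u : R} (h : Commute y u) (n k : ℕ) :
    Commute (gsum n y) (gsum k u) :=
  ((h.gsum_right k).symm.gsum_right n).symm

theorem mul_gsum_of_pow_eq_one {p : ℕ} {x : R} (hx : x ^ p = 1) : x * gsum p x = gsum p x := by
  have := sub_one_mul_gsum p x
  rw [hx, sub_self, sub_mul, one_mul, sub_eq_zero] at this
  exact this

theorem pow_mul_gsum_of_pow_eq_one {p : ℕ} {x : R} (hx : x ^ p = 1) (n : ℕ) :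
    x ^ n * gsum p x = gsum p x := by
  induction n with
  | zero => simp
  | succ n ih => rw [pow_succ, mul_assoc, mul_gsum_of_pow_eq_one hx, ih]

theorem gsum_mul_gsum_of_pow_eq_one {p : ℕ} {x : R} (hx : x ^ p = 1) (n : ℕ) :
    gsum n x * gsum p x = (n : R) * gsum p x := by
  rw [gsum, sum_mul, sum_congr rfl fun j _ => pow_mul_gsum_of_pow_eq_one hx j]
  simp

/-- Multiplication by `t` permutes the exponents modulo `p`. -/
theorem gsum_pow_of_coprime {p : ℕ} (hp : 0 < p) {x : R} (hx : x ^ p = 1) {t : ℕ}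
    (ht : t.Coprime p) : gsum p (x ^ t) = gsum p x := by
  have hinj : Set.InjOn (fun j => t * j % p) (range p : Set ℕ) := by
    intro i hi j hj h
    have h1 : i ≡ j [MOD p] := Nat.ModEq.cancel_left_of_coprime (Nat.coprime_comm.mp ht) h
    simp only [coe_range, Set.mem_Iio] at hi hj
    rwa [Nat.ModEq, Nat.mod_eq_of_lt hi, Nat.mod_eq_of_lt hj] at h1
  have himg : (range p).image (fun j => t * j % p) = range p := by
    apply eq_of_subset_of_card_le
    · intro i hi
      obtain ⟨j, -, rfl⟩ := mem_image.mp hi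
      exact mem_range.mpr (Nat.mod_lt _ hp)
    · rw [card_image_of_injOn hinj]
  conv_rhs => rw [gsum, ← himg, sum_image hinj]
  refine sum_congr rfl fun j _ => ?_
  rw [← pow_mul, ← pow_mod_orderOf, eq_comm, ← pow_mod_orderOf,
    Nat.mod_mod_of_dvd _ (orderOf_dvd_of_pow_eq_one hx)]

/-- Conjugation by `y` only permutes the powers of `x`, so it preserves their sum. This lets `y` be
moved past norms. -/
theorem semiconjBy_gsum_of_pow {p : ℕ} (hp : 0 < p) {x y : R} (hx : x ^ p = 1) {s t : ℕ}
    (hs : s.Coprime p) (ht : t.Coprime p) (h : y * x ^ t = x ^ s * y) :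
    Commute y (gsum p x) := by
  have := SemiconjBy.gsum (show SemiconjBy y (x ^ t) (x ^ s) from h) p
  rwa [gsum_pow_of_coprime hp hx hs, gsum_pow_of_coprime hp hx ht] at this

end GeomSum

/-! ### Fox derivatives of the relators and the identities among them. -/

section Relators

variable {R : Type*} [Ring R] {Q : Type*} [AddCommGroup Q] [Module R Q]

/-- The Fox derivative of the relation `x x' = x' x`, where `e`, `e'` are the derivatives of the
generators `x`, `x'`. -/
def relComm (x x' : R) (e e' : Q) : Q := (x - 1) • e' - (x' - 1) • e

/-- The Fox derivative of the relation `x ^ n = 1`. -/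
def relPow (n : ℕ) (x : R) (e : Q) : Q := gsum n x • e

/-- The Fox derivative of the relation `y x ^ t = x ^ s y`. -/
def relConj (s t : ℕ) (x y : R) (e f : Q) : Q :=
  (1 - x ^ s) • f + (y * gsum t x - gsum s x) • e

theorem gsum_smul_of_smul_eq {x : R} {v : Q} {b : ℤ} (h : x • v = b • v) (n : ℕ) :
    gsum n x • v = gsum n b • v := by
  have hpow : ∀ j, x ^ j • v = b ^ j • v := fun j => by
    induction j with
    | zero => simp
    | succ j ih => rw [pow_succ, mul_smul, h, smul_comm, ih, smul_smul, pow_succ']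
  simp [gsum, sum_smul, hpow]

theorem gsum_smul_of_smul_eq_self {x : R} {v : Q} (h : x • v = v) (n : ℕ) :
    gsum n x • v = (n : ℤ) • v := by
  have := gsum_smul_of_smul_eq (b := 1) (by simpa using h) n
  rwa [gsum_one_right] at this

theorem pow_smul_of_smul_eq {x : R} {v : Q} {b : ℤ} (h : x • v = b • v) (j : ℕ) :
    x ^ j • v = b ^ j • v := by
  induction j with
  | zero => simp
  | succ j ih => rw [pow_succ, mul_smul, h, smul_comm, ih, smul_smul, pow_succ']

theorem eq_zero_of_coprime_smul {a b : ℤ} (h : IsCoprime a b) {v : Q} (ha : a • v = 0)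
    (hb : b • v = 0) : v = 0 := by
  obtain ⟨u, w, huw⟩ := h
  rw [← one_smul ℤ v, ← huw, add_smul, mul_smul, mul_smul, ha, hb, smul_zero, smul_zero, add_zero]

theorem smul_relPow {n : ℕ} {x : R} (hx : x ^ n = 1) (e : Q) :
    x • relPow n x e = relPow n x e := by
  rw [relPow, smul_smul, mul_gsum_of_pow_eq_one hx]

theorem gsum_smul_relPow {n : ℕ} {x : R} (hx : x ^ n = 1) (j : ℕ) (e : Q) :
    gsum j x • relPow n x e = (j : ℤ) • relPow n x e :=
  gsum_smul_of_smul_eq_self (smul_relPow hx e) j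

/-- An identity among relations: that `x` commutes with `x' ^ p` follows either from `p` commutators
or from the power relator. -/
theorem gsum_smul_relComm_right {p : ℕ} {x x' : R} (h : Commute x x') (hx' : x' ^ p = 1)
    (e e' : Q) : gsum p x' • relComm x x' e e' = (x - 1) • relPow p x' e' := by
  have h1 : gsum p x' * (x - 1) = (x - 1) * gsum p x' :=
    ((h.gsum_right p).sub_left (Commute.one_left _)).symm
  rw [relComm, relPow, smul_sub, smul_smul, smul_smul, smul_smul, gsum_mul_sub_one, hx', sub_self,
    zero_smul, sub_zero, h1]

theorem gsum_smul_relComm_left {p : ℕ} {x x' : R} (h : Commute x x') (hx : x ^ p = 1)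
    (e e' : Q) : gsum p x • relComm x x' e e' = -((x' - 1) • relPow p x e) := by
  have : relComm x x' e e' = -relComm x' x e' e := by simp [relComm]
  rw [this, smul_neg, gsum_smul_relComm_right h.symm hx]

/-- An identity among relations, from conjugating `x ^ p` by `y`. After augmentation it reads `p D =
(t - s) B`. -/
theorem gsum_smul_relConj {p : ℕ} {x y : R} {s t : ℕ} (hx : x ^ p = 1)
    (hy : Commute y (gsum p x)) (e f : Q) :
    gsum p x • relConj s t x y e f = (t : ℤ) • y • relPow p x e - (s : ℤ) • relPow p x e := by
  have h1 : gsum p x * (1 - x ^ s) = 0 := by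
    have := (Commute.refl x).gsum_right p
    rw [mul_sub, mul_one, (this.pow_left s).eq.symm, pow_mul_gsum_of_pow_eq_one hx, sub_self]
  have h2 : ∀ n, gsum p x * gsum n x = gsum n x * gsum p x := fun n =>
    (Commute.refl x).gsum_gsum p n
  rw [relConj, smul_add, smul_smul, h1, zero_smul, zero_add, smul_smul, mul_sub, ← mul_assoc,
    ← hy.eq, mul_assoc, h2, h2, gsum_mul_gsum_of_pow_eq_one hx, gsum_mul_gsum_of_pow_eq_one hx,
    sub_smul, mul_smul, mul_smul, mul_smul, Nat.cast_smul_eq_nsmul R, Nat.cast_smul_eq_nsmul R, smul_comm y t]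
  simp only [relPow, natCast_zsmul]

/-- Conjugation by `y` carries the commutator of `x ^ t`, `x' ^ t` to that of `x ^ s`, `x' ^ s`.
After augmentation this reads `(t ^ 2 - s ^ 2) A = 0`, the source of the dichotomy on `α ^ 2`. -/
theorem relConj_relComm {x x' y : R} {s t : ℕ} (h : Commute x x') (hx : y * x ^ t = x ^ s * y)
    (hx' : y * x' ^ t = x' ^ s * y) (e e' f : Q) :
    (y * (gsum t x * gsum t x')) • relComm x x' e e'
        - (gsum s x * gsum s x') • relComm x x' e e' =
      (x ^ s - 1) • relConj s t x' y e' f - (x' ^ s - 1) • relConj s t x y e f := by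
  have key : ∀ {u v : R}, Commute u v → y * u ^ t = u ^ s * y →
      (u ^ s - 1) * (y * gsum t v - gsum s v) =
        y * (gsum t u * gsum t v) * (u - 1) - gsum s u * gsum s v * (u - 1) := by
    intro u v huv hu
    have e1 : gsum t u * gsum t v * (u - 1) = (u ^ t - 1) * gsum t v := by
      rw [(huv.gsum_gsum t t).eq, mul_assoc, gsum_mul_sub_one]
      exact (((huv.pow_left t).gsum_right t).sub_left (Commute.one_left _)).eq.symm
    have e2 : gsum s u * gsum s v * (u - 1) = (u ^ s - 1) * gsum s v := by
      rw [(huv.gsum_gsum s s).eq, mul_assoc, gsum_mul_sub_one]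
      exact (((huv.pow_left s).gsum_right s).sub_left (Commute.one_left _)).eq.symm
    rw [e2, mul_assoc, e1, mul_sub, ← mul_assoc, sub_mul _ _ y, ← hu, one_mul, ← mul_assoc,
      mul_sub, mul_one]
  have k1 := key h hx
  have k2 := key h.symm hx'
  rw [(h.symm.gsum_gsum t t).eq, (h.symm.gsum_gsum s s).eq] at k2
  have k3 : (x ^ s - 1) * (1 - x' ^ s) = (x' ^ s - 1) * (1 - x ^ s) := by
    have := (h.pow_pow s s).eq
    noncomm_ring
    rw [this]; abel
  simp only [relConj, relComm, smul_add, smul_sub, smul_smul, k1, k2, k3]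
  simp only [sub_smul]
  abel

/-- Iterating the conjugation gives `y ^ m x ^ (t ^ m) = x ^ (s ^ m) y ^ m`. As `t ^ m` exceeds `s ^
m` by `p n`, this compares a commutator with `y ^ m` to `n` copies of the power relator. -/
theorem sub_smul_relPow_of_relConj_eq_zero {p : ℕ} {x y : R} {s t n m : ℕ} (hx : x ^ p = 1)
    (hst : t ^ m = s ^ m + p * n) (hxy : y * x ^ t = x ^ s * y) (hy : y ^ m = 1) {e f : Q}
    (h : relConj s t x y e f = 0) :
    (1 - x ^ s ^ m) • relPow m y f + (n : ℤ) • relPow p x e = 0 := by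
  have hsemi : ∀ j, SemiconjBy (y ^ j) (x ^ t ^ j) (x ^ s ^ j) := fun j => by
    induction j with
    | zero => simp
    | succ j ih =>
      rw [pow_succ y, pow_succ t, pow_succ s, mul_comm (t ^ j), pow_mul x t,
        mul_comm (s ^ j), pow_mul]
      have h1 : SemiconjBy y ((x ^ t) ^ t ^ j) ((x ^ s) ^ t ^ j) := SemiconjBy.pow_right hxy _
      refine SemiconjBy.mul_left ?_ h1
      rw [← pow_mul, mul_comm, pow_mul, ← pow_mul x s, mul_comm s, pow_mul]
      exact ih.pow_right s
  -- The left side is the Fox derivative of `y ^ j x ^ (t ^ j) = x ^ (s ^ j) y ^ j`.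
  have main : ∀ j, (1 - x ^ s ^ j) • gsum j y • f
      + (y ^ j * gsum (t ^ j) x - gsum (s ^ j) x) • e = 0 := by
    intro j
    induction j with
    | zero => simp
    | succ j ih =>
      have a1 : gsum s (x ^ s ^ j) * (1 - x ^ s ^ j) = 1 - x ^ s ^ (j + 1) := by
        rw [← neg_sub (x ^ s ^ j), mul_neg, gsum_mul_sub_one, ← pow_mul, ← pow_succ, neg_sub]
      have a2 : gsum s (x ^ s ^ j) * (y ^ j * gsum (t ^ j) x - gsum (s ^ j) x) =
          y ^ j * gsum (t ^ j * s) x - gsum (s ^ (j + 1)) x := by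
        rw [mul_sub, ← mul_assoc, ← ((hsemi j).gsum s).eq, mul_assoc, ← gsum_mul, ← gsum_mul,
          ← pow_succ]
      have b0 : gsum (t ^ j) (x ^ s) * (1 - x ^ s) = 1 - x ^ (s * t ^ j) := by
        rw [← neg_sub (x ^ s), mul_neg, gsum_mul_sub_one, ← pow_mul, neg_sub]
      have b1 : y ^ j * gsum (t ^ j) (x ^ s) * (1 - x ^ s) = (1 - x ^ s ^ (j + 1)) * y ^ j := by
        rw [mul_assoc, b0, mul_sub, sub_mul, mul_one, one_mul, mul_comm s, pow_mul,
          ((hsemi j).pow_right s).eq, ← pow_mul, ← pow_succ]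
      have b2 : y ^ j * gsum (t ^ j) (x ^ s) * (y * gsum t x - gsum s x) =
          y ^ (j + 1) * gsum (t ^ (j + 1)) x - y ^ j * gsum (t ^ j * s) x := by
        have := (SemiconjBy.gsum (show SemiconjBy y (x ^ t) (x ^ s) from hxy) (t ^ j)).eq
        rw [mul_assoc, mul_sub, ← mul_assoc (gsum (t ^ j) (x ^ s)), ← this, mul_assoc y,
          ← gsum_mul, ← gsum_mul, mul_sub, ← mul_assoc, ← pow_succ, mul_comm t, ← pow_succ,
          mul_comm s]
      have c1 := congrArg (fun v => gsum s (x ^ s ^ j) • v) ih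
      have c2 := congrArg (fun v => (y ^ j * gsum (t ^ j) (x ^ s)) • v) h
      simp only [relConj, smul_add, smul_smul, a2, b1, b2, smul_zero] at c1 c2
      rw [← mul_assoc, a1] at c1
      have c3 := congrArg₂ (· + ·) c1 c2
      simp only [add_zero] at c3
      rw [gsum_succ, ← c3, smul_smul, mul_add]
      simp only [add_smul, sub_smul]
      abel
  have hm := main m
  rw [hy, one_mul, hst, gsum_add, add_sub_cancel_left, gsum_mul, hx, gsum_one_right] at hm
  rw [relPow, relPow, ← hm]
  congr 1
  rw [← mul_assoc, ← (Nat.cast_commute n _).eq, mul_assoc, pow_mul_gsum_of_pow_eq_one hx, mul_smul,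
    Nat.cast_smul_eq_nsmul R, natCast_zsmul]

end Relators

end

section

open Finset

/-! ### Redundancy of relators, tested in an arbitrary module. -/

section Generation

variable {R : Type*} [Ring R] {Q Q' : Type*} [AddCommGroup Q] [Module R Q] [AddCommGroup Q']
  [Module R Q']

theorem map_relComm (g : Q →ₗ[R] Q') (x x' : R) (e e' : Q) :
    g (relComm x x' e e') = relComm x x' (g e) (g e') := by simp [relComm]

theorem map_relPow (g : Q →ₗ[R] Q') (n : ℕ) (x : R) (e : Q) :
    g (relPow n x e) = relPow n x (g e) := by simp [relPow]

theorem map_relConj (g : Q →ₗ[R] Q') (s t : ℕ) (x y : R) (e f : Q) :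
    g (relConj s t x y e f) = relConj s t x y (g e) (g f) := by simp [relConj]

/-- The relations between commuting elements `x i` of exponent `p` and an element `y` of exponent
`m` with `y x ^ t = x ^ s y`. -/
structure ScalarRelations (p m s t : ℕ) {ι : Type*} (x : ι → R) (y : R) : Prop where
  comm : ∀ i j, Commute (x i) (x j)
  pow_x : ∀ i, x i ^ p = 1
  pow_y : y ^ m = 1
  conj : ∀ i, y * x i ^ t = x i ^ s * y
  norm : ∀ i, Commute y (gsum p (x i))

variable {ι : Type*} {p m s t : ℕ} {x : ι → R} {y : R}

/-- Since `x ^ (p s) = 1`, the integer `b ^ (p s)` acts on `v` as the identity, while it is a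
multiple of `b ^ s`. -/
theorem eq_zero_of_pow_smul_eq_zero {x : R} {v : Q} {b : ℤ} (hp : p ≠ 0) (hx : x ^ p = 1)
    (hv : x • v = b • v) (h : b ^ s • v = 0) : v = 0 := by
  have h1 := pow_smul_of_smul_eq hv (p * s)
  rw [pow_mul, hx, one_pow, one_smul, mul_comm, pow_mul] at h1
  rw [h1]
  obtain ⟨q, rfl⟩ := Nat.exists_eq_succ_of_ne_zero hp
  rw [pow_succ, mul_smul, h, smul_zero]

/-- Invertibility of `y` gives `(s + 1) v = 0`, to be compared with `s v = 0`. -/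
theorem eq_zero_of_smul_smul_eq {v : Q} (hm : m ≠ 0) (hy : y ^ m = 1)
    (hv : ((s + 1 : ℕ) : ℤ) • y • v = (s : ℤ) • v) (h : (s : ℤ) • v = 0) : v = 0 := by
  rw [h, smul_comm] at hv
  obtain ⟨q, rfl⟩ := Nat.exists_eq_succ_of_ne_zero hm
  have h1 := congrArg (fun w => y ^ q • w) hv
  simp only [smul_smul, ← pow_succ, hy, smul_zero, one_smul] at h1
  push_cast at h1
  rw [add_smul, h, one_smul, zero_add] at h1
  exact h1

theorem smul_eq_self_of_coprime {x : R} {v : Q} {a b : ℕ} (h : a.Coprime b) (ha : x ^ a • v = v)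
    (hb : x ^ b • v = v) : x • v = v := by
  have h1 : ∀ n : ℕ, Function.IsPeriodicPt (fun w : Q => x • w) n v ↔ x ^ n • v = v := fun n => by
    rw [Function.IsPeriodicPt, Function.IsFixedPt, smul_iterate]
  have := Function.IsPeriodicPt.gcd ((h1 a).2 ha) ((h1 b).2 hb)
  rw [h, h1, pow_one] at this
  exact this

namespace ScalarRelations

variable (S : ScalarRelations p m s t x y) {e : ι → Q} {f : Q}
include S

theorem smul_relPow_y : y • relPow m y f = relPow m y f := _root_.smul_relPow S.pow_y f

theorem smul_smul_relPow {i : ι} (h : relConj s t (x i) y (e i) f = 0) :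
    (t : ℤ) • y • relPow p (x i) (e i) = (s : ℤ) • relPow p (x i) (e i) := by
  have := gsum_smul_relConj (s := s) (t := t) (S.pow_x i) (S.norm i) (e i) f
  rwa [h, smul_zero, eq_comm, sub_eq_zero] at this

/-- With `A = -B` the norm identity makes `x i` act on B as `1 - p`. The conjugation identity then
compares geometric sums of lengths `t` and `s` in `1 - p`; since `t = s + 1` they differ by the one
term `(1 - p) ^ s`, which therefore kills `s B`. -/
theorem relPow_eq_zero_of_relComm (hp : p ≠ 0) (hm : m ≠ 0) (ht : t = s + 1) {i j : ι}
    (hi : relConj s t (x i) y (e i) f = 0) (hj : relConj s t (x j) y (e j) f = 0)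
    (hij : relComm (x i) (x j) (e i) (e j) + relPow p (x j) (e j) = 0) :
    relPow p (x j) (e j) = 0 := by
  have hA : relComm (x i) (x j) (e i) (e j) = -relPow p (x j) (e j) := eq_neg_of_add_eq_zero_left hij
  have h2 := gsum_smul_relComm_right (S.comm i j) (S.pow_x j) (e i) (e j)
  have h5 := S.smul_smul_relPow hj
  have h4 := relConj_relComm (S.comm i j) (S.conj i) (S.conj j) (e i) (e j) f
  rw [hi, hj, smul_zero, smul_zero, sub_zero, sub_eq_zero, hA] at h4
  have hxj : ∀ n, gsum n (x j) • relPow p (x j) (e j) = (n : ℤ) • relPow p (x j) (e j) := fun n =>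
    gsum_smul_relPow (S.pow_x j) n (e j)
  rw [hA, smul_neg, hxj] at h2
  set B := relPow p (x j) (e j)
  have hxi : x i • B = (1 - p : ℤ) • B := by
    rw [sub_smul, one_smul] at h2
    rw [sub_smul, one_smul, sub_eq_add_neg, h2]; abel
  have key : ((1 - p : ℤ) ^ s) • (s : ℤ) • B = 0 := by
    simp only [mul_smul, smul_neg, hxj, neg_inj] at h4
    rw [smul_comm (gsum t (x i)), smul_comm (gsum s (x i)), gsum_smul_of_smul_eq hxi,
      gsum_smul_of_smul_eq hxi, smul_comm y, smul_comm y, smul_comm (t : ℤ), h5, ht, gsum_succ,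
      add_smul, smul_comm (s : ℤ) (gsum s (1 - p : ℤ))] at h4
    simpa using h4
  have hs : (s : ℤ) • B = 0 :=
    eq_zero_of_pow_smul_eq_zero hp (S.pow_x i) (by rw [smul_comm, hxi, smul_comm]) key
  subst ht
  exact eq_zero_of_smul_smul_eq hm S.pow_y h5 hs

/-- `B = -Y` is fixed by `y`, so `t B = s B` with `t - s = 1`. -/
theorem relPow_eq_zero_of_add_eq_zero (ht : t = s + 1) {i : ι}
    (hi : relConj s t (x i) y (e i) f = 0)
    (h : relPow m y f + relPow p (x i) (e i) = 0) : relPow p (x i) (e i) = 0 := by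
  have h5 := S.smul_smul_relPow hi
  have hY : relPow m y f = -relPow p (x i) (e i) := eq_neg_of_add_eq_zero_left h
  have hy := S.smul_relPow_y (f := f)
  rw [hY, smul_neg, neg_inj] at hy
  rw [hy, ht] at h5
  push_cast at h5
  rw [add_smul, one_smul] at h5
  simpa using h5

end ScalarRelations

namespace ScalarRelations

variable {e : ι → Q} {f : Q}

theorem gsum_smul_relConj_one (S : ScalarRelations p m 1 1 x y) (i : ι) :
    gsum m y • relConj 1 1 (x i) y (e i) f = (1 - x i) • relPow m y f := by
  have hyx : y * x i = x i * y := by simpa using S.conj i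
  have hc : gsum m y * (1 - x i) = (1 - x i) * gsum m y :=
    ((Commute.one_right _).sub_right ((show Commute (x i) y from hyx.symm).gsum_right m).symm).eq
  simp only [relConj, relPow, pow_one, gsum_one_left, mul_one, smul_add, smul_smul,
    gsum_mul_sub_one, S.pow_y, sub_self, zero_smul, add_zero, hc]

/-- `B = -Y` is fixed by both `x i` and `y`. The two norm identities for `D = -B` then give `p B =
0` and `m B = 0`. -/
theorem relPow_eq_zero_of_relConj_one (S : ScalarRelations p m 1 1 x y) (hmp : m.Coprime p) {i : ι}
    (hi : relConj 1 1 (x i) y (e i) f + relPow p (x i) (e i) = 0)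
    (h : relPow m y f + relPow p (x i) (e i) = 0) : relPow p (x i) (e i) = 0 := by
  have h5 := gsum_smul_relConj (s := 1) (t := 1) (S.pow_x i) (S.norm i) (e i) f
  have hD : relConj 1 1 (x i) y (e i) f = -relPow p (x i) (e i) := eq_neg_of_add_eq_zero_left hi
  have hY : relPow m y f = -relPow p (x i) (e i) := eq_neg_of_add_eq_zero_left h
  have hy := S.smul_relPow_y (f := f)
  have hmul := S.gsum_smul_relConj_one (e := e) (f := f) i
  rw [hD, smul_neg, gsum_smul_relPow (S.pow_x i)] at h5
  rw [hY, smul_neg, neg_inj] at hy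
  rw [hD, hY, smul_neg, smul_neg, sub_smul, one_smul, _root_.smul_relPow (S.pow_x i), sub_self,
    neg_zero, neg_eq_zero, gsum_smul_of_smul_eq_self hy] at hmul
  rw [hy] at h5
  exact eq_zero_of_coprime_smul (Nat.isCoprime_iff_coprime.mpr hmp) hmul (by simpa using h5)

/-- Both `x i` and `y` act on B as `1 - p`. Their orders divide the coprime numbers `p` and `m`, so
`1 - p` acts as the identity; hence `p B = 0`, and the norm of `y` gives `m B = 0`. -/
theorem relPow_eq_zero_of_relComm_one (S : ScalarRelations p m 1 1 x y) (hmp : m.Coprime p)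
    {i j : ι} (hY : relPow m y f = 0)
    (hj : relConj 1 1 (x j) y (e j) f + relPow p (x j) (e j) = 0)
    (hij : relComm (x i) (x j) (e i) (e j) + relPow p (x j) (e j) = 0) :
    relPow p (x j) (e j) = 0 := by
  have h5 := gsum_smul_relConj (s := 1) (t := 1) (S.pow_x j) (S.norm j) (e j) f
  have hD : relConj 1 1 (x j) y (e j) f = -relPow p (x j) (e j) := eq_neg_of_add_eq_zero_left hj
  have hA : relComm (x i) (x j) (e i) (e j) = -relPow p (x j) (e j) := eq_neg_of_add_eq_zero_left hij
  have h2 := gsum_smul_relComm_right (S.comm i j) (S.pow_x j) (e i) (e j)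
  have hmul := S.gsum_smul_relConj_one (e := e) (f := f) j
  rw [hD, smul_neg, gsum_smul_relPow (S.pow_x j)] at h5
  rw [hA, smul_neg, gsum_smul_relPow (S.pow_x j)] at h2
  rw [hD, hY, smul_neg, smul_zero, neg_eq_zero] at hmul
  set B := relPow p (x j) (e j)
  have hx : x i • B = (1 - p : ℤ) • B := by
    rw [sub_smul, one_smul] at h2
    rw [sub_smul, one_smul, sub_eq_add_neg, h2]; abel
  have hy : y • B = (1 - p : ℤ) • B := by
    simp only [Nat.cast_one, one_smul] at h5
    rw [sub_smul, one_smul, sub_eq_add_neg, h5]; abel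
  have hB : (1 - p : ℤ) • B = B := by
    refine smul_eq_self_of_coprime hmp ?_ ?_
    · rw [← pow_smul_of_smul_eq hy, S.pow_y, one_smul]
    · rw [← pow_smul_of_smul_eq hx, S.pow_x, one_smul]
  have hpB : (p : ℤ) • B = 0 := by
    rw [sub_smul, one_smul] at hB
    simpa using hB
  rw [gsum_smul_of_smul_eq_self (hy.trans hB)] at hmul
  exact eq_zero_of_coprime_smul (Nat.isCoprime_iff_coprime.mpr hmp) hmul hpB

/-- The term `gsum p (x i) • Bj` added to the conjugation relator of `i` breaks the symmetry between
`i` and `j`. With `c`, `d` the cross norms of `Bj`, `Bi`, it yields `d + c = -p ^ 2 c`; without it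
the same computation would give only `d + c = 0`, which does not force `c` to vanish. -/
theorem relators_eq_zero_of_torsionFree (S : ScalarRelations p m s t x y) (hp : p ≠ 0)
    (hm : m ≠ 0) (ht : t = s + 1) {n : ℕ} (hn : t ^ m = s ^ m + p * n) (hsp : s.Coprime p)
    (htf : ∀ v : Q, (p : ℤ) • v = 0 → v = 0) {i j : ι}
    (hi : relConj s t (x i) y (e i) f + gsum p (x i) • relPow p (x j) (e j) = 0)
    (hj : relConj s t (x j) y (e j) f = 0)
    (hZ : relComm (x i) (x j) (e i) (e j) + relPow m y f + relPow p (x i) (e i)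
      + relPow p (x j) (e j) = 0) :
    relPow p (x i) (e i) = 0 ∧ relPow p (x j) (e j) = 0 ∧ relPow m y f = 0 ∧
      relComm (x i) (x j) (e i) (e j) = 0 := by
  have hA1 := gsum_smul_relComm_right (S.comm i j) (S.pow_x j) (e i) (e j)
  have hA2 := gsum_smul_relComm_left (S.comm i j) (S.pow_x i) (e i) (e j)
  have hA3 := relConj_relComm (S.comm i j) (S.conj i) (S.conj j) (e i) (e j) f
  have hBj := S.smul_smul_relPow hj
  have hBi := gsum_smul_relConj (s := s) (t := t) (S.pow_x i) (S.norm i) (e i) f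
  have hDi : relConj s t (x i) y (e i) f = -(gsum p (x i) • relPow p (x j) (e j)) :=
    eq_neg_of_add_eq_zero_left hi
  have hY := S.smul_relPow_y (f := f)
  have hxi := fun n => gsum_smul_relPow (S.pow_x i) n (e i)
  have hxj := fun n => gsum_smul_relPow (S.pow_x j) n (e j)
  have hGi : ∀ v : Q, gsum p (x i) • gsum p (x i) • v = (p : ℤ) • gsum p (x i) • v := fun v =>
    gsum_smul_relPow (S.pow_x i) p v
  have hGij : ∀ v : Q, gsum p (x i) • gsum p (x j) • v = gsum p (x j) • gsum p (x i) • v :=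
    fun v => by rw [smul_smul, smul_smul, ((S.comm i j).gsum_gsum p p).eq]
  have hyG : ∀ (l : ι) (v : Q), y • gsum p (x l) • v = gsum p (x l) • y • v := fun l v => by
    rw [smul_smul, smul_smul, (S.norm l).eq]
  have hGx : ∀ (l : ι) (v : Q), gsum p (x l) • (x l - 1) • v = 0 := fun l v => by
    rw [smul_smul, gsum_mul_sub_one, S.pow_x, sub_self, zero_smul]
  have hdi := fun hD => sub_smul_relPow_of_relConj_eq_zero (e := e i) (f := f) (S.pow_x i) hn
    (S.conj i) S.pow_y hD
  have hdj := sub_smul_relPow_of_relConj_eq_zero (e := e j) (f := f) (S.pow_x j) hn (S.conj j)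
    S.pow_y hj
  rw [hDi, smul_neg, hGi] at hBi
  set A := relComm (x i) (x j) (e i) (e j)
  set Bi := relPow p (x i) (e i)
  set Bj := relPow p (x j) (e j)
  set Y := relPow m y f
  -- The product of the two norms annihilates A and turns the B's into `p` times the cross norms.
  have hN : gsum p (x i) • gsum p (x j) • Y + (p : ℤ) • (gsum p (x j) • Bi + gsum p (x i) • Bj)
      = 0 := by
    have := congrArg (fun v => gsum p (x i) • gsum p (x j) • v) hZ
    simp only [smul_add, smul_zero, hA1, hGx, zero_add, hxj] at this
    rw [hGij Bi, hxi, smul_comm _ (p : ℤ), smul_comm _ (p : ℤ)] at this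
    rw [smul_add, ← add_assoc]
    exact this
  have hBji := congrArg (fun v => gsum p (x i) • v) hBj
  have hBij := congrArg (fun v => gsum p (x j) • v) hBi
  simp only [smul_neg, smul_sub] at hBij
  rw [smul_comm _ (p : ℤ), ← hGij, hxj, smul_comm _ (p : ℤ), smul_comm _ (t : ℤ), ← hyG,
    smul_comm _ (s : ℤ)] at hBij
  beta_reduce at hBji
  rw [smul_comm _ (t : ℤ), ← hyG, smul_comm _ (s : ℤ)] at hBji
  have hc0 : gsum p (x i) • Bj = 0 ∧ gsum p (x j) • Bi = 0 := by
    have h1 := congrArg (fun v => y • v) hN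
    simp only [smul_add, hyG, hY, smul_zero] at h1
    simp only [smul_comm y (p : ℤ)] at h1
    set c := gsum p (x i) • Bj
    set d := gsum p (x j) • Bi
    -- By `hN`, `p (d + c)` is minus a norm of Y, which `y` fixes; absence of `p`-torsion removes
    -- the factor `p`.
    have hw : y • (d + c) = d + c := by
      rw [← sub_eq_zero]
      apply htf
      have := h1.trans hN.symm
      rw [add_right_inj] at this
      rw [smul_sub, smul_add, smul_add, this, sub_self]
    have hw' : d + c = -((p : ℤ) • (p : ℤ) • c) := by
      have h2 : (t : ℤ) • y • (d + c) = (s : ℤ) • (d + c) - (p : ℤ) • (p : ℤ) • c := by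
        have h3 : (t : ℤ) • y • d = (s : ℤ) • d - (p : ℤ) • (p : ℤ) • c := by
          rw [sub_eq_add_neg, hBij]; abel
        rw [smul_add, smul_add, hBji, smul_add, h3]
        abel
      rw [hw, ht] at h2
      push_cast at h2
      rw [add_smul, one_smul, sub_eq_add_neg, add_right_inj] at h2
      exact h2
    have hyc : y • c = c := by
      rw [← sub_eq_zero]
      refine htf _ (htf _ ?_)
      rw [hw', smul_neg, neg_inj, smul_comm y, smul_comm y] at hw
      rw [smul_sub, smul_sub, hw, sub_self]
    -- `y` fixes `c`, while `t y c = s c` and `t = s + 1`.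
    have hc : c = 0 := by
      rw [hyc, ht] at hBji
      push_cast at hBji
      rw [add_smul, one_smul] at hBji
      simpa using hBji
    refine ⟨hc, ?_⟩
    rw [hc] at hw'
    simpa using hw'
  obtain ⟨hc, hd⟩ := hc0
  have hYx : ∀ l, (1 - x l ^ s ^ m) • Y = 0 → x l • Y = Y := fun l hl => by
    refine smul_eq_self_of_coprime (Nat.Coprime.pow_left m hsp) ?_ (by rw [S.pow_x, one_smul])
    rw [sub_smul, one_smul, sub_eq_zero] at hl
    exact hl.symm
  -- The norm of `x l` annihilates `1 - x l ^ s ^ m`, which leaves `p n B = 0`, hence `n B = 0`.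
  -- Then `x l ^ s ^ m` fixes Y, and so does `x l` because `s` is prime to `p`.
  have hnB : ∀ (l : ι) (B : Q), (∀ k, gsum k (x l) • B = (k : ℤ) • B) →
      (1 - x l ^ s ^ m) • Y + (n : ℤ) • B = 0 → x l • Y = Y := fun l B hB h => by
    apply hYx
    have h0 : gsum p (x l) * (1 - x l ^ s ^ m) = 0 := by
      rw [mul_sub, mul_one, ← (((Commute.refl (x l)).pow_left _).gsum_right p).eq,
        pow_mul_gsum_of_pow_eq_one (S.pow_x l), sub_self]
    have h1 := congrArg (fun v => gsum p (x l) • v) h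
    simp only [smul_add, smul_smul, h0, zero_smul, zero_add, smul_zero] at h1
    rw [smul_comm, hB, smul_comm] at h1
    rw [htf _ h1, add_zero] at h
    exact h
  rw [hc, neg_zero] at hDi
  rw [hc, smul_zero, neg_zero, eq_comm, sub_eq_zero] at hBi
  have hYi := hnB i Bi hxi (hdi hDi)
  have hYj := hnB j Bj hxj hdj
  have hY0 : Y = 0 := by
    rw [hc, hd, add_zero, smul_zero, add_zero, gsum_smul_of_smul_eq_self hYj, smul_comm,
      gsum_smul_of_smul_eq_self hYi] at hN
    exact htf _ (htf _ hN)
  rw [hY0, add_zero] at hZ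
  have hA : A = -(Bi + Bj) := by rw [add_assoc] at hZ; exact eq_neg_of_add_eq_zero_left hZ
  have hxBj : x i • Bj = (1 - p : ℤ) • Bj := by
    rw [hA, smul_neg, smul_add, hd, zero_add, hxj, sub_smul, one_smul, eq_sub_iff_add_eq] at hA1
    rw [sub_smul, one_smul, ← hA1]; abel
  have hxBi : x j • Bi = (1 + p : ℤ) • Bi := by
    rw [hA, smul_neg, smul_add, hc, add_zero, hxi, neg_inj, sub_smul, one_smul,
      eq_sub_iff_add_eq] at hA2
    rw [add_smul, one_smul, ← hA2]; abel
  -- Now `x i` acts on `Bj` as `1 - p` and `x j` on `Bi` as `1 + p`. Again only the last terms of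
  -- the geometric sums survive, by `t = s + 1`.
  have key : (s : ℤ) • ((1 + p : ℤ) ^ s • Bi + (1 - p : ℤ) ^ s • Bj) = 0 := by
    have e1 : (y * (gsum t (x i) * gsum t (x j))) • Bi = gsum t (1 + p : ℤ) • (s : ℤ) • Bi := by
      rw [mul_smul, mul_smul, gsum_smul_of_smul_eq hxBi, smul_comm (gsum t (x i)), hxi, ← hBi,
        smul_comm y, smul_comm y]
    have e2 : (y * (gsum t (x i) * gsum t (x j))) • Bj = gsum t (1 - p : ℤ) • (s : ℤ) • Bj := by
      rw [mul_smul, mul_smul, hxj, smul_comm (gsum t (x i)), gsum_smul_of_smul_eq hxBj, ← hBj,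
        smul_comm y, smul_comm y, smul_comm (t : ℤ)]
    have e3 : (gsum s (x i) * gsum s (x j)) • Bi = gsum s (1 + p : ℤ) • (s : ℤ) • Bi := by
      rw [mul_smul, gsum_smul_of_smul_eq hxBi, smul_comm (gsum s (x i)), hxi]
    have e4 : (gsum s (x i) * gsum s (x j)) • Bj = gsum s (1 - p : ℤ) • (s : ℤ) • Bj := by
      rw [mul_smul, hxj, smul_comm (gsum s (x i)), gsum_smul_of_smul_eq hxBj, smul_comm]
    rw [hDi, hj, smul_zero, smul_zero, sub_zero, hA, smul_neg, smul_neg, smul_add, smul_add,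
      e1, e2, e3, e4, ht, gsum_succ, gsum_succ, add_smul, add_smul] at hA3
    rw [smul_add, smul_comm (s : ℤ), smul_comm (s : ℤ), ← neg_eq_zero, ← hA3]
    abel
  have hBi0 : Bi = 0 := by
    have h1 := congrArg (fun v => gsum p (x i) • v) key
    simp only [smul_comm (gsum p (x i)) (_ : ℤ), smul_add, hc, smul_zero, add_zero, hxi] at h1
    rw [smul_comm _ (p : ℤ), smul_comm _ (p : ℤ)] at h1
    have h2 := htf _ h1
    rw [smul_comm] at h2
    have h3 := eq_zero_of_pow_smul_eq_zero hp (S.pow_x j)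
      (by rw [smul_comm, hxBi, smul_comm]) h2
    rw [ht] at hBi
    exact eq_zero_of_smul_smul_eq hm S.pow_y hBi.symm.symm h3
  refine ⟨hBi0, ?_, hY0, ?_⟩ <;> have hBj0 : Bj = 0 := by
    rw [hBi0, smul_zero, zero_add, smul_comm] at key
    have h3 := eq_zero_of_pow_smul_eq_zero hp (S.pow_x i)
      (by rw [smul_comm, hxBj, smul_comm]) key
    rw [ht] at hBj
    exact eq_zero_of_smul_smul_eq hm S.pow_y hBj h3
  · exact hBj0
  · rw [hA, hBi0, hBj0, add_zero, neg_zero]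

end ScalarRelations

end Generation

end

section

open Finset

/-! ### Nakayama's lemma for commuting elements of order dividing an odd prime. -/

section Nakayama

variable {R : Type*} [Ring R] {Q : Type*} [AddCommGroup Q] [Module R Q]

/-- In the binomial expansion the two end terms are `x ^ p = 1` and `(-1) ^ p = -1`, the latter
because `p` is odd. -/
theorem exists_sub_one_pow_prime_eq {p : ℕ} (hp : p.Prime) (h2 : p ≠ 2) {x : R} (hx : x ^ p = 1) :
    ∃ z : R, (x - 1) ^ p = (p : R) * z := by
  obtain ⟨z, hz⟩ := (Commute.neg_one_right x).exists_add_pow_prime_eq hp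
  refine ⟨x * -1 * z, ?_⟩
  rw [sub_eq_add_neg, hz, hx, (hp.odd_of_ne_two h2).neg_one_pow, add_neg_cancel, zero_add,
    mul_assoc (p : R), mul_assoc (p : R)]

/-- The commuting elements `x - 1` and `x' - 1` are nilpotent modulo `p`, so iterating the
decomposition pushes both contributions into `p P`. -/
theorem exists_eq_smul_of_le_augmentation {p : ℕ} (hp : p.Prime) (h2 : p ≠ 2) {x x' : R}
    (hc : Commute x x') (hx : x ^ p = 1) (hx' : x' ^ p = 1) {P : Submodule R Q}
    (hP : ∀ v ∈ P, ∃ u ∈ P, ∃ w ∈ P, ∃ z ∈ P, v = (p : ℤ) • u + (x - 1) • w + (x' - 1) • z) :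
    ∀ v ∈ P, ∃ u ∈ P, v = (p : ℤ) • u := by
  have hz : ∀ n : ℤ, ∀ v ∈ P, n • v ∈ P := fun n v hv => P.toAddSubgroup.zsmul_mem hv n
  have hpow : ∀ {g : R}, g ^ p = 1 → ∀ v ∈ P, ∃ u ∈ P, (g - 1) ^ p • v = (p : ℤ) • u := by
    intro g hg v hv
    obtain ⟨z, h⟩ := exists_sub_one_pow_prime_eq hp h2 hg
    exact ⟨z • v, P.smul_mem _ hv, by
      rw [h, mul_smul, Nat.cast_smul_eq_nsmul R, natCast_zsmul]⟩
  have hcc : ∀ n : ℕ, (x - 1) ^ n * (x' - 1) = (x' - 1) * (x - 1) ^ n := fun n =>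
    (((hc.sub_left (Commute.one_left _)).sub_right (Commute.one_right _)).pow_left n).eq
  have step : ∀ n : ℕ, ∀ v ∈ P, ∃ u ∈ P, ∃ w ∈ P, ∃ z ∈ P,
      v = (p : ℤ) • u + (x - 1) ^ n • w + (x' - 1) • z := by
    intro n
    induction n with
    | zero => exact fun v hv => ⟨0, P.zero_mem, v, hv, 0, P.zero_mem, by simp⟩
    | succ n ih =>
      intro v hv
      obtain ⟨u, hu, w, hw, z, hz', rfl⟩ := ih v hv
      obtain ⟨u1, hu1, w1, hw1, z1, hz1, rfl⟩ := hP w hw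
      refine ⟨u + (x - 1) ^ n • u1, P.add_mem hu (P.smul_mem _ hu1), w1, hw1,
        z + (x - 1) ^ n • z1, P.add_mem hz' (P.smul_mem _ hz1), ?_⟩
      simp only [smul_add, smul_smul, ← pow_succ, hcc, smul_comm _ (p : ℤ)]
      abel
  have step' : ∀ v ∈ P, ∃ u ∈ P, ∃ z ∈ P, v = (p : ℤ) • u + (x' - 1) • z := by
    intro v hv
    obtain ⟨u, hu, w, hw, z, hz', rfl⟩ := step p v hv
    obtain ⟨u1, hu1, h⟩ := hpow hx w hw
    exact ⟨u + u1, P.add_mem hu hu1, z, hz', by rw [h, smul_add]⟩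
  have step2 : ∀ n : ℕ, ∀ v ∈ P, ∃ u ∈ P, ∃ z ∈ P, v = (p : ℤ) • u + (x' - 1) ^ n • z := by
    intro n
    induction n with
    | zero => exact fun v hv => ⟨0, P.zero_mem, v, hv, by simp⟩
    | succ n ih =>
      intro v hv
      obtain ⟨u, hu, w, hw, rfl⟩ := ih v hv
      obtain ⟨u1, hu1, z1, hz1, rfl⟩ := step' w hw
      refine ⟨u + (x' - 1) ^ n • u1, P.add_mem hu (P.smul_mem _ hu1), z1, hz1, ?_⟩
      simp only [smul_add, smul_smul, ← pow_succ, smul_comm _ (p : ℤ)]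
      abel
  intro v hv
  obtain ⟨u, hu, w, hw, rfl⟩ := step2 p v hv
  obtain ⟨u1, hu1, h⟩ := hpow hx' w hw
  exact ⟨u + u1, P.add_mem hu hu1, by rw [h, smul_add]⟩

/-- The elements annihilated by a power of `p`. -/
def powTorsion (R : Type*) [Ring R] (Q : Type*) [AddCommGroup Q] [Module R Q] (p : ℕ) :
    Submodule R Q where
  carrier := {v | ∃ c : ℕ, ((p : ℤ) ^ c) • v = 0}
  add_mem' := by
    rintro v w ⟨c, hc⟩ ⟨d, hd⟩
    refine ⟨c + d, ?_⟩
    rw [smul_add, pow_add, mul_comm, mul_smul, hc, mul_comm, mul_smul, hd]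
    simp
  zero_mem' := ⟨0, by simp⟩
  smul_mem' := by
    rintro r v ⟨c, hc⟩
    exact ⟨c, by rw [smul_comm, hc, smul_zero]⟩

theorem powTorsion_torsionFree (p : ℕ) (v : Q ⧸ powTorsion R Q p) (hv : (p : ℤ) • v = 0) :
    v = 0 := by
  obtain ⟨w, rfl⟩ := Submodule.Quotient.mk_surjective _ v
  rw [← Submodule.Quotient.mk_smul, Submodule.Quotient.mk_eq_zero] at hv
  obtain ⟨c, hc⟩ := hv
  rw [Submodule.Quotient.mk_eq_zero]
  exact ⟨c + 1, by rw [pow_succ, mul_smul, hc]⟩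

/-- The span equals `p` times itself, hence any `p`-power times itself, while its finitely many
generators are killed by a common power of `p`. -/
theorem eq_bot_of_le_augmentation {p : ℕ} (hp : p.Prime) (h2 : p ≠ 2) {x x' : R}
    (hc : Commute x x') (hx : x ^ p = 1) (hx' : x' ^ p = 1) {s : Finset Q}
    (hs : ∀ v ∈ s, v ∈ powTorsion R Q p)
    (hP : ∀ v ∈ Submodule.span R (s : Set Q), ∃ u ∈ Submodule.span R (s : Set Q),
      ∃ w ∈ Submodule.span R (s : Set Q), ∃ z ∈ Submodule.span R (s : Set Q),
      v = (p : ℤ) • u + (x - 1) • w + (x' - 1) • z) :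
    ∀ v ∈ s, v = 0 := by
  choose! c hc' using hs
  have key : ∀ v ∈ Submodule.span R (s : Set Q), ((p : ℤ) ^ (∑ v ∈ s, c v)) • v = 0 := by
    intro v hv
    induction hv using Submodule.span_induction with
    | mem v hv =>
      obtain ⟨d, hd⟩ := Nat.exists_eq_add_of_le' (single_le_sum (f := c) (fun _ _ => Nat.zero_le _) hv)
      rw [hd, pow_add, mul_smul, hc' v hv, smul_zero]
    | zero => simp
    | add v w _ _ hv hw => rw [smul_add, hv, hw, add_zero]
    | smul r v _ hv => rw [smul_comm, hv, smul_zero]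
  have h1 := exists_eq_smul_of_le_augmentation hp h2 hc hx hx' hP
  have h3 : ∀ n : ℕ, ∀ v ∈ Submodule.span R (s : Set Q), ∃ u ∈ Submodule.span R (s : Set Q),
      v = ((p : ℤ) ^ n) • u := by
    intro n
    induction n with
    | zero => exact fun v hv => ⟨v, hv, by simp⟩
    | succ n ih =>
      intro v hv
      obtain ⟨u, hu, rfl⟩ := ih v hv
      obtain ⟨w, hw, rfl⟩ := h1 u hu
      exact ⟨w, hw, by rw [pow_succ, mul_smul]⟩
  intro v hv
  obtain ⟨u, hu, rfl⟩ := h3 (∑ v ∈ s, c v) v (Submodule.subset_span hv)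
  exact key u hu

end Nakayama

namespace ScalarRelations

variable {R : Type*} [Ring R] {Q : Type*} [AddCommGroup Q] [Module R Q]
  {ι : Type*} {p m s t : ℕ} {x : ι → R} {y : R} {e : ι → Q} {f : Q}

/-- The residual case modulo `p` and the augmentation of `E_k`. The iterated conjugation identity
reduces to `n B = 0`, which kills both B's. This leaves `A = -Y`, fixed by `y`, and the identity
between D and A becomes `(s + t) A = 0`. -/
theorem relators_eq_zero_of_smul_eq_self (S : ScalarRelations p m s t x y)
    (ht : t = s + 1) {n : ℕ} (hn : t ^ m = s ^ m + p * n) (hnp : n.Coprime p)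
    (hst : (s + t).Coprime p) {i j : ι}
    (hi : relConj s t (x i) y (e i) f + gsum p (x i) • relPow p (x j) (e j) = 0)
    (hj : relConj s t (x j) y (e j) f = 0)
    (hZ : relComm (x i) (x j) (e i) (e j) + relPow m y f + relPow p (x i) (e i)
      + relPow p (x j) (e j) = 0)
    (hx : ∀ v ∈ ({relComm (x i) (x j) (e i) (e j), relPow m y f, relPow p (x i) (e i),
      relPow p (x j) (e j)} : Set Q), x i • v = v ∧ x j • v = v ∧ (p : ℤ) • v = 0) :
    ∀ v ∈ ({relComm (x i) (x j) (e i) (e j), relPow m y f, relPow p (x i) (e i),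
      relPow p (x j) (e j)} : Set Q), v = 0 := by
  have hA3 := relConj_relComm (S.comm i j) (S.conj i) (S.conj j) (e i) (e j) f
  have hdi := fun hD => sub_smul_relPow_of_relConj_eq_zero (e := e i) (f := f) (S.pow_x i) hn
    (S.conj i) S.pow_y hD
  have hdj := sub_smul_relPow_of_relConj_eq_zero (e := e j) (f := f) (S.pow_x j) hn (S.conj j)
    S.pow_y hj
  have hY := S.smul_relPow_y (f := f)
  set A := relComm (x i) (x j) (e i) (e j)
  set Bi := relPow p (x i) (e i)
  set Bj := relPow p (x j) (e j)
  set Y := relPow m y f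
  simp only [Set.mem_insert_iff, Set.mem_singleton_iff, forall_eq_or_imp, forall_eq] at hx ⊢
  obtain ⟨⟨hA1, hA2, hA⟩, ⟨hY1, hY2, -⟩, ⟨-, -, hBi⟩, ⟨-, -, hBj⟩⟩ := hx
  have hpow : ∀ (g : R) (k : ℕ), g • Y = Y → (1 - g ^ k) • Y = 0 := fun g k hg => by
    have := pow_smul_of_smul_eq (b := 1) (by simpa using hg) k
    rw [one_pow, one_smul] at this
    rw [sub_smul, one_smul, this, sub_self]
  have hnp' := Nat.isCoprime_iff_coprime.mpr hnp
  rw [hpow _ _ hY2, zero_add] at hdj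
  have hBj0 : Bj = 0 := eq_zero_of_coprime_smul hnp' hdj hBj
  rw [hBj0, smul_zero, add_zero] at hi
  have hdi' := hdi hi
  rw [hpow _ _ hY1, zero_add] at hdi'
  have hBi0 : Bi = 0 := eq_zero_of_coprime_smul hnp' hdi' hBi
  rw [hBi0, hBj0, add_zero, add_zero] at hZ
  have hAY : A = -Y := eq_neg_of_add_eq_zero_left hZ
  have hyA : y • A = A := by rw [hAY, smul_neg, hY]
  rw [hi, hj, smul_zero, smul_zero, sub_zero, mul_smul, mul_smul, mul_smul,
    gsum_smul_of_smul_eq_self hA2, gsum_smul_of_smul_eq_self hA2, smul_comm _ (_ : ℤ),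
    smul_comm (gsum s (x i)) (_ : ℤ), gsum_smul_of_smul_eq_self hA1, gsum_smul_of_smul_eq_self hA1,
    smul_comm y, smul_comm y, hyA, smul_smul, smul_smul, ← sub_smul] at hA3
  have h1 : (t * t - s * s : ℤ) = ((s + t : ℕ) : ℤ) := by subst ht; push_cast; ring
  rw [h1] at hA3
  have hA0 : A = 0 := eq_zero_of_coprime_smul (Nat.isCoprime_iff_coprime.mpr hst) hA3 hA
  exact ⟨hA0, by rwa [hA0, eq_comm, neg_eq_zero] at hAY, hBi0, hBj0⟩

/-- Modulo `p`-power torsion the relators vanish by `relators_eq_zero_of_torsionFree`, so their span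
`P` is torsion. Modulo `p P + (x i - 1) P + (x j - 1) P` they vanish by
`relators_eq_zero_of_smul_eq_self`, and Nakayama's lemma gives `P = 0`. -/
theorem relators_eq_zero_of_pair (S : ScalarRelations p m s t x y) (hp : p.Prime) (h2 : p ≠ 2)
    (hm : m ≠ 0) (hnorm : ∀ (i : ι) (r : R), ∃ r', r * (x i - 1) = (x i - 1) * r')
    (ht : t = s + 1) {n : ℕ} (hn : t ^ m = s ^ m + p * n) (hnp : n.Coprime p)
    (hsp : s.Coprime p) (hst : (s + t).Coprime p) {i j : ι}
    (hi : relConj s t (x i) y (e i) f + gsum p (x i) • relPow p (x j) (e j) = 0)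
    (hj : relConj s t (x j) y (e j) f = 0)
    (hZ : relComm (x i) (x j) (e i) (e j) + relPow m y f + relPow p (x i) (e i)
      + relPow p (x j) (e j) = 0) :
    relPow p (x i) (e i) = 0 ∧ relPow p (x j) (e j) = 0 ∧ relPow m y f = 0 ∧
      relComm (x i) (x j) (e i) (e j) = 0 := by
  classical
  set s4 : Finset Q := {relComm (x i) (x j) (e i) (e j), relPow m y f, relPow p (x i) (e i),
      relPow p (x j) (e j)} with hs4
  suffices h : ∀ v ∈ s4, v = 0 by
    simp only [hs4, mem_insert, mem_singleton, forall_eq_or_imp, forall_eq] at h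
    exact ⟨h.2.2.1, h.2.2.2, h.2.1, h.1⟩
  refine eq_bot_of_le_augmentation hp h2 (S.comm i j) (S.pow_x i) (S.pow_x j) ?_ ?_
  · set q := (powTorsion R Q p).mkQ
    have := S.relators_eq_zero_of_torsionFree (e := fun i => q (e i)) (f := q f) hp.ne_zero hm ht hn
      hsp (powTorsion_torsionFree p) (i := i) (j := j)
      (by rw [← map_relConj, ← map_relPow, ← map_smul, ← map_add, hi, map_zero])
      (by rw [← map_relConj, hj, map_zero])
      (by rw [← map_relComm, ← map_relPow, ← map_relPow, ← map_relPow, ← map_add, ← map_add,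
        ← map_add, hZ, map_zero])
    simp only [← map_relComm, ← map_relPow] at this
    simp only [q, Submodule.mkQ_apply, Submodule.Quotient.mk_eq_zero] at this
    simp only [hs4, mem_insert, mem_singleton, forall_eq_or_imp, forall_eq]
    exact ⟨this.2.2.2, this.2.2.1, this.1, this.2.1⟩
  · set P := Submodule.span R (s4 : Set Q)
    -- Stability under scalars uses `hnorm`, which moves `x i - 1` and `x j - 1` to the left of any
    -- scalar.
    let W : Submodule R Q :=
      { carrier := {v | ∃ u ∈ P, ∃ w ∈ P, ∃ z ∈ P, v = (p : ℤ) • u + (x i - 1) • w + (x j - 1) • z}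
        add_mem' := by
          rintro _ _ ⟨u, hu, w, hw, z, hz, rfl⟩ ⟨u', hu', w', hw', z', hz', rfl⟩
          refine ⟨u + u', P.add_mem hu hu', w + w', P.add_mem hw hw', z + z', P.add_mem hz hz', ?_⟩
          simp only [smul_add]; abel
        zero_mem' := ⟨0, P.zero_mem, 0, P.zero_mem, 0, P.zero_mem, by simp⟩
        smul_mem' := by
          rintro r _ ⟨u, hu, w, hw, z, hz, rfl⟩
          obtain ⟨r1, h1⟩ := hnorm i r
          obtain ⟨r2, h2⟩ := hnorm j r
          refine ⟨r • u, P.smul_mem _ hu, r1 • w, P.smul_mem _ hw, r2 • z, P.smul_mem _ hz, ?_⟩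
          simp only [smul_add, smul_smul, h1, h2, smul_comm r (p : ℤ)] }
    suffices h : P ≤ W from fun v hv => h hv
    set q := W.mkQ
    have key := S.relators_eq_zero_of_smul_eq_self (e := fun i => q (e i)) (f := q f) ht hn hnp
      hst (i := i) (j := j)
      (by rw [← map_relConj, ← map_relPow, ← map_smul, ← map_add, hi, map_zero])
      (by rw [← map_relConj, hj, map_zero])
      (by rw [← map_relComm, ← map_relPow, ← map_relPow, ← map_relPow, ← map_add, ← map_add,
        ← map_add, hZ, map_zero])
    have hfix : ∀ v ∈ s4, x i • q v = q v ∧ x j • q v = q v ∧ (p : ℤ) • q v = 0 := by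
      intro v hv
      have hvP : v ∈ P := Submodule.subset_span hv
      have h1 : (x i - 1) • v ∈ W := ⟨0, P.zero_mem, v, hvP, 0, P.zero_mem, by simp⟩
      have h2 : (x j - 1) • v ∈ W := ⟨0, P.zero_mem, 0, P.zero_mem, v, hvP, by simp⟩
      have h3 : (p : ℤ) • v ∈ W := ⟨v, hvP, 0, P.zero_mem, 0, P.zero_mem, by simp⟩
      rw [← Submodule.Quotient.mk_eq_zero, Submodule.Quotient.mk_smul] at h1 h2 h3
      rw [sub_smul, one_smul, sub_eq_zero] at h1 h2
      exact ⟨h1, h2, h3⟩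
    simp only [← map_relComm, ← map_relPow] at key
    simp only [hs4, mem_insert, mem_singleton, forall_eq_or_imp, forall_eq] at hfix
    simp only [Set.mem_insert_iff, Set.mem_singleton_iff, forall_eq_or_imp, forall_eq] at key
    have k := key hfix
    simp only [q, Submodule.mkQ_apply, Submodule.Quotient.mk_eq_zero] at k
    rw [Submodule.span_le]
    intro v hv
    simp only [hs4, coe_insert, coe_singleton, Set.mem_insert_iff, Set.mem_singleton_iff] at hv
    rcases hv with rfl | rfl | rfl | rfl
    exacts [k.1, k.2.1, k.2.2.1, k.2.2.2]

end ScalarRelations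

end

section

open Finset

/-! ### The small families of relators generate all relators. -/

section Families

variable {R : Type*} [Ring R] {Q Q' : Type*} [AddCommGroup Q] [Module R Q] [AddCommGroup Q']
  [Module R Q'] {ι : Type*} [LinearOrder ι]

/-- All defining relators of `(ℤ/p)^ι ⋊ ℤ/m` vanish. -/
structure RelatorsVanish (p m s t : ℕ) (x : ι → R) (y : R) (e : ι → Q) (f : Q) : Prop where
  comm : ∀ i j, relComm (x i) (x j) (e i) (e j) = 0
  pow : ∀ i, relPow p (x i) (e i) = 0
  conj : ∀ i, relConj s t (x i) y (e i) f = 0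
  pow_y : relPow m y f = 0

/-- The commutator relator of a pair, modified by a power relator if `o` is a member. -/
def pairRelator (p : ℕ) (o : ι) (x : ι → R) (e : ι → Q) (q : {q : ι × ι // q.1 < q.2}) : Q :=
  relComm (x q.1.1) (x q.1.2) (e q.1.1) (e q.1.2) +
    if q.1.1 = o then relPow p (x q.1.2) (e q.1.2) else 0

/-- A generating family of relators that is minimal when the action is trivial (`b = true`) or by
a character of order two (`b = false`). -/
def relatorsInvolutive (p m s t : ℕ) (b : Bool) (o : ι) (x : ι → R) (y : R) (e : ι → Q) (f : Q) :
    (ι ⊕ {q : ι × ι // q.1 < q.2}) ⊕ Unit → Q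
  | .inl (.inl i) => relConj s t (x i) y (e i) f + bif b then relPow p (x i) (e i) else 0
  | .inl (.inr q) => pairRelator p o x e q
  | .inr _ => relPow m y f + relPow p (x o) (e o)

/-- A generating family of relators that is minimal when the square of the character of the action
is nontrivial. -/
def relatorsGeneric (p m s t : ℕ) (o o' : ι) (x : ι → R) (y : R) (e : ι → Q) (f : Q) :
    ι ⊕ {q : ι × ι // q.1 < q.2} → Q
  | .inl i => relConj s t (x i) y (e i) f +
      if i = o then gsum p (x o) • relPow p (x o') (e o') else 0
  | .inr q => pairRelator p o x e q +
      if q.1 = (o, o') then relPow m y f + relPow p (x o) (e o) else 0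

theorem map_pairRelator (g : Q →ₗ[R] Q') (p : ℕ) (o : ι) (x : ι → R) (e : ι → Q)
    (q : {q : ι × ι // q.1 < q.2}) :
    g (pairRelator p o x e q) = pairRelator p o x (fun i => g (e i)) q := by
  simp only [pairRelator, map_add, map_relComm, apply_ite g, map_relPow, map_zero]

theorem map_relatorsInvolutive (g : Q →ₗ[R] Q') (p m s t : ℕ) (b : Bool) (o : ι) (x : ι → R)
    (y : R) (e : ι → Q) (f : Q) (j) :
    g (relatorsInvolutive p m s t b o x y e f j) =
      relatorsInvolutive p m s t b o x y (fun i => g (e i)) (g f) j := by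
  rcases j with (i | q) | _
  · cases b <;> simp [relatorsInvolutive, map_relConj, map_relPow]
  · exact map_pairRelator g p o x e q
  · simp [relatorsInvolutive, map_relPow]

theorem map_relatorsGeneric (g : Q →ₗ[R] Q') (p m s t : ℕ) (o o' : ι) (x : ι → R)
    (y : R) (e : ι → Q) (f : Q) (j) :
    g (relatorsGeneric p m s t o o' x y e f j) =
      relatorsGeneric p m s t o o' x y (fun i => g (e i)) (g f) j := by
  rcases j with i | q
  · simp only [relatorsGeneric, map_add, map_relConj, apply_ite g, map_relPow, map_zero, map_smul]
  · simp only [relatorsGeneric, map_add, apply_ite g, map_relPow, map_zero, map_pairRelator]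

variable {p m s t : ℕ} {x : ι → R} {y : R} {e : ι → Q} {f : Q}

theorem relComm_eq_zero_of_pairRelator {o : ι}
    (hpair : ∀ q, pairRelator p o x e q = 0) (hpow : ∀ i, relPow p (x i) (e i) = 0) (i j : ι) :
    relComm (x i) (x j) (e i) (e j) = 0 := by
  have hlt : ∀ {i j : ι}, i < j → relComm (x i) (x j) (e i) (e j) = 0 := fun {i j} hij => by
    have := hpair ⟨(i, j), hij⟩
    simpa [pairRelator, hpow] using this
  rcases lt_trichotomy i j with h | rfl | h
  · exact hlt h
  · simp [relComm]
  · rw [show relComm (x i) (x j) (e i) (e j) = -relComm (x j) (x i) (e j) (e i) by simp [relComm],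
      hlt h, neg_zero]

/-- The relators at `o` kill `B_o`, then Y. Minimality of `o` pairs it with every other index, so
each remaining B occurs in a commutator relator and dies too. -/
theorem relatorsVanish_of_trivial (S : ScalarRelations p m 1 1 x y) (hmp : m.Coprime p) {o : ι}
    (ho : ∀ j, j ≠ o → o < j) (h : ∀ j, relatorsInvolutive p m 1 1 true o x y e f j = 0) :
    RelatorsVanish p m 1 1 x y e f := by
  have hconj : ∀ i, relConj 1 1 (x i) y (e i) f + relPow p (x i) (e i) = 0 := fun i =>
    h (.inl (.inl i))
  have hY : relPow m y f + relPow p (x o) (e o) = 0 := h (.inr ())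
  have hpair : ∀ q, pairRelator p o x e q = 0 := fun q => h (.inl (.inr q))
  have hB : relPow p (x o) (e o) = 0 := S.relPow_eq_zero_of_relConj_one hmp (hconj o) hY
  rw [hB, add_zero] at hY
  have hpow : ∀ i, relPow p (x i) (e i) = 0 := fun i => by
    by_cases hi : i = o
    · rw [hi, hB]
    · have := hpair ⟨(o, i), ho i hi⟩
      simp only [pairRelator, if_true] at this
      exact S.relPow_eq_zero_of_relComm_one hmp hY (hconj i) this
  exact ⟨relComm_eq_zero_of_pairRelator hpair hpow, hpow,
    fun i => by simpa [hpow] using hconj i, hY⟩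

theorem relatorsVanish_of_involutive (S : ScalarRelations p m s t x y) (hp : p ≠ 0) (hm : m ≠ 0)
    (ht : t = s + 1) {o : ι}
    (ho : ∀ j, j ≠ o → o < j) (h : ∀ j, relatorsInvolutive p m s t false o x y e f j = 0) :
    RelatorsVanish p m s t x y e f := by
  have hconj : ∀ i, relConj s t (x i) y (e i) f = 0 := fun i => by
    simpa [relatorsInvolutive] using h (.inl (.inl i))
  have hY : relPow m y f + relPow p (x o) (e o) = 0 := h (.inr ())
  have hpair : ∀ q, pairRelator p o x e q = 0 := fun q => h (.inl (.inr q))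
  have hB : relPow p (x o) (e o) = 0 := S.relPow_eq_zero_of_add_eq_zero ht (hconj o) hY
  rw [hB, add_zero] at hY
  have hpow : ∀ i, relPow p (x i) (e i) = 0 := fun i => by
    by_cases hi : i = o
    · rw [hi, hB]
    · have := hpair ⟨(o, i), ho i hi⟩
      simp only [pairRelator, if_true] at this
      exact S.relPow_eq_zero_of_relComm hp hm ht (hconj o) (hconj i) this
  exact ⟨relComm_eq_zero_of_pairRelator hpair hpow, hpow, hconj, hY⟩

/-- The pair `o`, `o'` carries all the correction terms. Once `relators_eq_zero_of_pair` kills its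
relators, the family reduces to unmodified conjugations and commutators with one B added, as in the
involutive case. -/
theorem relatorsVanish_of_generic (S : ScalarRelations p m s t x y) (hp : p.Prime) (h2 : p ≠ 2)
    (hm : m ≠ 0) (hnorm : ∀ (i : ι) (r : R), ∃ r', r * (x i - 1) = (x i - 1) * r')
    (ht : t = s + 1) {n : ℕ} (hn : t ^ m = s ^ m + p * n) (hnp : n.Coprime p)
    (hsp : s.Coprime p) (hst : (s + t).Coprime p) {o o' : ι} (hoo : o' ≠ o)
    (ho : ∀ j, j ≠ o → o < j) (h : ∀ j, relatorsGeneric p m s t o o' x y e f j = 0) :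
    RelatorsVanish p m s t x y e f := by
  have hi : relConj s t (x o) y (e o) f + gsum p (x o) • relPow p (x o') (e o') = 0 := by
    simpa [relatorsGeneric] using h (.inl o)
  have hj : relConj s t (x o') y (e o') f = 0 := by
    simpa [relatorsGeneric, hoo] using h (.inl o')
  have hZ : relComm (x o) (x o') (e o) (e o') + relPow m y f + relPow p (x o) (e o)
      + relPow p (x o') (e o') = 0 := by
    have := h (.inr ⟨(o, o'), ho o' hoo⟩)
    simp only [relatorsGeneric, pairRelator, if_true] at this
    rw [← this]; abel
  obtain ⟨hB, hB', hY, -⟩ :=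
    S.relators_eq_zero_of_pair hp h2 hm hnorm ht hn hnp hsp hst hi hj hZ
  have hconj : ∀ i, relConj s t (x i) y (e i) f = 0 := fun i => by
    simpa [relatorsGeneric, hB'] using h (.inl i)
  have hpair : ∀ q, pairRelator p o x e q = 0 := fun q => by
    simpa [relatorsGeneric, hB, hY] using h (.inr q)
  have hpow : ∀ i, relPow p (x i) (e i) = 0 := fun i => by
    by_cases hi : i = o
    · rw [hi, hB]
    · have := hpair ⟨(o, i), ho i hi⟩
      simp only [pairRelator, if_true] at this
      exact S.relPow_eq_zero_of_relComm hp.ne_zero hm ht (hconj o) (hconj i) this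
  exact ⟨relComm_eq_zero_of_pairRelator hpair hpow, hpow, hconj, hY⟩

end Families

end

section

open Finset

/-! ### The integral group ring and the Fox boundary. -/

section IntegralGroupRing

variable {U : Type} [Group U] {N : Type*} [AddCommGroup N]

/-- The additive extension to the integral group ring of a function on the group. -/
noncomputable def additiveExtension (δ : U → N) : MonoidAlgebra ℤ U →ₗ[ℤ] N :=
  (MonoidAlgebra.basis U ℤ).constr ℤ δ

@[simp] theorem additiveExtension_of (δ : U → N) (g : U) :
    additiveExtension δ (MonoidAlgebra.of ℤ U g) = δ g := by
  rw [MonoidAlgebra.of_apply, ← MonoidAlgebra.basis_apply, additiveExtension,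
    Module.Basis.constr_basis]

theorem groupRing_induction {P : MonoidAlgebra ℤ U → Prop} (r : MonoidAlgebra ℤ U)
    (of : ∀ u, P (MonoidAlgebra.of ℤ U u)) (add : ∀ a b, P a → P b → P (a + b))
    (neg : ∀ a, P a → P (-a)) (zero : P 0) : P r := by
  induction r using MonoidAlgebra.induction_on with
  | of u => exact of u
  | add a b ha hb => exact add a b ha hb
  | smul n a ha =>
    induction n using Int.induction_on with
    | zero => simpa using zero
    | succ n ih => rw [add_smul, one_smul]; exact add _ _ ih ha
    | pred n ih => rw [sub_smul, one_smul, sub_eq_add_neg]; exact add _ _ ih (neg _ ha)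

/-- The augmentation of the integral group ring. -/
noncomputable def augmentation (U : Type) [Group U] : MonoidAlgebra ℤ U →+* ℤ :=
  (MonoidAlgebra.lift ℤ ℤ U 1 : MonoidAlgebra ℤ U →ₐ[ℤ] ℤ)

@[simp] theorem augmentation_of (g : U) : augmentation U (MonoidAlgebra.of ℤ U g) = 1 := by
  simp [augmentation]

/-- The boundary map `ℤ[U]^J → ℤ[U]` determined by a family of group elements. -/
noncomputable def foxBoundary {J : Type*} [Fintype J] (g : J → U) :
    (J → MonoidAlgebra ℤ U) →ₗ[MonoidAlgebra ℤ U] MonoidAlgebra ℤ U :=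
  Fintype.linearCombination _ fun j => MonoidAlgebra.of ℤ U (g j) - 1

theorem foxBoundary_single {J : Type*} [Fintype J] [DecidableEq J] (g : J → U) (j : J)
    (r : MonoidAlgebra ℤ U) :
    foxBoundary g (Pi.single j r) = r * (MonoidAlgebra.of ℤ U (g j) - 1) := by
  rw [foxBoundary, Fintype.linearCombination_apply_single, smul_eq_mul]

theorem augmentation_foxBoundary {J : Type*} [Fintype J] (g : J → U) (v) :
    augmentation U (foxBoundary g v) = 0 := by
  simp [foxBoundary, Fintype.linearCombination_apply, -MonoidAlgebra.of_apply]

/-- The identity `a b - 1 = a (b - 1) + (a - 1)` reduces the augmentation ideal to the generators.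
-/
theorem exists_foxBoundary_eq {J : Type*} [Fintype J] {g : J → U}
    (hg : Submonoid.closure (Set.range g) = ⊤) {r : MonoidAlgebra ℤ U}
    (hr : augmentation U r = 0) : ∃ v, foxBoundary g v = r := by
  classical
  have h1 : ∀ u : U, MonoidAlgebra.of ℤ U u - 1 ∈ LinearMap.range (foxBoundary g) := fun u => by
    have hu : u ∈ Submonoid.closure (Set.range g) := hg ▸ Submonoid.mem_top u
    induction hu using Submonoid.closure_induction with
    | mem u hu =>
      obtain ⟨j, rfl⟩ := hu
      exact ⟨Pi.single j 1, by rw [foxBoundary_single, one_mul]⟩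
    | one => rw [map_one, sub_self]; exact Submodule.zero_mem _
    | mul a b _ _ ha hb =>
      have : MonoidAlgebra.of ℤ U (a * b) - 1 = MonoidAlgebra.of ℤ U a •
          (MonoidAlgebra.of ℤ U b - 1) + (MonoidAlgebra.of ℤ U a - 1) := by
        rw [map_mul, smul_eq_mul, mul_sub, mul_one]; abel
      rw [this]
      exact Submodule.add_mem _ (Submodule.smul_mem _ _ hb) ha
  have h2 : ∀ r : MonoidAlgebra ℤ U, r - (augmentation U r : MonoidAlgebra ℤ U) ∈
      LinearMap.range (foxBoundary g) := fun r => by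
    induction r using groupRing_induction with
    | of u => simpa [-MonoidAlgebra.of_apply, -LinearMap.mem_range] using h1 u
    | add a b ha hb =>
      rw [map_add, Int.cast_add, add_sub_add_comm]
      exact Submodule.add_mem _ ha hb
    | neg a ha =>
      rw [map_neg, Int.cast_neg, ← neg_sub']
      exact Submodule.neg_mem _ ha
    | zero => simp
  have := h2 r
  rw [hr, Int.cast_zero, sub_zero] at this
  exact this

end IntegralGroupRing

/-! ### Affine permutations, and exactness of the Fox complex of a presentation. -/

section AffinePermutation

variable {U : Type} [Group U] {Q : Type*} [AddCommGroup Q] [Module (MonoidAlgebra ℤ U) Q]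

/-- The affine permutation `q ↦ g q + a` of a module over the group ring. -/
noncomputable def affinePerm (g : U) (a : Q) : Equiv.Perm Q where
  toFun q := MonoidAlgebra.of ℤ U g • q + a
  invFun q := MonoidAlgebra.of ℤ U g⁻¹ • (q - a)
  left_inv q := by
    beta_reduce
    rw [add_sub_cancel_right, smul_smul, ← map_mul, inv_mul_cancel, map_one, one_smul]
  right_inv q := by
    beta_reduce
    rw [smul_smul, ← map_mul, mul_inv_cancel, map_one, one_smul, sub_add_cancel]

theorem affinePerm_apply (g : U) (a q : Q) :
    affinePerm g a q = MonoidAlgebra.of ℤ U g • q + a := rfl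

theorem affinePerm_mul (g h : U) (a b : Q) :
    affinePerm g a * affinePerm h b = affinePerm (g * h) (MonoidAlgebra.of ℤ U g • b + a) := by
  ext q
  rw [Equiv.Perm.mul_apply, affinePerm_apply, affinePerm_apply, affinePerm_apply, map_mul,
    mul_smul, smul_add, add_assoc]

theorem affinePerm_one : affinePerm (1 : U) (0 : Q) = 1 := by
  ext q
  rw [affinePerm_apply, map_one, one_smul, add_zero, Equiv.Perm.one_apply]

/-- Translation parts follow the rules of Fox calculus, so a relation holds among affine
permutations when its Fox derivative vanishes. -/
theorem affinePerm_pow (g : U) (a : Q) (n : ℕ) :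
    affinePerm g a ^ n = affinePerm (g ^ n) (gsum n (MonoidAlgebra.of ℤ U g) • a) := by
  induction n with
  | zero => simp [affinePerm_one]
  | succ n ih =>
    rw [pow_succ', ih, affinePerm_mul, ← pow_succ', smul_smul, add_comm n, gsum_add, gsum_one_left,
      pow_one, add_smul, one_smul, add_comm a]

end AffinePermutation

/-- `U` is presented by commuting generators `x i` of order `p` and a generator `y` of order
`m`, subject to `y x ^ t = x ^ s y`. -/
structure ScalarPresentation (p m s t : ℕ) {ι : Type} {U : Type} [Group U] (x : ι → U) (y : U) :
    Prop where
  comm : ∀ i j, Commute (x i) (x j)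
  pow_x : ∀ i, x i ^ p = 1
  pow_y : y ^ m = 1
  conj : ∀ i, y * x i ^ t = x i ^ s * y
  coprime_s : s.Coprime p
  coprime_t : t.Coprime p
  pos : 0 < p
  closure : Submonoid.closure (Set.range fun o : Option ι => o.elim y x) = ⊤
  lift : ∀ {H : Type} [Group H] (X : ι → H) (Y : H), (∀ i j, Commute (X i) (X j)) →
    (∀ i, X i ^ p = 1) → Y ^ m = 1 → (∀ i, Y * X i ^ t = X i ^ s * Y) →
    ∃ g : U →* H, (∀ i, g (x i) = X i) ∧ g y = Y

namespace ScalarPresentation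

variable {p m s t : ℕ} {ι : Type} {U : Type} [Group U] {x : ι → U} {y : U}

theorem scalarRelations (S : ScalarPresentation p m s t x y) :
    ScalarRelations p m s t (fun i => MonoidAlgebra.of ℤ U (x i)) (MonoidAlgebra.of ℤ U y) where
  comm i j := (S.comm i j).map _
  pow_x i := by rw [← map_pow, S.pow_x, map_one]
  pow_y := by rw [← map_pow, S.pow_y, map_one]
  conj i := by rw [← map_pow, ← map_pow, ← map_mul, ← map_mul, S.conj]
  norm i := by
    refine semiconjBy_gsum_of_pow S.pos ?_ S.coprime_s S.coprime_t ?_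
    · rw [← map_pow, S.pow_x, map_one]
    · rw [← map_pow, ← map_pow, ← map_mul, ← map_mul, S.conj]

/-- Conjugation by `y` takes `x i` to a power of itself, and `x ^ n - 1` is divisible by `x - 1`. -/
theorem exists_mul_sub_one (S : ScalarPresentation p m s t x y) (i : ι) (r : MonoidAlgebra ℤ U) :
    ∃ r', r * (MonoidAlgebra.of ℤ U (x i) - 1) = (MonoidAlgebra.of ℤ U (x i) - 1) * r' := by
  induction r using groupRing_induction with
  | of u =>
    have hu : u ∈ Submonoid.closure (Set.range fun o : Option ι => o.elim y x) :=
      S.closure ▸ Submonoid.mem_top u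
    induction hu using Submonoid.closure_induction with
    | mem u hu =>
      obtain ⟨o, rfl⟩ := hu
      cases o with
      | none =>
        -- Here `n` inverts `t` modulo the order of `x i`, which turns `y x ^ t = x ^ s y` into `y x
        -- = x ^ (s n) y`.
        obtain ⟨n, hn⟩ := exists_pow_eq_self_of_coprime
          (S.coprime_t.coprime_dvd_right (orderOf_dvd_of_pow_eq_one (S.pow_x i)))
        have h : y * x i = x i ^ (s * n) * y := by
          have := (SemiconjBy.pow_right (show SemiconjBy y (x i ^ t) (x i ^ s) from S.conj i) n).eq
          rwa [hn, ← pow_mul] at this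
        refine ⟨gsum (s * n) (MonoidAlgebra.of ℤ U (x i)) * MonoidAlgebra.of ℤ U y, ?_⟩
        change MonoidAlgebra.of ℤ U y * _ = _
        rw [← mul_assoc, sub_one_mul_gsum, mul_sub, ← map_mul, h, map_mul, map_pow,
          sub_mul, one_mul, mul_one]
      | some j =>
        refine ⟨MonoidAlgebra.of ℤ U (x j), ?_⟩
        have := (S.comm j i).map (MonoidAlgebra.of ℤ U)
        exact (this.sub_right (Commute.one_right _)).eq
    | one => exact ⟨1, by rw [map_one, one_mul, mul_one]⟩
    | mul a b _ _ ha hb =>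
      obtain ⟨r, hr⟩ := ha
      obtain ⟨r', hr'⟩ := hb
      exact ⟨r * r', by rw [map_mul, mul_assoc, hr', ← mul_assoc, hr, mul_assoc]⟩
  | add a b ha hb =>
    obtain ⟨r, hr⟩ := ha
    obtain ⟨r', hr'⟩ := hb
    exact ⟨r + r', by rw [add_mul, hr, hr', mul_add]⟩
  | neg a ha =>
    obtain ⟨r, hr⟩ := ha
    exact ⟨-r, by rw [neg_mul, hr, mul_neg]⟩
  | zero => exact ⟨0, by simp⟩

/-- Exactness of the Fox complex: a chain killed by the boundary map lies in any submodule modulo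
which all relators vanish. -/
theorem mem_of_foxBoundary_eq_zero [Fintype ι] [DecidableEq ι] (S : ScalarPresentation p m s t x y)
    {N : Submodule (MonoidAlgebra ℤ U) (Option ι → MonoidAlgebra ℤ U)}
    (hN : RelatorsVanish p m s t (fun i => MonoidAlgebra.of ℤ U (x i)) (MonoidAlgebra.of ℤ U y)
      (fun i => N.mkQ (Pi.single (some i) 1)) (N.mkQ (Pi.single none 1)))
    {v : Option ι → MonoidAlgebra ℤ U} (hv : foxBoundary (fun o : Option ι => o.elim y x) v = 0) :
    v ∈ N := by
  set e := fun i => N.mkQ (Pi.single (some i) 1)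
  set f := N.mkQ (Pi.single none 1)
  -- Vanishing of the relators modulo `N` makes these affine permutations satisfy the defining
  -- relations. The resulting action of `U` has translation parts `δ`, a derivation sending
  -- generators to basis classes.
  obtain ⟨g, hgx, hgy⟩ := S.lift (H := Equiv.Perm ((Option ι → MonoidAlgebra ℤ U) ⧸ N))
    (fun i => affinePerm (x i) (e i)) (affinePerm y f)
    (fun i j => by
      have h := hN.comm i j
      rw [relComm, sub_smul, sub_smul, one_smul, one_smul, sub_eq_zero] at h
      rw [Commute, SemiconjBy, affinePerm_mul, affinePerm_mul, (S.comm i j).eq]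
      congr 1
      rw [sub_eq_sub_iff_add_eq_add] at h
      rw [h])
    (fun i => by
      rw [affinePerm_pow, S.pow_x, ← relPow, hN.pow, affinePerm_one])
    (by rw [affinePerm_pow, S.pow_y, ← relPow, hN.pow_y, affinePerm_one])
    (fun i => by
      have h := hN.conj i
      rw [relConj, sub_smul, sub_smul, one_smul, mul_smul] at h
      rw [affinePerm_pow, affinePerm_pow, affinePerm_mul, affinePerm_mul, S.conj]
      congr 1
      rw [map_pow, ← sub_eq_zero, ← h]
      abel)
  have haff : ∀ u : U, ∃ a, g u = affinePerm u a := fun u => by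
    have hu : u ∈ Submonoid.closure (Set.range fun o : Option ι => o.elim y x) :=
      S.closure ▸ Submonoid.mem_top u
    induction hu using Submonoid.closure_induction with
    | mem u hu =>
      obtain ⟨o, rfl⟩ := hu
      cases o with
      | none => exact ⟨f, hgy⟩
      | some j => exact ⟨e j, hgx j⟩
    | one => exact ⟨0, by rw [map_one, affinePerm_one]⟩
    | mul a b _ _ ha hb =>
      obtain ⟨c, hc⟩ := ha
      obtain ⟨d, hd⟩ := hb
      exact ⟨_, by rw [map_mul, hc, hd, affinePerm_mul]⟩
  choose δ hδ using haff
  have hinj : ∀ (u : U) (a b : (Option ι → MonoidAlgebra ℤ U) ⧸ N),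
      affinePerm u a = affinePerm u b → a = b := fun u a b h => by
    have := congrArg (fun F : Equiv.Perm _ => F 0) h
    simpa [affinePerm_apply] using this
  have hδm : ∀ u w : U, δ (u * w) = MonoidAlgebra.of ℤ U u • δ w + δ u := fun u w =>
    hinj (u * w) _ _ (by rw [← hδ, map_mul, hδ, hδ, affinePerm_mul])
  have hδg : ∀ o : Option ι, δ (o.elim y x) = N.mkQ (Pi.single o 1) := fun o => by
    cases o with
    | none => exact hinj y _ _ (by rw [← hgy]; exact (hδ y).symm)
    | some j => exact hinj (x j) _ _ (by rw [← hgx]; exact (hδ (x j)).symm)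
  -- The extension of `δ` recovers a chain modulo `N` from its boundary, because `δ (u g) - δ u = u
  -- δ g`.
  have key : ∀ v, additiveExtension δ (foxBoundary (fun o : Option ι => o.elim y x) v) = N.mkQ v := by
    intro v
    rw [← Finset.univ_sum_single v]
    simp only [map_sum, foxBoundary_single]
    refine sum_congr rfl fun o _ => ?_
    generalize v o = r
    have : ∀ u : U, Pi.single (M := fun _ => MonoidAlgebra ℤ U) o (MonoidAlgebra.of ℤ U u) =
      MonoidAlgebra.of ℤ U u • Pi.single o 1 := fun u => by
        rw [← Pi.single_smul, smul_eq_mul, mul_one]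
    induction r using groupRing_induction with
    | of u =>
      rw [mul_sub, mul_one, ← map_mul, map_sub, additiveExtension_of, additiveExtension_of, hδm,
        add_sub_cancel_right, hδg, this, map_smul]
    | add a b ha hb => rw [add_mul, map_add, ha, hb, Pi.single_add, map_add]
    | neg a ha => rw [neg_mul, map_neg, ha, Pi.single_neg, map_neg]
    | zero => simp
  rw [← Submodule.Quotient.mk_eq_zero, ← Submodule.mkQ_apply, ← key, hv, map_zero]

theorem foxBoundary_relators [Fintype ι] [DecidableEq ι] (S : ScalarPresentation p m s t x y) :
    RelatorsVanish p m s t (fun i => MonoidAlgebra.of ℤ U (x i)) (MonoidAlgebra.of ℤ U y)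
      (fun i => foxBoundary (fun o : Option ι => o.elim y x) (Pi.single (some i) 1))
      (foxBoundary (fun o : Option ι => o.elim y x) (Pi.single none 1)) := by
  have R := S.scalarRelations
  simp only [foxBoundary_single, one_mul, Option.elim]
  refine ⟨fun i j => ?_, fun i => ?_, fun i => ?_, ?_⟩
  · rw [relComm, smul_eq_mul, smul_eq_mul, sub_eq_zero]
    exact (((R.comm i j).sub_left (Commute.one_left _)).sub_right (Commute.one_right _)).eq
  · rw [relPow, smul_eq_mul, gsum_mul_sub_one, R.pow_x, sub_self]
  · rw [relConj, smul_eq_mul, smul_eq_mul, sub_mul (_ * _), mul_assoc, gsum_mul_sub_one,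
      gsum_mul_sub_one, mul_sub (MonoidAlgebra.of ℤ U y), R.conj]
    noncomm_ring
  · rw [relPow, smul_eq_mul, gsum_mul_sub_one, R.pow_y, sub_self]

end ScalarPresentation

end

section

open Finset

/-! ### Partial resolutions from families of relators, and their Euler characteristics. -/

section Resolution

variable {U : Type} [Group U]

theorem trivial_asAlgebraHom (r : MonoidAlgebra ℤ U) (n : ℤ) :
    (Representation.trivial ℤ U ℤ).asAlgebraHom r n = augmentation U r * n := by
  induction r using groupRing_induction with
  | of u => rw [Representation.asAlgebraHom_of, augmentation_of, one_mul]; rfl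
  | add a b ha hb => rw [map_add, LinearMap.add_apply, ha, hb, map_add, add_mul]
  | neg a ha => rw [map_neg, LinearMap.neg_apply, ha, map_neg, neg_mul]
  | zero => simp

/-- The augmentation as a map to the trivial module. -/
noncomputable def augmentationMap (U : Type) [Group U] : (Fin 1 → MonoidAlgebra ℤ U)
    →ₗ[MonoidAlgebra ℤ U] (Representation.trivial ℤ U ℤ).asModule :=
  (LinearMap.toSpanSingleton (MonoidAlgebra ℤ U) _
    ((Representation.trivial ℤ U ℤ).asModuleEquiv.symm 1)).comp (LinearMap.proj 0)

theorem augmentationMap_apply (v : Fin 1 → MonoidAlgebra ℤ U) :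
    augmentationMap U v =
      (Representation.trivial ℤ U ℤ).asModuleEquiv.symm (augmentation U (v 0)) := by
  rw [LinearEquiv.eq_symm_apply]
  simp only [augmentationMap, LinearMap.comp_apply, LinearMap.toSpanSingleton_apply,
    Representation.asModuleEquiv_map_smul, LinearEquiv.apply_symm_apply, trivial_asAlgebraHom,
    mul_one, LinearMap.proj_apply]

theorem augmentationMap_eq_zero_iff (v : Fin 1 → MonoidAlgebra ℤ U) :
    augmentationMap U v = 0 ↔ augmentation U (v 0) = 0 := by
  rw [augmentationMap_apply, LinearEquiv.symm_apply_eq, map_zero]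

/-- The Fox complex of a generating family `g` and of a family `F` of relators, as a partial free
resolution. -/
noncomputable def foxResolution {J κ : Type} [Fintype J] [Fintype κ] (g : J → U)
    (hg : Submonoid.closure (Set.range g) = ⊤) (F : κ → (J → MonoidAlgebra ℤ U))
    (hF : ∀ v, foxBoundary g v = 0 ↔ v ∈ Submodule.span (MonoidAlgebra ℤ U) (Set.range F))
    (n : ℕ) (hn : n ≤ 2) : FreeStepResolution U n where
  rank
    | 0 => 1
    | 1 => Fintype.card J
    | 2 => Fintype.card κ
    | _ => 0
  d
    | 0 => (LinearEquiv.funUnique (Fin 1) (MonoidAlgebra ℤ U) (MonoidAlgebra ℤ U)).symm.toLinearMap ∘ₗ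
        foxBoundary g ∘ₗ (LinearEquiv.funCongrLeft (MonoidAlgebra ℤ U) (MonoidAlgebra ℤ U)
          (Fintype.equivFin J)).toLinearMap
    | 1 => (LinearEquiv.funCongrLeft (MonoidAlgebra ℤ U) (MonoidAlgebra ℤ U)
          (Fintype.equivFin J)).symm.toLinearMap ∘ₗ Fintype.linearCombination _ F ∘ₗ
        (LinearEquiv.funCongrLeft (MonoidAlgebra ℤ U) (MonoidAlgebra ℤ U)
          (Fintype.equivFin κ)).toLinearMap
    | _ + 2 => 0
  aug := augmentationMap U
  aug_surjective := fun z => by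
    refine ⟨fun _ => ((Representation.trivial ℤ U ℤ).asModuleEquiv z : MonoidAlgebra ℤ U), ?_⟩
    rw [augmentationMap_apply, LinearEquiv.symm_apply_eq]
    simp
  exact_zero := fun _ v => by
    refine (augmentationMap_eq_zero_iff v).trans ?_
    constructor
    · intro hv
      obtain ⟨w, hw⟩ := exists_foxBoundary_eq hg hv
      refine ⟨(LinearEquiv.funCongrLeft (MonoidAlgebra ℤ U) (MonoidAlgebra ℤ U)
          (Fintype.equivFin J)).symm w, ?_⟩
      simp only [LinearMap.comp_apply, LinearEquiv.coe_coe, LinearEquiv.apply_symm_apply, hw]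
      rw [LinearEquiv.symm_apply_eq]; rfl
    · rintro ⟨w, rfl⟩
      exact augmentation_foxBoundary g _
  exact_succ := fun i hi v => by
    obtain rfl : i = 0 := by omega
    simp only [LinearMap.comp_apply, LinearEquiv.coe_coe, EmbeddingLike.map_eq_zero_iff, hF,
      ← Fintype.range_linearCombination, LinearMap.mem_range, Set.mem_range,
      LinearEquiv.symm_apply_eq]
    constructor
    · rintro ⟨w, hw⟩
      exact ⟨(LinearEquiv.funCongrLeft (MonoidAlgebra ℤ U) (MonoidAlgebra ℤ U)
          (Fintype.equivFin κ)).symm w, by rwa [LinearEquiv.apply_symm_apply]⟩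
    · rintro ⟨w, hw⟩
      exact ⟨_, hw⟩

theorem foxResolution_signedChi_one {J κ : Type} [Fintype J] [Fintype κ] (g : J → U)
    (hg : Submonoid.closure (Set.range g) = ⊤) (F : κ → (J → MonoidAlgebra ℤ U)) (hF) :
    (foxResolution g hg F hF 1 (by norm_num)).signedChi = Fintype.card J - 1 := by
  simp only [FreeStepResolution.signedChi, sum_range_succ, foxResolution]
  simp
  ring

theorem foxResolution_signedChi_two {J κ : Type} [Fintype J] [Fintype κ] (g : J → U)
    (hg : Submonoid.closure (Set.range g) = ⊤) (F : κ → (J → MonoidAlgebra ℤ U)) (hF) :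
    (foxResolution g hg F hF 2 le_rfl).signedChi = Fintype.card κ - Fintype.card J + 1 := by
  simp only [FreeStepResolution.signedChi, sum_range_succ, foxResolution]
  simp
  ring

end Resolution

theorem card_subtype_lt (k : ℕ) :
    Fintype.card {q : Fin k × Fin k // q.1 < q.2} = k.choose 2 := by
  rw [Fintype.card_subtype, Fintype.card_product_filter_lt, Fintype.card_fin]

namespace ScalarPresentation

variable {p m s t k : ℕ} {U : Type} [Group U] {x : Fin k → U} {y : U}

theorem foxBoundary_eq_zero_iff {κ : Type*} (S : ScalarPresentation p m s t x y)
    (F : κ → (Option (Fin k) → MonoidAlgebra ℤ U))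
    (hF : ∀ j, foxBoundary (fun o : Option (Fin k) => o.elim y x) (F j) = 0)
    (hv : RelatorsVanish p m s t (fun i => MonoidAlgebra.of ℤ U (x i)) (MonoidAlgebra.of ℤ U y)
      (fun i => (Submodule.span (MonoidAlgebra ℤ U) (Set.range F)).mkQ (Pi.single (some i) 1))
      ((Submodule.span (MonoidAlgebra ℤ U) (Set.range F)).mkQ (Pi.single none 1))) (v) :
    foxBoundary (fun o : Option (Fin k) => o.elim y x) v = 0 ↔
      v ∈ Submodule.span (MonoidAlgebra ℤ U) (Set.range F) := by
  refine ⟨S.mem_of_foxBoundary_eq_zero hv, fun h => ?_⟩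
  rw [← LinearMap.mem_ker]
  refine Submodule.span_le.mpr ?_ h
  rintro _ ⟨j, rfl⟩
  exact hF j

/-- The hypothesis is applied with `N` the span of the family itself. The count is `k + k.choose 2 +
1` relators against `k + 1` generators. -/
theorem exists_resolution_involutive (S : ScalarPresentation p m s t x y) (b : Bool) (o : Fin k)
    (h : ∀ (N : Submodule (MonoidAlgebra ℤ U) (Option (Fin k) → MonoidAlgebra ℤ U)),
      (∀ j, relatorsInvolutive p m s t b o (fun i => MonoidAlgebra.of ℤ U (x i))
        (MonoidAlgebra.of ℤ U y) (fun i => N.mkQ (Pi.single (some i) 1))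
        (N.mkQ (Pi.single none 1)) j = 0) →
      RelatorsVanish p m s t (fun i => MonoidAlgebra.of ℤ U (x i)) (MonoidAlgebra.of ℤ U y)
        (fun i => N.mkQ (Pi.single (some i) 1)) (N.mkQ (Pi.single none 1))) :
    (∃ F : FreeStepResolution U 1, F.signedChi = k) ∧
      ∃ F : FreeStepResolution U 2, F.signedChi = k.choose 2 + 1 := by
  set F := relatorsInvolutive p m s t b o (fun i => MonoidAlgebra.of ℤ U (x i))
    (MonoidAlgebra.of ℤ U y)
    (fun i => (Pi.single (some i) 1 : Option (Fin k) → MonoidAlgebra ℤ U)) (Pi.single none 1) with hFd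
  have hR := S.foxBoundary_relators
  have hF : ∀ j, foxBoundary (fun o : Option (Fin k) => o.elim y x) (F j) = 0 := by
    rintro ((i | q) | _) <;> rw [hFd, map_relatorsInvolutive]
    · cases b <;> simp [relatorsInvolutive, hR.conj, hR.pow, -MonoidAlgebra.of_apply]
    · simp [relatorsInvolutive, pairRelator, hR.comm, hR.pow, -MonoidAlgebra.of_apply]
    · simp [relatorsInvolutive, hR.pow, hR.pow_y, -MonoidAlgebra.of_apply]
  have key := S.foxBoundary_eq_zero_iff F hF (h _ fun j => by
    rw [← map_relatorsInvolutive, Submodule.mkQ_apply, Submodule.Quotient.mk_eq_zero]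
    exact Submodule.subset_span ⟨j, rfl⟩)
  refine ⟨⟨foxResolution _ S.closure F key 1 (by norm_num), ?_⟩,
    ⟨foxResolution _ S.closure F key 2 le_rfl, ?_⟩⟩
  · rw [foxResolution_signedChi_one]; simp
  · rw [foxResolution_signedChi_two]; simp [card_subtype_lt]

theorem exists_resolution_generic (S : ScalarPresentation p m s t x y) (o o' : Fin k)
    (h : ∀ (N : Submodule (MonoidAlgebra ℤ U) (Option (Fin k) → MonoidAlgebra ℤ U)),
      (∀ j, relatorsGeneric p m s t o o' (fun i => MonoidAlgebra.of ℤ U (x i))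
        (MonoidAlgebra.of ℤ U y) (fun i => N.mkQ (Pi.single (some i) 1))
        (N.mkQ (Pi.single none 1)) j = 0) →
      RelatorsVanish p m s t (fun i => MonoidAlgebra.of ℤ U (x i)) (MonoidAlgebra.of ℤ U y)
        (fun i => N.mkQ (Pi.single (some i) 1)) (N.mkQ (Pi.single none 1))) :
    (∃ F : FreeStepResolution U 1, F.signedChi = k) ∧
      ∃ F : FreeStepResolution U 2, F.signedChi = k.choose 2 := by
  set F := relatorsGeneric p m s t o o' (fun i => MonoidAlgebra.of ℤ U (x i))
    (MonoidAlgebra.of ℤ U y)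
    (fun i => (Pi.single (some i) 1 : Option (Fin k) → MonoidAlgebra ℤ U)) (Pi.single none 1) with hFd
  have hR := S.foxBoundary_relators
  have hF : ∀ j, foxBoundary (fun o : Option (Fin k) => o.elim y x) (F j) = 0 := by
    rintro (i | q) <;> rw [hFd, map_relatorsGeneric]
    · simp [relatorsGeneric, hR.conj, hR.pow, -MonoidAlgebra.of_apply]
    · simp [relatorsGeneric, pairRelator, hR.comm, hR.pow, hR.pow_y, -MonoidAlgebra.of_apply]
  have key := S.foxBoundary_eq_zero_iff F hF (h _ fun j => by
    rw [← map_relatorsGeneric, Submodule.mkQ_apply, Submodule.Quotient.mk_eq_zero]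
    exact Submodule.subset_span ⟨j, rfl⟩)
  refine ⟨⟨foxResolution _ S.closure F key 1 (by norm_num), ?_⟩,
    ⟨foxResolution _ S.closure F key 2 le_rfl, ?_⟩⟩
  · rw [foxResolution_signedChi_one]; simp
  · rw [foxResolution_signedChi_two]; simp [card_subtype_lt]

end ScalarPresentation

end

section

open Finset Module

/-! ### Cochains with values in a one-dimensional character. -/

section Twisted

variable {U : Type} [Group U] {K : Type*} [Field K]

/-- The ring homomorphism `ℤ[U] → K` extending a character. -/
noncomputable def charRingHom (χ : U →* Kˣ) : MonoidAlgebra ℤ U →+* K :=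
  (MonoidAlgebra.lift ℤ K U ((Units.coeHom K).comp χ) : MonoidAlgebra ℤ U →ₐ[ℤ] K)

@[simp] theorem charRingHom_of (χ : U →* Kˣ) (g : U) :
    charRingHom χ (MonoidAlgebra.of ℤ U g) = χ g := by
  simp [charRingHom]

/-- Derivations of `U` with values in the one-dimensional module of a character. -/
def IsTwistedDerivation (χ : U →* Kˣ) (δ : U → K) : Prop :=
  ∀ g h, δ (g * h) = δ g + χ g * δ h

/-- Principal derivations. -/
def IsTwistedPrincipal (χ : U →* Kˣ) (δ : U → K) : Prop := ∃ c, ∀ g, δ g = χ g * c - c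

/-- Two-cocycles of `U` with values in the one-dimensional module of a character. -/
def IsTwistedCocycle (χ : U →* Kˣ) (f : U → U → K) : Prop :=
  ∀ g h j, f (g * h) j + f g h = χ g * f h j + f g (h * j)

/-- Two-coboundaries. -/
def IsTwistedCoboundary (χ : U →* Kˣ) (f : U → U → K) : Prop :=
  ∃ φ : U → K, ∀ g h, f g h = χ g * φ h - φ (g * h) + φ g

variable {χ : U →* Kˣ} {M : Type*} [AddCommGroup M] [Module (MonoidAlgebra ℤ U) M]

/-- An additive map that is equivariant for a character is semilinear. -/
noncomputable def semilinearOfEquivariant (T : M →+ K)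
    (hT : ∀ g v, T (MonoidAlgebra.of ℤ U g • v) = χ g * T v) : M →ₛₗ[charRingHom χ] K where
  toFun := T
  map_add' := T.map_add
  map_smul' r v := by
    rw [smul_eq_mul]
    induction r using groupRing_induction with
    | of u => rw [hT, charRingHom_of]
    | add a b ha hb => rw [add_smul, map_add, ha, hb, map_add, add_mul]
    | neg a ha => rw [neg_smul, map_neg, ha, map_neg, neg_mul]
    | zero => rw [zero_smul, map_zero, map_zero, zero_mul]

theorem semilinear_of_smul (g : M →ₛₗ[charRingHom χ] K) (u : U) (v : M) :
    g (MonoidAlgebra.of ℤ U u • v) = χ u * g v := by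
  rw [LinearMap.map_smulₛₗ, charRingHom_of, smul_eq_mul]

/-- Semilinear maps from a free module are determined by their values on the basis. -/
noncomputable def semilinearPiEquiv (χ : U →* Kˣ) (n : ℕ) :
    ((Fin n → MonoidAlgebra ℤ U) →ₛₗ[charRingHom χ] K) ≃ₗ[K] (Fin n → K) where
  toFun f i := f (Pi.single i 1)
  invFun w :=
    { toFun := fun v => ∑ i, charRingHom χ (v i) * w i
      map_add' := fun v v' => by simp [add_mul, sum_add_distrib]
      map_smul' := fun r v => by simp [mul_sum, mul_assoc] }
  map_add' _ _ := rfl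
  map_smul' _ _ := rfl
  left_inv f := by
    refine LinearMap.ext fun v => ?_
    have hv : v = ∑ i, v i • Pi.single i (1 : MonoidAlgebra ℤ U) := by
      conv_lhs => rw [← Finset.univ_sum_single v]
      exact sum_congr rfl fun i _ => by rw [← Pi.single_smul, smul_eq_mul, mul_one]
    change ∑ i, charRingHom χ (v i) * f (Pi.single i 1) = f v
    conv_rhs => rw [hv, map_sum]
    exact sum_congr rfl fun i _ => by rw [LinearMap.map_smulₛₗ, smul_eq_mul]
  right_inv w := by
    ext i
    simp [Pi.single_apply, apply_ite (charRingHom χ)]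

theorem finrank_semilinear (χ : U →* Kˣ) (n : ℕ) :
    finrank K ((Fin n → MonoidAlgebra ℤ U) →ₛₗ[charRingHom χ] K) = n := by
  rw [(semilinearPiEquiv χ n).finrank_eq, finrank_fin_fun]

instance finite_semilinear (χ : U →* Kˣ) (n : ℕ) :
    Module.Finite K ((Fin n → MonoidAlgebra ℤ U) →ₛₗ[charRingHom χ] K) :=
  Module.Finite.equiv (semilinearPiEquiv χ n).symm

/-- Precomposition with a linear map. -/
noncomputable def semilinearComp {M' : Type*} [AddCommGroup M'] [Module (MonoidAlgebra ℤ U) M'] (χ : U →* Kˣ)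
    (d : M' →ₗ[MonoidAlgebra ℤ U] M) :
    (M →ₛₗ[charRingHom χ] K) →ₗ[K] (M' →ₛₗ[charRingHom χ] K) where
  toFun g := g.comp d
  map_add' _ _ := rfl
  map_smul' _ _ := rfl

theorem additiveExtension_add (δ δ' : U → K) (z : MonoidAlgebra ℤ U) :
    additiveExtension (δ + δ') z = additiveExtension δ z + additiveExtension δ' z := by
  induction z using groupRing_induction with
  | of u => simp only [additiveExtension_of, Pi.add_apply]
  | add a b ha hb => simp only [map_add, ha, hb]; ring
  | neg a ha => simp only [map_neg, ha]; ring
  | zero => simp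

theorem additiveExtension_smul (c : K) (δ : U → K) (z : MonoidAlgebra ℤ U) :
    additiveExtension (c • δ) z = c * additiveExtension δ z := by
  induction z using groupRing_induction with
  | of u => simp only [additiveExtension_of, Pi.smul_apply, smul_eq_mul]
  | add a b ha hb => simp only [map_add, ha, hb]; ring
  | neg a ha => simp only [map_neg, ha]; ring
  | zero => simp

theorem additiveExtension_derivation {δ : U → K} (hδ : IsTwistedDerivation χ δ) (h : U)
    (z : MonoidAlgebra ℤ U) :
    additiveExtension δ (MonoidAlgebra.of ℤ U h * z) =
      χ h * additiveExtension δ z + augmentation U z * δ h := by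
  induction z using groupRing_induction with
  | of u =>
    rw [← map_mul, additiveExtension_of, additiveExtension_of, hδ, augmentation_of]
    push_cast; ring
  | add a b ha hb => rw [mul_add, map_add, ha, hb, map_add, map_add]; push_cast; ring
  | neg a ha => rw [mul_neg, map_neg, ha, map_neg, map_neg]; push_cast; ring
  | zero => simp

theorem additiveExtension_cocycle {f : U → U → K} (hf : IsTwistedCocycle χ f) (h g : U)
    (z : MonoidAlgebra ℤ U) :
    additiveExtension (f (h * g)) z + augmentation U z * f h g =
      χ h * additiveExtension (f g) z + additiveExtension (f h) (MonoidAlgebra.of ℤ U g * z) := by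
  induction z using groupRing_induction with
  | of u =>
    rw [← map_mul]
    simp only [additiveExtension_of, augmentation_of, Int.cast_one, one_mul]
    exact hf h g u
  | add a b ha hb =>
    simp only [mul_add, map_add, Int.cast_add, add_mul]
    linear_combination ha + hb
  | neg a ha =>
    simp only [mul_neg, map_neg, Int.cast_neg, neg_mul]
    linear_combination -ha
  | zero => simp

/-- The lift of a two-cocycle to a cochain on a free module mapping to the group ring. -/
noncomputable def cocycleLift {J : Type*} [Fintype J] [DecidableEq J]
    (d : (J → MonoidAlgebra ℤ U) →ₗ[MonoidAlgebra ℤ U] MonoidAlgebra ℤ U) (f : U → U → K)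
    (v : J → MonoidAlgebra ℤ U) : K :=
  ∑ j, additiveExtension (fun g => additiveExtension (f g) (d (Pi.single j 1))) (v j)

section CocycleLift

variable {J : Type*} [Fintype J] [DecidableEq J]
  (d : (J → MonoidAlgebra ℤ U) →ₗ[MonoidAlgebra ℤ U] MonoidAlgebra ℤ U)

theorem cocycleLift_add (f : U → U → K) (v w : J → MonoidAlgebra ℤ U) :
    cocycleLift d f (v + w) = cocycleLift d f v + cocycleLift d f w := by
  simp [cocycleLift, sum_add_distrib]

theorem cocycleLift_add_left (f f' : U → U → K) (v : J → MonoidAlgebra ℤ U) :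
    cocycleLift d (f + f') v = cocycleLift d f v + cocycleLift d f' v := by
  simp only [cocycleLift, ← sum_add_distrib]
  refine sum_congr rfl fun j _ => ?_
  rw [← additiveExtension_add]
  congr 1; congr 1; ext g
  exact additiveExtension_add _ _ _

theorem cocycleLift_smul_left (c : K) (f : U → U → K) (v : J → MonoidAlgebra ℤ U) :
    cocycleLift d (c • f) v = c * cocycleLift d f v := by
  simp only [cocycleLift, mul_sum]
  refine sum_congr rfl fun j _ => ?_
  rw [← additiveExtension_smul]
  congr 1; congr 1; ext g
  exact additiveExtension_smul _ _ _

/-- The defect of equivariance depends only on the boundary of `v`. On cycles the lift is therefore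
equivariant, which converts a bar cocycle into a cochain on `F_2`. -/
theorem cocycleLift_smul (hd : ∀ v, augmentation U (d v) = 0) {f : U → U → K}
    (hf : IsTwistedCocycle χ f) (h : U) (v : J → MonoidAlgebra ℤ U) :
    cocycleLift d f (MonoidAlgebra.of ℤ U h • v) =
      χ h * cocycleLift d f v + additiveExtension (f h) (d v) := by
  have hv : d v = ∑ j, v j * d (Pi.single j 1) := by
    conv_lhs => rw [← Finset.univ_sum_single v, map_sum]
    exact sum_congr rfl fun i _ => by
      rw [← smul_eq_mul, ← map_smul, ← Pi.single_smul, smul_eq_mul, mul_one]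
  rw [hv, map_sum, cocycleLift, cocycleLift, mul_sum, ← sum_add_distrib]
  refine sum_congr rfl fun j _ => ?_
  rw [Pi.smul_apply, smul_eq_mul]
  generalize v j = r
  induction r using groupRing_induction with
  | of u =>
    have := additiveExtension_cocycle hf h u (d (Pi.single j 1))
    rw [hd, Int.cast_zero, zero_mul, add_zero] at this
    rw [← map_mul, additiveExtension_of, additiveExtension_of, this]
  | add a b ha hb => rw [mul_add, map_add, ha, hb, map_add, add_mul, map_add]; ring
  | neg a ha => rw [mul_neg, map_neg, ha, map_neg, neg_mul, map_neg]; ring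
  | zero => simp

end CocycleLift

section Augmented

variable {F0 F1 : Type*} [AddCommGroup F0] [Module (MonoidAlgebra ℤ U) F0] [AddCommGroup F1]
  [Module (MonoidAlgebra ℤ U) F1] {ε : F0 →+ ℤ}
  (hε : ∀ r v, ε (r • v) = augmentation U r * ε v) {d0 : F1 →ₗ[MonoidAlgebra ℤ U] F0}
  (hd : ∀ z, ε z = 0 ↔ ∃ w, d0 w = z)
include hε hd

theorem exists_boundary_eq_sub (v0 : F0) (g : U) : ∃ w, d0 w = MonoidAlgebra.of ℤ U g • v0 - v0 := by
  rw [← hd, map_sub, hε, augmentation_of, one_mul, sub_self]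

variable {v0 : F0} (hv0 : ε v0 = 1)
include hv0

/-- By `hker`, `m` depends only on the boundary of its argument. Its values on lifts of `g v0 - v0`,
corrected by `f g` on `φ0 v0`, form a 1-cochain with coboundary `f`. -/
theorem isTwistedCoboundary_of_lift {φ0 : F0 →ₗ[MonoidAlgebra ℤ U] MonoidAlgebra ℤ U}
    (hφ : ∀ v, augmentation U (φ0 v) = ε v) {f : U → U → K} (hf : IsTwistedCocycle χ f)
    {m : F1 →+ K}
    (hm : ∀ h v, m (MonoidAlgebra.of ℤ U h • v) =
      χ h * m v + additiveExtension (f h) (φ0 (d0 v)))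
    (hker : ∀ v, d0 v = 0 → m v = 0) : IsTwistedCoboundary χ f := by
  choose w hw using exists_boundary_eq_sub hε hd v0
  have key : ∀ h g, m (w (h * g)) = m (w h) + χ h * m (w g) +
      additiveExtension (f h) (φ0 (MonoidAlgebra.of ℤ U g • v0 - v0)) := fun h g => by
    have h0 : d0 (w (h * g) - w h - MonoidAlgebra.of ℤ U h • w g) = 0 := by
      rw [map_sub, map_sub, map_smul, hw, hw, hw, map_mul, smul_sub, mul_smul]; abel
    have h1 := hker _ h0
    rw [map_sub, map_sub, hm, hw] at h1
    linear_combination h1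
  refine ⟨fun g => additiveExtension (f g) (φ0 v0) - m (w g), fun h g => ?_⟩
  have h1 := additiveExtension_cocycle hf h g (φ0 v0)
  rw [hφ, hv0, Int.cast_one, one_mul] at h1
  have h2 := key h g
  rw [map_sub, map_smul, smul_eq_mul, map_sub] at h2
  linear_combination h1 - h2

/-- `F0` is the sum of the boundaries and the multiples of `v0`, so a preimage is fixed by `f` on
boundaries and by the value `s` at `v0`; `hs` provides its equivariance. -/
theorem mem_range_semilinearComp {f : F1 →ₛₗ[charRingHom χ] K} (hf : ∀ v, d0 v = 0 → f v = 0)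
    {s : K} (hs : ∀ g w, d0 w = MonoidAlgebra.of ℤ U g • v0 - v0 → f w = χ g * s - s) :
    f ∈ LinearMap.range (semilinearComp (K := K) χ d0) := by
  have hpre : ∀ x : F0, ∃ w, d0 w = x - ε x • v0 := fun x => by
    rw [← hd, map_sub, map_zsmul, hv0]; simp
  have hzs : ∀ (r : MonoidAlgebra ℤ U) (n : ℤ) (v : F0), r • n • v = n • r • v := fun r n v =>
    smul_comm r n v
  have huniq : ∀ w w', d0 w = d0 w' → f w = f w' := fun w w' h => by
    have := hf (w - w') (by rw [map_sub, h, sub_self])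
    rwa [map_sub, sub_eq_zero] at this
  choose pre hp using hpre
  let f0 : F0 →+ K :=
    { toFun := fun x => f (pre x) + ε x * s
      map_zero' := by
        rw [hf (pre 0) (by rw [hp]; simp)]; simp
      map_add' := fun x y => by
        rw [huniq (pre (x + y)) (pre x + pre y) (by rw [map_add, hp, hp, hp, map_add, add_smul]; abel)]
        rw [map_add, map_add]; push_cast; ring }
  have hf0 : ∀ g x, f0 (MonoidAlgebra.of ℤ U g • x) = χ g * f0 x := fun g x => by
    obtain ⟨w, hw⟩ := exists_boundary_eq_sub hε hd v0 g
    change f (pre _) + _ = _ * (f (pre x) + _)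
    have hεg : ε (MonoidAlgebra.of ℤ U g • x) = ε x := by rw [hε, augmentation_of, one_mul]
    rw [huniq (pre (MonoidAlgebra.of ℤ U g • x)) (MonoidAlgebra.of ℤ U g • pre x + ε x • w) (by
      rw [hp (_ • x), map_add, map_smul d0, hp, map_zsmul d0, hw, hεg, smul_sub, smul_sub, hzs]; abel), map_add,
      semilinear_of_smul, map_zsmul, hs g w hw, hεg, zsmul_eq_mul]
    ring
  refine ⟨semilinearOfEquivariant f0 hf0, LinearMap.ext fun w => ?_⟩
  change f (pre (d0 w)) + ε (d0 w) * s = f w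
  have h0 : ε (d0 w) = 0 := (hd _).2 ⟨w, rfl⟩
  rw [h0, huniq (pre (d0 w)) w (by rw [hp, h0, zero_smul, sub_zero])]
  simp

end Augmented

end Twisted

end

section

open Finset Module

/-! ### Swan's lower bounds for Euler characteristics. -/

section CocycleDual

variable {U : Type} [Group U] {K : Type*} [Field K] {χ : U →* Kˣ} {J M V : Type*} [Fintype J]
  [DecidableEq J] [AddCommGroup M] [Module (MonoidAlgebra ℤ U) M] [AddCommGroup V] [Module K V]

theorem cocycleLift_zero (d : (J → MonoidAlgebra ℤ U) →ₗ[MonoidAlgebra ℤ U] MonoidAlgebra ℤ U)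
    (f : U → U → K) : cocycleLift d f 0 = 0 := by
  simp [cocycleLift]

/-- The lift of a two-cocycle as an additive map. -/
noncomputable def cocycleLiftHom
    (d : (J → MonoidAlgebra ℤ U) →ₗ[MonoidAlgebra ℤ U] MonoidAlgebra ℤ U)
    (f : U → U → K) : (J → MonoidAlgebra ℤ U) →+ K where
  toFun := cocycleLift d f
  map_zero' := cocycleLift_zero d f
  map_add' := cocycleLift_add d f

theorem cocycleLiftHom_apply
    (d : (J → MonoidAlgebra ℤ U) →ₗ[MonoidAlgebra ℤ U] MonoidAlgebra ℤ U)
    (f : U → U → K) (v) : cocycleLiftHom d f v = cocycleLift d f v := rfl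

/-- A family of two-cocycles, evaluated on cycles. -/
noncomputable def cocycleDual
    {d : (J → MonoidAlgebra ℤ U) →ₗ[MonoidAlgebra ℤ U] MonoidAlgebra ℤ U}
    (hd : ∀ v, augmentation U (d v) = 0)
    {b : M →ₗ[MonoidAlgebra ℤ U] (J → MonoidAlgebra ℤ U)} (hb : ∀ z, d (b z) = 0)
    {c : V →ₗ[K] (U → U → K)} (hc : ∀ v, IsTwistedCocycle χ (c v)) :
    V →ₗ[K] (M →ₛₗ[charRingHom χ] K) where
  toFun v := semilinearOfEquivariant ((cocycleLiftHom d (c v)).comp b.toAddMonoidHom)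
    fun g z => by
      have := cocycleLift_smul d hd (hc v) g (b z)
      rw [hb, map_zero, add_zero, ← map_smul] at this
      exact this
  map_add' v w := LinearMap.ext fun z => by
    have := cocycleLift_add_left d (c v) (c w) (b z)
    rw [← map_add] at this
    exact this
  map_smul' a v := LinearMap.ext fun z => by
    have := cocycleLift_smul_left d a (c v) (b z)
    rw [← map_smul] at this
    exact this

end CocycleDual

namespace FreeStepResolution

variable {U : Type} [Group U] {n : ℕ} (F : FreeStepResolution U n)

/-- The augmentation of a partial resolution as an additive map to the integers. -/
noncomputable def eps : (Fin (F.rank 0) → MonoidAlgebra ℤ U) →+ ℤ :=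
  (Representation.trivial ℤ U ℤ).asModuleEquiv.toAddEquiv.toAddMonoidHom.comp F.aug.toAddMonoidHom

theorem eps_apply (v) : F.eps v = (Representation.trivial ℤ U ℤ).asModuleEquiv (F.aug v) := rfl

theorem eps_smul (r : MonoidAlgebra ℤ U) (v) : F.eps (r • v) = augmentation U r * F.eps v := by
  rw [eps_apply, map_smul, Representation.asModuleEquiv_map_smul, trivial_asAlgebraHom, ← eps_apply]

theorem eps_eq_zero_iff (hn : 0 < n) (z) : F.eps z = 0 ↔ ∃ w, F.d 0 w = z := by
  rw [eps_apply, LinearEquiv.map_eq_zero_iff]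
  exact F.exact_zero hn z

theorem exists_eps_eq_one : ∃ v, F.eps v = 1 := by
  obtain ⟨v, hv⟩ := F.aug_surjective ((Representation.trivial ℤ U ℤ).asModuleEquiv.symm 1)
  exact ⟨v, by rw [eps_apply, hv, LinearEquiv.apply_symm_apply]⟩

/-- A lift of the augmentation to the group ring. -/
noncomputable def toGroupRing :
    (Fin (F.rank 0) → MonoidAlgebra ℤ U) →ₗ[MonoidAlgebra ℤ U] MonoidAlgebra ℤ U :=
  Fintype.linearCombination _ fun i => ((F.eps (Pi.single i 1) : ℤ) : MonoidAlgebra ℤ U)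

theorem augmentation_toGroupRing (v) : augmentation U (F.toGroupRing v) = F.eps v := by
  have hv : v = ∑ i, v i • Pi.single i (1 : MonoidAlgebra ℤ U) := by
    conv_lhs => rw [← Finset.univ_sum_single v]
    exact sum_congr rfl fun i _ => by rw [← Pi.single_smul, smul_eq_mul, mul_one]
  conv_rhs => rw [hv, map_sum]
  rw [toGroupRing, Fintype.linearCombination_apply, map_sum]
  refine sum_congr rfl fun i _ => ?_
  rw [eps_smul, smul_eq_mul, map_mul, map_intCast, Int.cast_id]

theorem augmentation_toGroupRing_d (hn : 0 < n) (w) :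
    augmentation U (F.toGroupRing (F.d 0 w)) = 0 := by
  rw [augmentation_toGroupRing, F.eps_eq_zero_iff hn]
  exact ⟨w, rfl⟩

theorem sub_smul_mem_range (hn : 0 < n) {v0} (hv0 : F.eps v0 = 1) (x) :
    ∃ w, F.d 0 w = x - F.eps x • v0 := by
  rw [← F.eps_eq_zero_iff hn, map_sub, map_zsmul, hv0]; simp

variable {K : Type*} [Field K] {χ : U →* Kˣ}

theorem eq_zero_of_comp_eq_zero (hn : 0 < n) {v0} (hv0 : F.eps v0 = 1)
    {g : (Fin (F.rank 0) → MonoidAlgebra ℤ U) →ₛₗ[charRingHom χ] K}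
    (hg : ∀ w, g (F.d 0 w) = 0) (h0 : g v0 = 0) : g = 0 := by
  refine LinearMap.ext fun x => ?_
  obtain ⟨w, hw⟩ := F.sub_smul_mem_range hn hv0 x
  have := hg w
  rwa [hw, map_sub, map_zsmul, h0, smul_zero, sub_zero] at this

/-- A cochain on `F_0` is determined by its coboundary and its value at `v0`. The bound serves only
for the existence of `μ_1` when the action is trivial. -/
theorem neg_one_le_signedChi_one (F : FreeStepResolution U 1) : -1 ≤ F.signedChi := by
  obtain ⟨v0, hv0⟩ := F.exists_eps_eq_one
  let χ : U →* ℚˣ := 1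
  let T : ((Fin (F.rank 0) → MonoidAlgebra ℤ U) →ₛₗ[charRingHom χ] ℚ) →ₗ[ℚ]
      ((Fin (F.rank 1) → MonoidAlgebra ℤ U) →ₛₗ[charRingHom χ] ℚ) × ℚ :=
    (semilinearComp χ (F.d 0)).prod
      { toFun := fun g => g v0, map_add' := fun _ _ => rfl, map_smul' := fun _ _ => rfl }
  have hT : Function.Injective T := by
    rw [← LinearMap.ker_eq_bot, LinearMap.ker_eq_bot']
    intro g hg
    have h1 := congrArg Prod.fst hg
    have h2 : g v0 = 0 := congrArg Prod.snd hg
    exact F.eq_zero_of_comp_eq_zero one_pos hv0 (fun w => LinearMap.congr_fun h1 w) h2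
  have := LinearMap.finrank_le_finrank_of_injective hT
  rw [finrank_prod, finrank_semilinear, finrank_semilinear, finrank_self] at this
  simp only [signedChi, sum_range_succ, sum_range_zero]
  simp
  omega

/-- Swan's inequality `μ_1 ≥ h^1 - h^0`, where `χ ≠ 1` makes `h^0` vanish: independent classes in
`H^1` and the cochains on `F_0` embed jointly into the cochains on `F_1`. -/
theorem finrank_le_signedChi_one (F : FreeStepResolution U 1) (hχ : χ ≠ 1) {V : Type*}
    [AddCommGroup V] [Module K V] [Module.Finite K V] (c : V →ₗ[K] (U → K))
    (hc : ∀ v, IsTwistedDerivation χ (c v)) (hinj : ∀ v, IsTwistedPrincipal χ (c v) → v = 0) :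
    (finrank K V : ℤ) ≤ F.signedChi := by
  obtain ⟨v0, hv0⟩ := F.exists_eps_eq_one
  let D : V →ₗ[K] ((Fin (F.rank 1) → MonoidAlgebra ℤ U) →ₛₗ[charRingHom χ] K) :=
    { toFun := fun v => semilinearOfEquivariant
        ((additiveExtension (c v)).toAddMonoidHom.comp
          (F.toGroupRing.toAddMonoidHom.comp (F.d 0).toAddMonoidHom)) fun g w => by
            change additiveExtension (c v) (F.toGroupRing (F.d 0 (_ • w))) = _
            rw [map_smul, map_smul, smul_eq_mul, additiveExtension_derivation (hc v),
              F.augmentation_toGroupRing_d one_pos]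
            simp
      map_add' := fun v w => LinearMap.ext fun z => by
        change additiveExtension (c (v + w)) _ = _
        rw [map_add, additiveExtension_add]; rfl
      map_smul' := fun a v => LinearMap.ext fun z => by
        change additiveExtension (c (a • v)) _ = _
        rw [map_smul, additiveExtension_smul]; rfl }
  have hD : ∀ v w, D v w = additiveExtension (c v) (F.toGroupRing (F.d 0 w)) := fun _ _ => rfl
  let T : (V × ((Fin (F.rank 0) → MonoidAlgebra ℤ U) →ₛₗ[charRingHom χ] K)) →ₗ[K]
      ((Fin (F.rank 1) → MonoidAlgebra ℤ U) →ₛₗ[charRingHom χ] K) :=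
    D.coprod (-semilinearComp χ (F.d 0))
  have hT : Function.Injective T := by
    rw [← LinearMap.ker_eq_bot, LinearMap.ker_eq_bot']
    rintro ⟨v, g⟩ hvg
    have h1 : ∀ w, additiveExtension (c v) (F.toGroupRing (F.d 0 w)) = g (F.d 0 w) := fun w => by
      have := LinearMap.congr_fun hvg w
      simp only [T, LinearMap.coprod_apply, LinearMap.add_apply, hD, LinearMap.neg_apply] at this
      exact eq_of_sub_eq_zero ((sub_eq_add_neg _ _).trans this)
    have hv : v = 0 := by
      refine hinj v ⟨g v0 - additiveExtension (c v) (F.toGroupRing v0), fun h => ?_⟩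
      obtain ⟨w, hw⟩ := exists_boundary_eq_sub F.eps_smul (F.eps_eq_zero_iff one_pos) v0 h
      have h2 := h1 w
      rw [hw, map_sub, map_smul, map_sub, smul_eq_mul, additiveExtension_derivation (hc v),
        F.augmentation_toGroupRing, hv0, map_sub, semilinear_of_smul] at h2
      push_cast at h2
      linear_combination h2
    subst hv
    have h2 : ∀ w, g (F.d 0 w) = 0 := fun w => by
      rw [← h1, map_zero]
      have := additiveExtension_smul (0 : K) (0 : U → K) (F.toGroupRing (F.d 0 w))
      rwa [zero_smul, zero_mul] at this
    obtain ⟨h, hh⟩ : ∃ h, χ h ≠ 1 := by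
      by_contra! hcon
      exact hχ (MonoidHom.ext hcon)
    have h3 : g v0 = 0 := by
      obtain ⟨w, hw⟩ := exists_boundary_eq_sub F.eps_smul (F.eps_eq_zero_iff one_pos) v0 h
      have h4 := h2 w
      rw [hw, map_sub, semilinear_of_smul, ← sub_one_mul, mul_eq_zero] at h4
      refine h4.resolve_left fun h5 => hh ?_
      exact Units.ext (sub_eq_zero.mp h5)
    rw [F.eq_zero_of_comp_eq_zero one_pos hv0 h2 h3]
    rfl
  have := LinearMap.finrank_le_finrank_of_injective hT
  rw [finrank_prod, finrank_semilinear, finrank_semilinear] at this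
  simp only [signedChi, sum_range_succ, sum_range_zero]
  simp
  omega

/-- Cocycles modulo coboundaries on `F_1` are derivations modulo principal ones, through evaluation
on lifts of `g v0 - v0`. The map `ev` detects these classes, so `W` bounds `h^1`. -/
theorem finrank_ker_le (F : FreeStepResolution U 2) {W : Type*} [AddCommGroup W] [Module K W]
    [Module.Finite K W] (ev : (U → K) →ₗ[K] W)
    (hev : ∀ δ, IsTwistedDerivation χ δ → ev δ = 0 → IsTwistedPrincipal χ δ) :
    finrank K (LinearMap.ker (semilinearComp (K := K) χ (F.d 1))) ≤
      finrank K W + finrank K (LinearMap.range (semilinearComp (K := K) χ (F.d 0))) := by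
  obtain ⟨v0, hv0⟩ := F.exists_eps_eq_one
  choose w hw using exists_boundary_eq_sub F.eps_smul (F.eps_eq_zero_iff two_pos) v0
  set Z := LinearMap.ker (semilinearComp (K := K) χ (F.d 1))
  have hZ : ∀ f : Z, ∀ v, F.d 0 v = 0 → f.1 v = 0 := fun f v hv => by
    obtain ⟨z, rfl⟩ := (F.exact_succ 0 (by norm_num) v).1 hv
    exact LinearMap.congr_fun (LinearMap.mem_ker.mp f.2) z
  let T : Z →ₗ[K] W := ev ∘ₗ
    { toFun := fun f g => f.1 (w g), map_add' := fun _ _ => rfl, map_smul' := fun _ _ => rfl }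
  have hT : ∀ f ∈ LinearMap.ker T, f.1 ∈ LinearMap.range (semilinearComp (K := K) χ (F.d 0)) := by
    intro f hf
    have hder : IsTwistedDerivation χ fun g => f.1 (w g) := fun g h => by
      have h0 : F.d 0 (w (g * h) - w g - MonoidAlgebra.of ℤ U g • w h) = 0 := by
        rw [map_sub, map_sub, map_smul, hw, hw, hw, map_mul, smul_sub, mul_smul]; abel
      have h1 := hZ f _ h0
      rw [map_sub, map_sub, semilinear_of_smul] at h1
      linear_combination h1
    obtain ⟨s, hs⟩ := hev _ hder hf
    refine mem_range_semilinearComp F.eps_smul (F.eps_eq_zero_iff two_pos) hv0 (hZ f) (s := s)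
      fun g z hz => ?_
    rw [← hs]
    have := hZ f (z - w g) (by rw [map_sub, hw, hz, sub_self])
    rwa [map_sub, sub_eq_zero] at this
  have hsum := LinearMap.finrank_range_add_finrank_ker (V := Z) (V₂ := W) T
  refine hsum.symm.le.trans (add_le_add (Submodule.finrank_le (LinearMap.range T)) ?_)
  let I : LinearMap.ker T →ₗ[K] LinearMap.range (semilinearComp (K := K) χ (F.d 0)) :=
    { toFun := fun f => ⟨f.1.1, hT f.1 f.2⟩, map_add' := fun _ _ => rfl
      map_smul' := fun _ _ => rfl }
  refine LinearMap.finrank_le_finrank_of_injective (f := I) fun a b hab => ?_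
  exact Subtype.ext (Subtype.ext (congrArg (fun z => z.1) hab))

/-- Swan's inequality `μ_2 ≥ h^2 - h^1 + h^0`: `V` supplies classes in `H^2`, `W` bounds `h^1` from
above and `b` bounds `h^0` from below. The rest is rank–nullity for the two coboundary maps. -/
theorem finrank_sub_le_signedChi_two (F : FreeStepResolution U 2) {V W : Type*}
    [AddCommGroup V] [Module K V] [Module.Finite K V] [AddCommGroup W] [Module K W]
    [Module.Finite K W] (c : V →ₗ[K] (U → U → K))
    (hc : ∀ v, IsTwistedCocycle χ (c v)) (hinj : ∀ v, IsTwistedCoboundary χ (c v) → v = 0)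
    (ev : (U → K) →ₗ[K] W)
    (hev : ∀ δ, IsTwistedDerivation χ δ → ev δ = 0 → IsTwistedPrincipal χ δ)
    {b : ℕ} (hb : b = 0 ∨ b = 1 ∧ χ = 1) :
    (finrank K V : ℤ) - finrank K W + b ≤ F.signedChi := by
  obtain ⟨v0, hv0⟩ := F.exists_eps_eq_one
  set d0 := semilinearComp (K := K) χ (F.d 0)
  set d1 := semilinearComp (K := K) χ (F.d 1)
  have hphi := F.augmentation_toGroupRing_d two_pos
  have hd01 : ∀ z, F.d 0 (F.d 1 z) = 0 := fun z => (F.exact_succ 0 (by norm_num) _).2 ⟨z, rfl⟩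
  have hb' : ∀ z, (F.toGroupRing ∘ₗ F.d 0) (F.d 1 z) = 0 := fun z => by
    rw [LinearMap.comp_apply, hd01, map_zero]
  let L := cocycleDual (d := F.toGroupRing ∘ₗ F.d 0) hphi hb' hc
  have hL : ∀ v, L v ∈ LinearMap.range d1 → v = 0 := by
    rintro v ⟨g, hg⟩
    refine hinj v (isTwistedCoboundary_of_lift F.eps_smul (F.eps_eq_zero_iff two_pos) hv0
      F.augmentation_toGroupRing (hc v)
      (m := cocycleLiftHom (F.toGroupRing ∘ₗ F.d 0) (c v) - g.toAddMonoidHom) ?_ ?_)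
    · intro h x
      have h1 := cocycleLift_smul (F.toGroupRing ∘ₗ F.d 0) hphi (hc v) h x
      have h2 := semilinear_of_smul g h x
      rw [LinearMap.comp_apply] at h1
      change cocycleLift (F.toGroupRing ∘ₗ F.d 0) (c v) (MonoidAlgebra.of ℤ U h • x) -
        g (MonoidAlgebra.of ℤ U h • x) =
          χ h * (cocycleLift (F.toGroupRing ∘ₗ F.d 0) (c v) x - g x) + _
      rw [h1, h2]
      ring
    · intro x hx
      obtain ⟨z, rfl⟩ := (F.exact_succ 0 (by norm_num) x).1 hx
      have := LinearMap.congr_fun hg z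
      exact sub_eq_zero.mpr this.symm
  have h2 : finrank K V ≤ finrank K (_ ⧸ LinearMap.range d1) := by
    refine LinearMap.finrank_le_finrank_of_injective (f := (LinearMap.range d1).mkQ ∘ₗ L) ?_
    rw [← LinearMap.ker_eq_bot, LinearMap.ker_eq_bot']
    intro v hv
    exact hL v ((Submodule.Quotient.mk_eq_zero _).1 hv)
  have e2 := Submodule.finrank_quotient_add_finrank (LinearMap.range d1)
  have e1 := LinearMap.finrank_range_add_finrank_ker d1
  have e0 := LinearMap.finrank_range_add_finrank_ker d0
  rw [finrank_semilinear] at e0 e1 e2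
  change _ = F.rank 2 at e2
  have h1 : finrank K (LinearMap.ker d1) ≤ finrank K W + finrank K (LinearMap.range d0) :=
    F.finrank_ker_le ev hev
  have h0 : b ≤ finrank K (LinearMap.ker d0) := by
    rcases hb with rfl | ⟨rfl, rfl⟩
    · exact Nat.zero_le _
    · rw [Nat.one_le_iff_ne_zero]
      intro h
      rw [Submodule.finrank_eq_zero] at h
      -- The augmentation is an invariant cochain that kills boundaries and takes the value `1` at
      -- `v0`.
      let E : (Fin (F.rank 0) → MonoidAlgebra ℤ U) →ₛₗ[charRingHom (1 : U →* Kˣ)] K :=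
        semilinearOfEquivariant ((Int.castAddHom K).comp F.eps) fun g v => by
          change ((F.eps _ : ℤ) : K) = _ * ((F.eps v : ℤ) : K)
          rw [F.eps_smul, augmentation_of]; simp
      have hE : E ∈ LinearMap.ker d0 := LinearMap.mem_ker.mpr <| LinearMap.ext fun w => by
        change ((F.eps (F.d 0 w) : ℤ) : K) = 0
        rw [(F.eps_eq_zero_iff two_pos _).2 ⟨w, rfl⟩, Int.cast_zero]
      rw [h, Submodule.mem_bot] at hE
      have : ((F.eps v0 : ℤ) : K) = 0 := LinearMap.congr_fun hE v0
      rw [hv0, Int.cast_one] at this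
      exact one_ne_zero this
  simp only [signedChi, sum_range_succ, sum_range_zero]
  simp
  omega

end FreeStepResolution

end

section

open Finset Module

/-! ### Isotypic actions are scalar actions over the prime field. -/

section IsotypicAction

variable {p k : ℕ} {C : Type} [Group C]

/-- The standard generators of the elementary abelian group. -/
def elemGen (p : ℕ) {k : ℕ} (i : Fin k) : ElemAb p k := Multiplicative.ofAdd (Pi.single i 1)

theorem elemGen_pow (i : Fin k) (n : ℕ) :
    elemGen p i ^ n = Multiplicative.ofAdd (Pi.single i (n : ZMod p)) := by
  rw [elemGen, ← ofAdd_nsmul, ← Pi.single_smul, nsmul_one]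

theorem elemGen_pow_self (i : Fin k) : elemGen p i ^ p = 1 := by
  rw [elemGen_pow]; simp

theorem eq_top_of_elemGen_mem [NeZero p] {P : Submonoid (ElemAb p k)}
    (h : ∀ i, elemGen p i ∈ P) : P = ⊤ := by
  refine eq_top_iff.2 fun u _ => ?_
  have hu : u = ∏ i, elemGen p i ^ (u.toAdd i).val := by
    apply Multiplicative.toAdd.injective
    simp only [elemGen_pow, ZMod.natCast_zmod_val, toAdd_prod, toAdd_ofAdd]
    exact (Finset.univ_sum_single _).symm
  rw [hu]
  exact prod_mem fun i _ => pow_mem (h i) _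

variable (φ : C →* MulAut (ElemAb p k)) in
/-- The action multiplies by a character with values in the prime field. -/
def IsScalarAction (a : C →* (ZMod p)ˣ) : Prop :=
  ∀ c u, φ c u = Multiplicative.ofAdd ((a c : ZMod p) • u.toAdd)

/-- On `Hom(E_k, K)` every `c` acts by the scalar `α c`. Testing on the coordinate functionals shows
that `E_k` itself is acted on by a scalar, and a diagonal matrix entry places it in the prime field.
The inverse comes from the contragredient action. -/
theorem IsIsotypicAction.exists_isScalarAction [Fact p.Prime] (hk : 0 < k)
    {φ : C →* MulAut (ElemAb p k)} {K : Type*} [Field K] [CharP K p] {α : C →* Kˣ}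
    (h : IsIsotypicAction φ α) :
    ∃ a : C →* (ZMod p)ˣ, IsScalarAction φ a ∧
      ∀ c, ZMod.castHom (dvd_refl p) K (a c) = α c⁻¹ := by
  obtain ⟨e⟩ := h
  set κ := ZMod.castHom (dvd_refl p) K
  have hκ : Function.Injective κ := κ.injective
  have hscal : ∀ c v, (Representation.directSum fun _ : Fin k => charRep α) c v = (α c : K) • v := by
    intro c v
    ext i
    rfl
  have hrep : ∀ c f, homRep K φ c f = (α c : K) • f := fun c f => by
    apply e.toLinearEquiv.injective
    have h1 := LinearMap.congr_fun (e.isIntertwining' c) f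
    have h2 := (hscal c (e.toLinearEquiv f)).trans (map_smul e.toLinearEquiv (α c : K) f).symm
    exact h1.trans h2
  let f (i : Fin k) : Additive (ElemAb p k) →+ K :=
    { toFun := fun u => κ (u.toMul.toAdd i)
      map_zero' := map_zero κ
      map_add' := fun u v => map_add κ _ _ }
  have hf : ∀ c i (u : ElemAb p k), κ ((φ c⁻¹ u).toAdd i) = α c * κ (u.toAdd i) := fun c i u =>
    DFunLike.congr_fun (hrep c (f i)) (Additive.ofMul u)
  let o : Fin k := ⟨0, hk⟩
  let b (c : C) : ZMod p := (φ c (elemGen p o)).toAdd o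
  have hb : ∀ c, κ (b c) = α c⁻¹ := fun c => by
    have := hf c⁻¹ o (elemGen p o)
    rw [inv_inv] at this
    rw [this]
    simp [elemGen]
  let a' : C →* ZMod p :=
    { toFun := b
      map_one' := hκ (by rw [hb]; simp)
      map_mul' := fun c d => hκ (by rw [map_mul, hb, hb, hb]; simp [mul_comm]) }
  refine ⟨a'.toHomUnits, fun c u => ?_, hb⟩
  apply Multiplicative.toAdd.injective
  funext i
  apply hκ
  have := hf c⁻¹ i u
  rw [inv_inv] at this
  rw [this, ← hb, ← map_mul]
  rfl

theorem pow_eq_one_iff_of_cast_eq [Fact p.Prime] {K : Type*} [Field K] [CharP K p] {α : C →* Kˣ}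
    {a : C →* (ZMod p)ˣ} (h : ∀ c, ZMod.castHom (dvd_refl p) K (a c) = α c⁻¹) (n : ℕ) :
    α ^ n = 1 ↔ a ^ n = 1 := by
  have key : ∀ c, (α c⁻¹) ^ n = 1 ↔ (a c) ^ n = 1 := fun c => by
    rw [← Units.val_inj, ← Units.val_inj, Units.val_pow_eq_pow_val, Units.val_pow_eq_pow_val, ← h,
      ← map_pow, Units.val_one, Units.val_one, map_eq_one_iff _ (RingHom.injective _)]
  constructor
  · intro h1
    ext c : 1
    exact (key c).1 (DFunLike.congr_fun h1 c⁻¹)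
  · intro h1
    ext c : 1
    have := (key c⁻¹).2 (DFunLike.congr_fun h1 c⁻¹)
    rwa [inv_inv] at this

end IsotypicAction

/-! ### The presentation of the semidirect product and the choice of exponents. -/

section Presentation

variable {p k : ℕ} [Fact p.Prime] {C : Type} [Group C] [Finite C] {φ : C →* MulAut (ElemAb p k)}
  {a : C →* (ZMod p)ˣ}

open SemidirectProduct in
theorem IsScalarAction.scalarPresentation (hφ : IsScalarAction φ a) {c : C}
    (hc : ∀ g, g ∈ Subgroup.zpowers c) {s t : ℕ} (hs : s.Coprime p) (ht : t.Coprime p)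
    (hst : (s : ZMod p) = a c * t) :
    ScalarPresentation p (Nat.card C) s t
      (fun i : Fin k => (inl (elemGen p i) : ElemAb p k ⋊[φ] C)) (inr c) where
  comm i j := (Commute.all (elemGen p i) (elemGen p j)).map inl
  pow_x i := by rw [← map_pow, elemGen_pow_self, map_one]
  pow_y := by rw [← map_pow, pow_card_eq_one', map_one]
  conj i := by
    have h1 : φ c (elemGen p i ^ t) = elemGen p i ^ s := by
      rw [hφ, elemGen_pow, elemGen_pow, toAdd_ofAdd, ← Pi.single_smul, smul_eq_mul, hst]
    rw [← map_pow, ← map_pow, ← h1, inl_aut, mul_assoc, ← map_mul inr,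
      inv_mul_cancel, map_one, mul_one]
  coprime_s := hs
  coprime_t := ht
  pos := (Fact.out : p.Prime).pos
  closure := by
    refine eq_top_iff.2 fun u _ => ?_
    set S := Submonoid.closure (Set.range fun o : Option (Fin k) =>
      o.elim (inr c : ElemAb p k ⋊[φ] C) fun i => inl (elemGen p i))
    have h1 : S.comap (inl : ElemAb p k →* ElemAb p k ⋊[φ] C) = ⊤ :=
      eq_top_of_elemGen_mem fun i => Submonoid.subset_closure ⟨some i, rfl⟩
    have h2 : inl u.left ∈ S := by
      have : u.left ∈ S.comap (inl : ElemAb p k →* ElemAb p k ⋊[φ] C) := h1 ▸ Submonoid.mem_top _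
      exact this
    obtain ⟨n, hn⟩ : u.right ∈ Submonoid.powers c := mem_powers_iff_mem_zpowers.2 (hc u.right)
    rw [← inl_left_mul_inr_right u]
    refine mul_mem h2 ?_
    have h3 : (inr c : ElemAb p k ⋊[φ] C) ∈ S := Submonoid.subset_closure ⟨none, rfl⟩
    simp only [← hn, map_pow]
    exact pow_mem h3 n
  lift := by
    intro H _ X Y hX hXp hY hYX
    let f (i : Fin k) : Multiplicative (ZMod p) →* H := AddMonoidHom.toMultiplicativeLeft
      (ZMod.lift p ⟨zmultiplesHom (Additive H) (Additive.ofMul (X i)), by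
        rw [zmultiplesHom_apply, natCast_zsmul, ← ofMul_pow, hXp, ofMul_one]⟩)
    have hf : ∀ i (n : ℕ), f i (Multiplicative.ofAdd (n : ZMod p)) = X i ^ n := fun i n => by
      have h1 : f i (Multiplicative.ofAdd 1) = X i := by
        have := ZMod.lift_coe p ⟨zmultiplesHom (Additive H) (Additive.ofMul (X i)), by
          rw [zmultiplesHom_apply, natCast_zsmul, ← ofMul_pow, hXp, ofMul_one]⟩ 1
        rw [Int.cast_one] at this
        exact this.trans (one_zsmul _)
      rw [← h1, ← map_pow, ← ofAdd_nsmul, nsmul_one]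
    have hcomm : Pairwise fun i j => ∀ (u v : Multiplicative (ZMod p)), Commute (f i u) (f j v) := by
      intro i j _ u v
      obtain ⟨n, rfl⟩ : ∃ n : ℕ, Multiplicative.ofAdd (n : ZMod p) = u :=
        ⟨u.toAdd.val, ZMod.natCast_zmod_val _⟩
      obtain ⟨n', rfl⟩ : ∃ n : ℕ, Multiplicative.ofAdd (n : ZMod p) = v :=
        ⟨v.toAdd.val, ZMod.natCast_zmod_val _⟩
      rw [hf, hf]
      exact (hX i j).pow_pow _ _
    let fE : ElemAb p k →* H := (MonoidHom.noncommPiCoprod f hcomm).comp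
      (MulEquiv.piMultiplicative fun _ : Fin k => ZMod p).toMonoidHom
    have hfE : ∀ i, fE (elemGen p i) = X i := fun i => by
      have h1 : MulEquiv.piMultiplicative (fun _ : Fin k => ZMod p) (elemGen p i) =
          Pi.mulSingle i (Multiplicative.ofAdd 1) := by
        funext j
        rcases eq_or_ne j i with rfl | hj
        · rw [Pi.mulSingle_eq_same]; simp [elemGen]
        · rw [Pi.mulSingle_eq_of_ne hj]; simp [elemGen, hj]
      change MonoidHom.noncommPiCoprod f hcomm
        (MulEquiv.piMultiplicative (fun _ : Fin k => ZMod p) (elemGen p i)) = _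
      rw [h1, MonoidHom.noncommPiCoprod_mulSingle]
      simpa using hf i 1
    have hord : orderOf Y ∣ orderOf c := by
      rw [orderOf_eq_card_of_forall_mem_zpowers hc]
      exact orderOf_dvd_of_pow_eq_one hY
    let fC : C →* H := monoidHomOfForallMemZpowers hc hord
    have hfC : fC c = Y := monoidHomOfForallMemZpowers_apply_gen hc hord
    have hgen : fE.comp (MulEquiv.toMonoidHom (φ c)) =
        (MulEquiv.toMonoidHom (MulAut.conj (fC c))).comp fE := by
      have : MonoidHom.eqLocusM (fE.comp (MulEquiv.toMonoidHom (φ c)))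
          ((MulEquiv.toMonoidHom (MulAut.conj (fC c))).comp fE) = ⊤ := by
        refine eq_top_of_elemGen_mem fun i => ?_
        -- As `r` inverts `t` modulo `p`, each generator is the `r`-th power of its own `t`-th
        -- power, to which the relation applies.
        obtain ⟨r, hr⟩ := Nat.exists_mul_mod_eq_one_of_coprime ht (Fact.out : p.Prime).one_lt
        have hr' : ∀ {M : Type} [Monoid M] (z : M), z ^ p = 1 → (z ^ t) ^ r = z := by
          intro M _ z hz
          rw [← pow_mul, ← Nat.mod_add_div (t * r) p, hr.2, pow_add, pow_mul, hz]; simp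
        have h1 : φ c (elemGen p i) = (elemGen p i ^ s) ^ r := by
          conv_lhs => rw [← hr' _ (elemGen_pow_self i), map_pow]
          congr 1
          rw [hφ, elemGen_pow, elemGen_pow, toAdd_ofAdd, ← Pi.single_smul, smul_eq_mul, hst]
        change fE (φ c (elemGen p i)) = MulAut.conj (fC c) (fE (elemGen p i))
        rw [h1, map_pow, map_pow, hfE, hfC]
        conv_rhs => rw [← hr' _ (hXp i), map_pow, MulAut.conj_apply, hYX, mul_inv_cancel_right]
      exact MonoidHom.ext fun u => (this ▸ Submonoid.mem_top u : u ∈ MonoidHom.eqLocusM _ _)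
    have hall : ∀ g, fE.comp (MulEquiv.toMonoidHom (φ g)) =
        (MulEquiv.toMonoidHom (MulAut.conj (fC g))).comp fE := fun g => by
      obtain ⟨n, rfl⟩ : g ∈ Submonoid.powers c := mem_powers_iff_mem_zpowers.2 (hc g)
      induction n with
      | zero => ext u; simp
      | succ n ih =>
        refine MonoidHom.ext fun u => ?_
        have h1 := DFunLike.congr_fun hgen u
        have h2 := DFunLike.congr_fun ih (φ c u)
        change fE (φ c u) = MulAut.conj (fC c) (fE u) at h1
        change fE (φ (c ^ n) (φ c u)) = MulAut.conj (fC (c ^ n)) (fE (φ c u)) at h2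
        change fE (φ (c ^ (n + 1)) u) = MulAut.conj (fC (c ^ (n + 1))) (fE u)
        rw [pow_succ, map_mul φ, MulAut.mul_apply, h2, h1, map_mul fC, map_mul MulAut.conj,
          MulAut.mul_apply]
    exact ⟨SemidirectProduct.lift fE fC hall, fun i => by rw [lift_inl, hfE],
      by rw [lift_inr, hfC]⟩

/-- Replacing `s` by `s + p` changes `n` modulo `p` by `m ((s + 1) ^ (m - 1) - s ^ (m - 1))`. This
is nonzero, since otherwise comparison with `(s + 1) ^ m = s ^ m` would give `s + 1 = s`; so one of
the two lifts works. -/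
theorem exists_pow_eq_add_mul {m s : ℕ} (hm : m.Coprime p) (hs : (s : ZMod p) ≠ 0)
    (hst : ((s + 1 : ℕ) : ZMod p) ^ m = (s : ZMod p) ^ m) :
    ∃ s' : ℕ, (s' : ZMod p) = s ∧ ∃ n, (s' + 1) ^ m = s' ^ m + p * n ∧ n.Coprime p := by
  have hp : p.Prime := Fact.out
  have hdvd : ∀ s' : ℕ, (s' : ZMod p) = s → ∃ n, (s' + 1) ^ m = s' ^ m + p * n := fun s' hs' => by
    have h1 : s' ^ m ≤ (s' + 1) ^ m := Nat.pow_le_pow_left (Nat.le_succ s') m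
    have h2 : p ∣ (s' + 1) ^ m - s' ^ m := by
      rw [← ZMod.natCast_eq_zero_iff, Nat.cast_sub h1]
      push_cast at hst ⊢
      rw [hs', hst, sub_self]
    obtain ⟨n, hn⟩ := h2
    exact ⟨n, by omega⟩
  obtain ⟨n, hn⟩ := hdvd s rfl
  obtain ⟨n', hn'⟩ := hdvd (s + p) (by simp)
  by_cases hnp : n.Coprime p
  · exact ⟨s, rfl, n, hn, hnp⟩
  refine ⟨s + p, by simp, n', hn', ?_⟩
  rw [Nat.coprime_comm, hp.coprime_iff_not_dvd] at hnp ⊢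
  rw [not_not] at hnp
  intro hd
  obtain ⟨u, hu⟩ := Polynomial.powAddExpansion s p m
  obtain ⟨v, hv⟩ := Polynomial.powAddExpansion (s + 1) p m
  have h1 : n + m * (s + 1) ^ (m - 1) + v * p = m * s ^ (m - 1) + u * p + n' := by
    apply Nat.eq_of_mul_eq_mul_left hp.pos
    have : s + p + 1 = s + 1 + p := by ring
    rw [this] at hn'
    rw [hu, hv] at hn'
    linarith
  have h2 := congrArg (Nat.cast : ℕ → ZMod p) h1
  have hn0 := (ZMod.natCast_eq_zero_iff n p).2 hnp
  have hn0' := (ZMod.natCast_eq_zero_iff n' p).2 hd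
  push_cast at h2 hst
  rw [hn0, hn0'] at h2
  simp only [CharP.cast_eq_zero, mul_zero, add_zero, zero_add] at h2
  have hm0 : (m : ZMod p) ≠ 0 := by
    rw [Ne, ZMod.natCast_eq_zero_iff, ← hp.coprime_iff_not_dvd, Nat.coprime_comm]
    exact hm
  have h3 := mul_left_cancel₀ hm0 h2
  have hmpos : m ≠ 0 := fun h0 => hm0 (by rw [h0, Nat.cast_zero])
  obtain ⟨q, rfl⟩ := Nat.exists_eq_succ_of_ne_zero hmpos
  rw [Nat.succ_sub_one] at h3
  rw [pow_succ, pow_succ, h3] at hst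
  have := mul_left_cancel₀ (pow_ne_zero q hs) hst
  simp at this

theorem natCast_ne_zero_iff_coprime (s : ℕ) : (s : ZMod p) ≠ 0 ↔ s.Coprime p := by
  rw [Ne, ZMod.natCast_eq_zero_iff, ← (Fact.out : p.Prime).coprime_iff_not_dvd, Nat.coprime_comm]

/-- The solution of `s = A (s + 1)` is `s = A / (1 - A)`, with `s + 1 = 1 / (1 - A)`. -/
theorem exists_consecutive_ratio {A : ZMod p} (h0 : A ≠ 0) (h1 : A ≠ 1) :
    ∃ s : ℕ, (s : ZMod p) ≠ 0 ∧ ((s + 1 : ℕ) : ZMod p) ≠ 0 ∧ (s : ZMod p) = A * (s + 1 : ℕ) := by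
  have h2 : 1 - A ≠ 0 := sub_ne_zero.2 h1.symm
  have hs : ((A / (1 - A)).val : ZMod p) = A / (1 - A) := ZMod.natCast_zmod_val _
  have ht : (((A / (1 - A)).val + 1 : ℕ) : ZMod p) = 1 / (1 - A) := by
    rw [Nat.cast_add, hs]; field_simp; simp
  refine ⟨(A / (1 - A)).val, ?_, ?_, ?_⟩
  · rw [hs]; exact div_ne_zero h0 h2
  · rw [ht]; exact div_ne_zero one_ne_zero h2
  · rw [hs, ht]; ring

theorem pow_apply_generator_eq_one_iff {c : C} (hc : ∀ g, g ∈ Subgroup.zpowers c) (n : ℕ) :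
    (a c : ZMod p) ^ n = 1 ↔ a ^ n = 1 := by
  rw [← Units.val_pow_eq_pow_val, ← Units.val_one, Units.val_inj]
  constructor
  · intro h
    ext g : 1
    obtain ⟨j, rfl⟩ : g ∈ Submonoid.powers c := mem_powers_iff_mem_zpowers.2 (hc g)
    change a (c ^ j) ^ n = 1
    rw [map_pow, pow_right_comm, h, one_pow]
  · intro h
    exact DFunLike.congr_fun h c

open SemidirectProduct in
theorem IsScalarAction.exists_scalarPresentation (hφ : IsScalarAction φ a) (ha : a ≠ 1)
    (hC : (Nat.card C).Coprime p) {c : C} (hc : ∀ g, g ∈ Subgroup.zpowers c) :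
    ∃ s n, ScalarPresentation p (Nat.card C) s (s + 1)
      (fun i : Fin k => (inl (elemGen p i) : ElemAb p k ⋊[φ] C)) (inr c) ∧
      (s + 1) ^ Nat.card C = s ^ Nat.card C + p * n ∧ n.Coprime p ∧
      (s : ZMod p) = a c * (s + 1 : ℕ) := by
  obtain ⟨s0, hs0, ht0, hst0⟩ := exists_consecutive_ratio (A := (a c : ZMod p)) (Units.ne_zero (a c)) fun h =>
    ha <| MonoidHom.ext fun g => (pow_one (a g)).symm.trans
      (DFunLike.congr_fun ((pow_apply_generator_eq_one_iff hc 1).1 (by rw [h, one_pow])) g)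
  have hpow : (a c : ZMod p) ^ Nat.card C = 1 := by
    rw [← Units.val_pow_eq_pow_val, ← map_pow, pow_card_eq_one', map_one, Units.val_one]
  obtain ⟨s, hs, n, hn, hnp⟩ := exists_pow_eq_add_mul (s := s0) hC hs0 (by
    conv_rhs => rw [hst0, mul_pow, hpow, one_mul])
  refine ⟨s, n, hφ.scalarPresentation hc ?_ ?_ ?_, hn, hnp, ?_⟩
  · rw [← natCast_ne_zero_iff_coprime, hs]; exact hs0
  · rw [← natCast_ne_zero_iff_coprime]; push_cast at ht0 ⊢; rwa [hs]
  · push_cast at hst0 ⊢; rw [hs]; exact hst0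
  · push_cast at hst0 ⊢; rw [hs]; exact hst0

theorem IsScalarAction.exists_resolution_trivial [IsCyclic C] (hφ : IsScalarAction φ a)
    (hk : 1 < k) (hC : (Nat.card C).Coprime p) (ha : a = 1) :
    (∃ F : FreeStepResolution (ElemAb p k ⋊[φ] C) 1, F.signedChi = k) ∧
      ∃ F : FreeStepResolution (ElemAb p k ⋊[φ] C) 2, F.signedChi = k.choose 2 + 1 := by
  obtain ⟨c, hc⟩ := IsCyclic.exists_generator (α := C)
  have S := hφ.scalarPresentation hc (s := 1) (t := 1) (Nat.coprime_one_left p)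
    (Nat.coprime_one_left p) (by simp [ha])
  exact S.exists_resolution_involutive true ⟨0, by omega⟩ fun N h =>
    relatorsVanish_of_trivial S.scalarRelations hC
      (fun j hj => lt_of_le_of_ne (Nat.zero_le _) (Ne.symm hj)) h

theorem IsScalarAction.exists_resolution_involutive [IsCyclic C] (hφ : IsScalarAction φ a)
    (hk : 1 < k) (hC : (Nat.card C).Coprime p) (ha : a ≠ 1) :
    (∃ F : FreeStepResolution (ElemAb p k ⋊[φ] C) 1, F.signedChi = k) ∧
      ∃ F : FreeStepResolution (ElemAb p k ⋊[φ] C) 2, F.signedChi = k.choose 2 + 1 := by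
  obtain ⟨c, hc⟩ := IsCyclic.exists_generator (α := C)
  obtain ⟨s, n, S, -⟩ := hφ.exists_scalarPresentation ha hC hc
  exact S.exists_resolution_involutive false ⟨0, by omega⟩ fun N h =>
    relatorsVanish_of_involutive S.scalarRelations (Fact.out : p.Prime).ne_zero Nat.card_pos.ne'
      rfl (fun j hj => lt_of_le_of_ne (Nat.zero_le _) (Ne.symm hj)) h

theorem IsScalarAction.exists_resolution_generic [IsCyclic C] (hφ : IsScalarAction φ a)
    (h2 : p ≠ 2) (hk : 1 < k) (hC : (Nat.card C).Coprime p) (ha : a ^ 2 ≠ 1) :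
    (∃ F : FreeStepResolution (ElemAb p k ⋊[φ] C) 1, F.signedChi = k) ∧
      ∃ F : FreeStepResolution (ElemAb p k ⋊[φ] C) 2, F.signedChi = k.choose 2 := by
  obtain ⟨c, hc⟩ := IsCyclic.exists_generator (α := C)
  have ha1 : a ≠ 1 := by
    rintro rfl
    exact ha (MonoidHom.ext fun g => one_pow 2)
  obtain ⟨s, n, S, hn, hnp, hst⟩ := hφ.exists_scalarPresentation ha1 hC hc
  refine S.exists_resolution_generic ⟨0, by omega⟩ ⟨1, hk⟩ fun N h =>
    relatorsVanish_of_generic S.scalarRelations Fact.out h2 Nat.card_pos.ne'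
      S.exists_mul_sub_one rfl hn hnp S.coprime_s ?_ (by simp [Fin.ext_iff])
      (fun j hj => lt_of_le_of_ne (Nat.zero_le _) (Ne.symm hj)) h
  rw [← natCast_ne_zero_iff_coprime, Nat.cast_add]
  intro h0
  refine ha ((pow_apply_generator_eq_one_iff hc 2).1 ?_)
  have ht := (natCast_ne_zero_iff_coprime (p := p) _).2 S.coprime_t
  -- If `s + t` vanished modulo `p`, the ratio `s / t = a c` would be `-1`.
  have h3 : (a c : ZMod p) = -1 := by
    apply mul_right_cancel₀ ht
    rw [← hst]
    linear_combination h0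
  rw [h3]; ring

end Presentation

end

section

open Finset Module SemidirectProduct

/-! ### Explicit cohomology classes of the semidirect product. -/

section LowerBounds

variable {p k : ℕ} [Fact p.Prime] {C : Type} [Group C] {φ : C →* MulAut (ElemAb p k)}
  {a : C →* (ZMod p)ˣ}

/-- The coordinates of the elementary abelian part. -/
def elemCoord (φ : C →* MulAut (ElemAb p k)) (i : Fin k) (g : ElemAb p k ⋊[φ] C) : ZMod p :=
  g.left.toAdd i

/-- A character of the complement, inflated to the semidirect product. -/
def inflateChar (φ : C →* MulAut (ElemAb p k)) {M : Type*} [Group M] (b : C →* M) :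
    ElemAb p k ⋊[φ] C →* M :=
  b.comp rightHom

@[simp] theorem inflateChar_apply {M : Type*} [Group M] (b : C →* M) (g : ElemAb p k ⋊[φ] C) :
    inflateChar φ b g = b g.right := rfl

theorem inflateChar_eq_one_iff {M : Type*} [Group M] (b : C →* M) :
    inflateChar φ b = 1 ↔ b = 1 := by
  constructor
  · intro h
    ext g : 1
    have := DFunLike.congr_fun h (inr g)
    simpa using this
  · rintro rfl
    rfl

theorem elemCoord_inl_elemGen (i j : Fin k) :
    elemCoord φ i (inl (elemGen p j)) = if i = j then 1 else 0 := by
  simp [elemCoord, elemGen, Pi.single_apply]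

theorem IsScalarAction.elemCoord_mul (hφ : IsScalarAction φ a) (i : Fin k)
    (g h : ElemAb p k ⋊[φ] C) :
    elemCoord φ i (g * h) = elemCoord φ i g + a g.right * elemCoord φ i h := by
  simp only [elemCoord, mul_left, toAdd_mul, Pi.add_apply]
  rw [hφ]
  rfl

theorem twistedDerivation_one {G F : Type*} [Group G] [Field F] {χ : G →* Fˣ} {δ : G → F}
    (hδ : ∀ g h, δ (g * h) = δ g + χ g * δ h) : δ 1 = 0 := by
  have := hδ 1 1
  rw [mul_one, map_one, Units.val_one, one_mul] at this
  simpa using this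

theorem IsTwistedDerivation.apply_inl {F : Type*} [Field F] {b : C →* Fˣ}
    {δ : ElemAb p k ⋊[φ] C → F} (hδ : IsTwistedDerivation (inflateChar φ b) δ)
    (u v : ElemAb p k) : δ (inl (u * v)) = δ (inl u) + δ (inl v) := by
  rw [map_mul, hδ]; simp

theorem IsTwistedDerivation.apply_inl_eq_zero {F : Type*} [Field F] {b : C →* Fˣ}
    {δ : ElemAb p k ⋊[φ] C → F} (hδ : IsTwistedDerivation (inflateChar φ b) δ)
    (h : ∀ i, δ (inl (elemGen p i)) = 0) (u : ElemAb p k) : δ (inl u) = 0 := by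
  let P : Submonoid (ElemAb p k) :=
    { carrier := {u | δ (inl u) = 0}
      one_mem' := by
        change δ (inl 1) = 0
        rw [map_one]; exact twistedDerivation_one hδ
      mul_mem' := fun {u v} hu hv => by
        change δ (inl (u * v)) = 0
        rw [hδ.apply_inl, show δ (inl u) = 0 from hu, show δ (inl v) = 0 from hv, add_zero] }
  have hP : P = ⊤ := eq_top_of_elemGen_mem h
  exact (hP ▸ Submonoid.mem_top u : u ∈ P)

/-- A derivation that vanishes on `E_k` comes from `C`, where averaging over a group of invertible
order makes it principal. -/
theorem IsTwistedDerivation.isTwistedPrincipal [Finite C] {F : Type*} [Field F] {b : C →* Fˣ}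
    {δ : ElemAb p k ⋊[φ] C → F} (hδ : IsTwistedDerivation (inflateChar φ b) δ)
    (h : ∀ i, δ (inl (elemGen p i)) = 0) (hC : (Nat.card C : F) ≠ 0) :
    IsTwistedPrincipal (inflateChar φ b) δ := by
  cases nonempty_fintype C
  have key : ∀ g : C, ∑ j, δ (inr j) = Nat.card C * δ (inr g) + b g * ∑ j, δ (inr j) := fun g => by
    conv_lhs => rw [← Equiv.sum_comp (Equiv.mulLeft g)]
    simp only [Equiv.coe_mulLeft, map_mul, hδ (inr g), sum_add_distrib, ← mul_sum, sum_const,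
      card_univ, Nat.card_eq_fintype_card, nsmul_eq_mul, inflateChar_apply, right_inr]
  refine ⟨-(∑ j, δ (inr j)) / Nat.card C, fun g => ?_⟩
  have h1 : δ g = δ (inr g.right) := by
    conv_lhs => rw [← inl_left_mul_inr_right g]
    rw [hδ, hδ.apply_inl_eq_zero h]; simp
  rw [h1, inflateChar_apply]
  field_simp
  linear_combination -key g.right

/-- On `E_k` the derivation is additive, so the action of `g` multiplies its value by `a g`; the
derivation rule multiplies it by `b g`. -/
theorem IsScalarAction.apply_inl_smul (hφ : IsScalarAction φ a) {b : C →* (ZMod p)ˣ}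
    {δ : ElemAb p k ⋊[φ] C → ZMod p} (hδ : IsTwistedDerivation (inflateChar φ b) δ) (g : C) (i) :
    (b g : ZMod p) * δ (inl (elemGen p i)) = a g * δ (inl (elemGen p i)) := by
  have h1 : δ (inl (φ g (elemGen p i))) = b g * δ (inl (elemGen p i)) := by
    have h2 : inl (φ g (elemGen p i)) * inr g = (inr g * inl (elemGen p i) : ElemAb p k ⋊[φ] C) := by
      rw [inl_aut, mul_assoc, ← map_mul inr, inv_mul_cancel, map_one, mul_one]
    have h3 := congrArg δ h2
    rw [hδ, hδ] at h3
    simp only [inflateChar_apply, right_inl, map_one, Units.val_one, one_mul, right_inr] at h3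
    linear_combination h3
  have h4 : ∀ n : ℕ, δ (inl (elemGen p i ^ n)) = n * δ (inl (elemGen p i)) := fun n => by
    induction n with
    | zero =>
      rw [pow_zero, map_one, Nat.cast_zero, zero_mul]; exact twistedDerivation_one hδ
    | succ n ih => rw [pow_succ, hδ.apply_inl, ih]; push_cast; ring
  have h5 : φ g (elemGen p i) = elemGen p i ^ (a g : ZMod p).val := by
    rw [hφ, elemGen_pow, elemGen, toAdd_ofAdd, ← Pi.single_smul, smul_eq_mul, mul_one,
      ZMod.natCast_zmod_val]
  rw [← h1, h5, h4, ZMod.natCast_zmod_val]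

omit [Group C] in
theorem natCard_ne_zero_of_coprime (hC : (Nat.card C).Coprime p) : (Nat.card C : ZMod p) ≠ 0 :=
  (natCast_ne_zero_iff_coprime _).2 hC

theorem IsScalarAction.isTwistedPrincipal [Finite C] (hφ : IsScalarAction φ a)
    (hC : (Nat.card C).Coprime p) {b : C →* (ZMod p)ˣ} (hb : b ≠ a)
    {δ : ElemAb p k ⋊[φ] C → ZMod p} (hδ : IsTwistedDerivation (inflateChar φ b) δ) :
    IsTwistedPrincipal (inflateChar φ b) δ := by
  obtain ⟨g, hg⟩ : ∃ g, b g ≠ a g := by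
    by_contra! h
    exact hb (MonoidHom.ext h)
  refine hδ.isTwistedPrincipal (fun i => ?_) (natCard_ne_zero_of_coprime hC)
  have := hφ.apply_inl_smul hδ g i
  by_contra h
  exact hg (Units.ext (mul_right_cancel₀ h this))

theorem IsScalarAction.le_signedChi_one [Finite C] (hφ : IsScalarAction φ a) (ha : a ≠ 1)
    (F : FreeStepResolution (ElemAb p k ⋊[φ] C) 1) : (k : ℤ) ≤ F.signedChi := by
  have := F.finrank_le_signedChi_one (χ := inflateChar φ a)
    (fun h => ha ((inflateChar_eq_one_iff a).1 h))
    (Fintype.linearCombination (ZMod p) (elemCoord φ)) ?_ ?_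
  · rwa [finrank_fin_fun] at this
  · intro v g h
    simp only [Fintype.linearCombination_apply, Finset.sum_apply, Pi.smul_apply, smul_eq_mul,
      hφ.elemCoord_mul, mul_add, sum_add_distrib, mul_sum, inflateChar_apply]
    congr 1
    exact sum_congr rfl fun i _ => by ring
  · rintro v ⟨c, hc⟩
    funext i
    have := hc (inl (elemGen p i))
    simpa [Fintype.linearCombination_apply, elemCoord_inl_elemGen] using this

variable (φ a) in
/-- The linear combinations of cup products of two coordinates. -/
def cupCocycle : ({q : Fin k × Fin k // q.1 < q.2} → ZMod p) →ₗ[ZMod p]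
    (ElemAb p k ⋊[φ] C → ElemAb p k ⋊[φ] C → ZMod p) :=
  Fintype.linearCombination (ZMod p) fun q g h =>
    elemCoord φ q.1.1 g * a g.right * elemCoord φ q.1.2 h

theorem cupCocycle_apply (v) (g h : ElemAb p k ⋊[φ] C) :
    cupCocycle φ a v g h =
      ∑ q, v q * (elemCoord φ q.1.1 g * a g.right * elemCoord φ q.1.2 h) := by
  simp [cupCocycle, Fintype.linearCombination_apply, Finset.sum_apply]

theorem IsScalarAction.isTwistedCocycle_cupCocycle (hφ : IsScalarAction φ a) (v) :
    IsTwistedCocycle (inflateChar φ (a ^ 2)) (cupCocycle φ a v) := fun g h j => by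
  simp only [cupCocycle_apply, hφ.elemCoord_mul, mul_sum, ← sum_add_distrib, inflateChar_apply,
    mul_right, map_mul, Units.val_mul, MonoidHom.pow_apply, Units.val_pow_eq_pow_val]
  exact sum_congr rfl fun q _ => by ring

/-- `E_k` is abelian and acts trivially. Antisymmetrization on `E_k` thus kills coboundaries and
recovers the coefficients of cup products. -/
theorem IsTwistedCoboundary.symm_inl {F : Type*} [Field F] {b : C →* Fˣ}
    {f : ElemAb p k ⋊[φ] C → ElemAb p k ⋊[φ] C → F}
    (hf : IsTwistedCoboundary (inflateChar φ b) f) (u v : ElemAb p k) :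
    f (inl u) (inl v) = f (inl v) (inl u) := by
  obtain ⟨ψ, hψ⟩ := hf
  rw [hψ, hψ, ← map_mul, ← map_mul, mul_comm u v]
  simp
  ring

theorem cupCocycle_inl_sub (v) (q : {q : Fin k × Fin k // q.1 < q.2}) :
    cupCocycle φ a v (inl (elemGen p q.1.1)) (inl (elemGen p q.1.2)) -
      cupCocycle φ a v (inl (elemGen p q.1.2)) (inl (elemGen p q.1.1)) = v q := by
  rw [cupCocycle_apply, cupCocycle_apply, Finset.sum_eq_single q, Finset.sum_eq_zero]
  · simp [elemCoord_inl_elemGen]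
  · intro r _
    simp only [elemCoord_inl_elemGen]
    split_ifs with h1 h2
    · exact absurd (h1 ▸ h2 ▸ r.2) (not_lt.2 q.2.le)
    all_goals simp
  · intro r _ hr
    simp only [elemCoord_inl_elemGen]
    split_ifs with h1 h2
    · exact absurd (Subtype.ext (Prod.ext h1 h2)) hr
    all_goals simp
  · simp

theorem eq_zero_of_isTwistedCoboundary_cupCocycle {b : C →* (ZMod p)ˣ} {v}
    (h : IsTwistedCoboundary (inflateChar φ b) (cupCocycle φ a v)) : v = 0 := by
  funext q
  rw [← cupCocycle_inl_sub (φ := φ) (a := a) v q, h.symm_inl, sub_self]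
  rfl

/-- For the character `a ^ 2`, which differs from `a` because `a ≠ 1`, there is no `H^1`; hence `W =
0`. -/
theorem IsScalarAction.le_signedChi_two [Finite C] (hφ : IsScalarAction φ a)
    (hC : (Nat.card C).Coprime p) (ha : a ≠ 1) {b : ℕ} (hb : b = 0 ∨ b = 1 ∧ a ^ 2 = 1)
    (F : FreeStepResolution (ElemAb p k ⋊[φ] C) 2) : (k.choose 2 : ℤ) + b ≤ F.signedChi := by
  have ha2 : a ^ 2 ≠ a := fun h => ha <| MonoidHom.ext fun g => by
    have : a g ^ 2 = a g := DFunLike.congr_fun h g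
    rwa [pow_two, mul_eq_left] at this
  have := F.finrank_sub_le_signedChi_two (χ := inflateChar φ (a ^ 2)) (W := Fin 0 → ZMod p)
    (cupCocycle φ a) hφ.isTwistedCocycle_cupCocycle
    (fun v hv => eq_zero_of_isTwistedCoboundary_cupCocycle hv) 0
    (fun δ hδ _ => hφ.isTwistedPrincipal hC ha2 hδ) (b := b)
    (hb.imp_right fun h => ⟨h.1, (inflateChar_eq_one_iff _).2 h.2⟩)
  rwa [finrank_fin_fun, finrank_fintype_fun_eq_card, card_subtype_lt, Nat.cast_zero, sub_zero]
    at this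

/-- The carry cocycle of the integers modulo `p`. -/
def carry (x y : ZMod p) : ZMod p := ((x.val + y.val) / p : ℕ)

theorem carry_cocycle (x y z : ZMod p) :
    carry (x + y) z + carry x y = carry y z + carry x (y + z) := by
  have hp : 0 < p := (Fact.out : p.Prime).pos
  have key : ∀ x y : ZMod p, p * ((x.val + y.val) / p) + (x + y).val = x.val + y.val :=
    fun x y => by rw [ZMod.val_add, Nat.div_add_mod]
  simp only [carry, ← Nat.cast_add]
  congr 1
  apply Nat.eq_of_mul_eq_mul_left hp
  have h1 := key (x + y) z
  have h2 := key x y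
  have h3 := key y z
  have h4 := key x (y + z)
  rw [← add_assoc] at h4
  rw [mul_add, mul_add]
  omega

theorem carry_comm (x y : ZMod p) : carry x y = carry y x := by
  rw [carry, carry, add_comm]

/-- A carry occurs only at `n = p - 1`. -/
theorem sum_carry_one : ∑ n ∈ range p, carry (n : ZMod p) 1 = 1 := by
  have hp : p.Prime := Fact.out
  obtain ⟨q, rfl⟩ : ∃ q, p = q + 1 := ⟨p - 1, by have := hp.pos; omega⟩
  have hq : 1 < q + 1 := hp.one_lt
  have : Fact (1 < q + 1) := ⟨hq⟩
  have hc : ∀ n < q + 1, carry (n : ZMod (q + 1)) 1 = ((n + 1) / (q + 1) : ℕ) := fun n hn => by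
    rw [carry, ZMod.val_natCast_of_lt hn, ZMod.val_one]
  rw [sum_range_succ, Finset.sum_eq_zero, hc q (Nat.lt_succ_self q), Nat.div_self q.succ_pos]
  · simp
  · intro n hn
    rw [mem_range] at hn
    rw [hc n (by omega), Nat.div_eq_of_lt (by omega), Nat.cast_zero]

variable (φ) in
/-- The linear combinations of the Bockstein classes of the coordinates. -/
def carryCocycle : (Fin k → ZMod p) →ₗ[ZMod p]
    (ElemAb p k ⋊[φ] C → ElemAb p k ⋊[φ] C → ZMod p) :=
  Fintype.linearCombination (ZMod p) fun i g h => carry (elemCoord φ i g) (elemCoord φ i h)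

theorem carryCocycle_apply (w) (g h : ElemAb p k ⋊[φ] C) :
    carryCocycle φ w g h = ∑ i, w i * carry (elemCoord φ i g) (elemCoord φ i h) := by
  simp [carryCocycle, Fintype.linearCombination_apply, Finset.sum_apply]

theorem IsScalarAction.isTwistedCocycle_carryCocycle (hφ : IsScalarAction φ (1 : C →* (ZMod p)ˣ))
    (w) : IsTwistedCocycle (1 : ElemAb p k ⋊[φ] C →* (ZMod p)ˣ) (carryCocycle φ w) :=
    fun g h j => by
  have hmul : ∀ i (g h : ElemAb p k ⋊[φ] C),
      elemCoord φ i (g * h) = elemCoord φ i g + elemCoord φ i h := fun i g h => by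
    rw [hφ.elemCoord_mul]; simp
  simp only [carryCocycle_apply, hmul, mul_sum, ← sum_add_distrib, MonoidHom.one_apply,
    Units.val_one, one_mul, ← mul_add]
  exact sum_congr rfl fun i _ => by rw [carry_cocycle]

theorem sum_carryCocycle (w : Fin k → ZMod p) (i : Fin k) :
    ∑ n ∈ range p, carryCocycle φ w (inl (elemGen p i ^ n)) (inl (elemGen p i)) = w i := by
  have h0 : carry (0 : ZMod p) 0 = 0 := by simp [carry]
  have h1 : ∀ n : ℕ, carryCocycle φ w (inl (elemGen p i ^ n)) (inl (elemGen p i)) =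
      w i * carry (n : ZMod p) 1 := fun n => by
    rw [carryCocycle_apply, Finset.sum_eq_single i]
    · rw [elemCoord_inl_elemGen, if_pos rfl, elemGen_pow]; simp [elemCoord]
    · intro j _ hj
      rw [elemCoord_inl_elemGen, if_neg hj, elemGen_pow]; simp [elemCoord, hj, h0]
    · simp
  simp only [h1, ← mul_sum, sum_carry_one, mul_one]

/-- The sum telescopes up to `p` times a constant, and `x ^ p = 1`. Together with `sum_carryCocycle`
this detects Bockstein classes. -/
theorem IsTwistedCoboundary.sum_pow_eq_zero {b : C →* (ZMod p)ˣ}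
    {f : ElemAb p k ⋊[φ] C → ElemAb p k ⋊[φ] C → ZMod p}
    (hf : IsTwistedCoboundary (inflateChar φ b) f) (i : Fin k) :
    ∑ n ∈ range p, f (inl (elemGen p i ^ n)) (inl (elemGen p i)) = 0 := by
  obtain ⟨ψ, hψ⟩ := hf
  have h1 : ∀ n : ℕ, f (inl (elemGen p i ^ n)) (inl (elemGen p i)) = ψ (inl (elemGen p i)) -
      (ψ (inl (elemGen p i ^ (n + 1))) - ψ (inl (elemGen p i ^ n))) := fun n => by
    rw [hψ, ← map_mul, ← pow_succ, inflateChar_apply, right_inl, map_one, Units.val_one]; ring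
  simp only [h1, sum_sub_distrib, sum_const, card_range, nsmul_eq_mul, CharP.cast_eq_zero, zero_mul]
  have := Finset.sum_range_sub (fun n => ψ (inl (elemGen p i ^ n))) p
  rw [sum_sub_distrib] at this
  rw [this, elemGen_pow_self, pow_zero]; ring

/-- Here `h^2` is at least `k.choose 2 + k`, `h^1` at most `k`, and `h^0` at least `1`. Carries are
symmetric, so antisymmetrization isolates the cup products and sums over powers then isolate the
Bocksteins. -/
theorem IsScalarAction.succ_le_signedChi_two [Finite C]
    (hφ : IsScalarAction φ (1 : C →* (ZMod p)ˣ)) (hC : (Nat.card C).Coprime p)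
    (F : FreeStepResolution (ElemAb p k ⋊[φ] C) 2) : (k.choose 2 : ℤ) + 1 ≤ F.signedChi := by
  have h1 : inflateChar φ (1 : C →* (ZMod p)ˣ) = 1 := (inflateChar_eq_one_iff _).2 rfl
  have h12 : (1 : C →* (ZMod p)ˣ) ^ 2 = 1 := MonoidHom.ext fun g => one_pow 2
  have := F.finrank_sub_le_signedChi_two (χ := inflateChar φ (1 : C →* (ZMod p)ˣ))
    (W := Fin k → ZMod p) ((cupCocycle φ 1).coprod (carryCocycle φ)) ?_ ?_
    { toFun := fun δ i => δ (inl (elemGen p i)), map_add' := fun _ _ => rfl,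
      map_smul' := fun _ _ => rfl }
    (fun δ hδ h => hδ.isTwistedPrincipal (fun i => congrFun h i) (natCard_ne_zero_of_coprime hC))
    (b := 1) (Or.inr ⟨rfl, h1⟩)
  · rw [finrank_prod, finrank_fin_fun, finrank_fintype_fun_eq_card, card_subtype_lt] at this
    push_cast at this
    linarith
  · rintro ⟨v, w⟩ g h j
    have e1 := hφ.isTwistedCocycle_cupCocycle v g h j
    have e2 := hφ.isTwistedCocycle_carryCocycle w g h j
    rw [h12] at e1
    simp only [LinearMap.coprod_apply, Pi.add_apply]
    rw [← h1] at e2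
    linear_combination e1 + e2
  · rintro ⟨v, w⟩ hvw
    rw [LinearMap.coprod_apply] at hvw
    have hv : v = 0 := by
      funext q
      have h2 := hvw.symm_inl (elemGen p q.1.1) (elemGen p q.1.2)
      have h3 : carryCocycle φ w (inl (elemGen p q.1.1)) (inl (elemGen p q.1.2)) =
          carryCocycle φ w (inl (elemGen p q.1.2)) (inl (elemGen p q.1.1)) := by
        simp only [carryCocycle_apply, carry_comm]
      rw [← cupCocycle_inl_sub (φ := φ) (a := 1) v q]
      simp only [Pi.add_apply] at h2
      rw [Pi.zero_apply]
      linear_combination h2 - h3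
    subst hv
    rw [map_zero, zero_add] at hvw
    refine Prod.ext rfl (funext fun i => ?_)
    have := hvw.sum_pow_eq_zero i
    rwa [sum_carryCocycle] at this

end LowerBounds

end

section

open Finset Module

/-! ### Values of 2-cocycles on relators. -/

section CocyclesOnRelators

variable {U : Type} [Group U] {F : Type} [Field F] {J : Type*} [Fintype J] [DecidableEq J]

/-- A cochain with trivial coefficients on a free module. -/
noncomputable def augmentedSum (u : J → F) : (J → MonoidAlgebra ℤ U) →+ F where
  toFun v := ∑ j, (augmentation U (v j) : F) * u j
  map_zero' := by simp
  map_add' v w := by simp [add_mul, sum_add_distrib]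

omit [DecidableEq J] in
theorem augmentedSum_smul (u : J → F) (r : MonoidAlgebra ℤ U) (v : J → MonoidAlgebra ℤ U) :
    augmentedSum u (r • v) = (augmentation U r : F) * augmentedSum u v := by
  change ∑ j, _ = _ * ∑ j, _
  rw [mul_sum]
  refine sum_congr rfl fun j _ => ?_
  rw [Pi.smul_apply, smul_eq_mul, map_mul]; push_cast; ring

theorem augmentedSum_single (u : J → F) (j : J) :
    augmentedSum u (Pi.single j (1 : MonoidAlgebra ℤ U)) = u j := by
  change ∑ i, _ = _
  rw [Finset.sum_eq_single j]
  · simp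
  · intro i _ hi
    simp [hi]
  · simp

theorem map_smul_of_invariant {M : Type*} [AddCommGroup M] [Module (MonoidAlgebra ℤ U) M]
    (N : Submodule (MonoidAlgebra ℤ U) M) (T : M →+ F)
    (hT : ∀ h : U, ∀ v ∈ N, T (MonoidAlgebra.of ℤ U h • v) = T v) (r : MonoidAlgebra ℤ U) {v : M}
    (hv : v ∈ N) : T (r • v) = (augmentation U r : F) * T v := by
  induction r using groupRing_induction with
  | of u => rw [hT u v hv, augmentation_of, Int.cast_one, one_mul]
  | add a b ha hb => rw [add_smul, map_add, ha, hb, map_add]; push_cast; ring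
  | neg a ha => rw [neg_smul, map_neg, ha, map_neg]; push_cast; ring
  | zero => simp

theorem augmentation_gsum (n : ℕ) (g : U) :
    augmentation U (gsum n (MonoidAlgebra.of ℤ U g)) = n := by
  simp only [gsum, map_sum, ← map_pow, augmentation_of]
  simp

namespace ScalarPresentation

variable {p m s t k : ℕ} {x : Fin k → U} {y : U}

variable (x y) in
/-- The boundary map of the Fox complex. -/
noncomputable def boundary :
    (Option (Fin k) → MonoidAlgebra ℤ U) →ₗ[MonoidAlgebra ℤ U] MonoidAlgebra ℤ U :=
  foxBoundary fun o : Option (Fin k) => o.elim y x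

/-- The relator of a commutator. -/
noncomputable def relatorComm (x : Fin k → U) (i j : Fin k) : Option (Fin k) → MonoidAlgebra ℤ U :=
  relComm (MonoidAlgebra.of ℤ U (x i)) (MonoidAlgebra.of ℤ U (x j)) (Pi.single (some i) 1)
    (Pi.single (some j) 1)

/-- The relator of the power of a generator `x i`. -/
noncomputable def relatorPow (p : ℕ) (x : Fin k → U) (i : Fin k) :
    Option (Fin k) → MonoidAlgebra ℤ U :=
  relPow p (MonoidAlgebra.of ℤ U (x i)) (Pi.single (some i) 1)

/-- The relator of a conjugation. -/
noncomputable def relatorConj (s t : ℕ) (x : Fin k → U) (y : U) (i : Fin k) :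
    Option (Fin k) → MonoidAlgebra ℤ U :=
  relConj s t (MonoidAlgebra.of ℤ U (x i)) (MonoidAlgebra.of ℤ U y) (Pi.single (some i) 1)
    (Pi.single none 1)

/-- The relator of the power of the generator `y`. -/
noncomputable def relatorPowY (m : ℕ) (y : U) : Option (Fin k) → MonoidAlgebra ℤ U :=
  relPow m (MonoidAlgebra.of ℤ U y) (Pi.single none 1)

section Values

variable (u : Option (Fin k) → F)

theorem augmentedSum_relatorComm (i j : Fin k) : augmentedSum u (relatorComm x i j) = 0 := by
  rw [relatorComm, relComm, map_sub, augmentedSum_smul, augmentedSum_smul, map_sub, map_sub,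
    augmentation_of, augmentation_of, map_one]
  simp

theorem augmentedSum_relatorPow (i : Fin k) :
    augmentedSum u (relatorPow p x i) = p * u (some i) := by
  rw [relatorPow, relPow, augmentedSum_smul, augmentation_gsum, augmentedSum_single, Int.cast_natCast]

theorem augmentedSum_relatorConj (i : Fin k) :
    augmentedSum u (relatorConj s t x y i) = (t - s) * u (some i) := by
  rw [relatorConj, relConj, map_add, augmentedSum_smul, augmentedSum_smul, map_sub, map_sub,
    map_mul, ← map_pow, augmentation_of, augmentation_of, augmentation_gsum, augmentation_gsum,
    map_one, augmentedSum_single, augmentedSum_single]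
  push_cast; ring

theorem augmentedSum_relatorPowY :
    augmentedSum u (relatorPowY m y) = m * u none := by
  rw [relatorPowY, relPow, augmentedSum_smul, augmentation_gsum, augmentedSum_single, Int.cast_natCast]

end Values

variable {f : U → U → F}

variable (S : ScalarPresentation p m s t x y)
include S

theorem boundary_relatorComm (i j : Fin k) : boundary x y (relatorComm x i j) = 0 := by
  rw [relatorComm, map_relComm]; exact S.foxBoundary_relators.comm i j

theorem boundary_relatorPow (i : Fin k) : boundary x y (relatorPow p x i) = 0 := by
  rw [relatorPow, map_relPow]; exact S.foxBoundary_relators.pow i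

theorem boundary_relatorConj (i : Fin k) : boundary x y (relatorConj s t x y i) = 0 := by
  rw [relatorConj, map_relConj]; exact S.foxBoundary_relators.conj i

theorem boundary_relatorPowY : boundary x y (relatorPowY m y) = 0 := by
  rw [relatorPowY, map_relPow]; exact S.foxBoundary_relators.pow_y

/-- A cocycle is a coboundary if it agrees with a cochain on all relators. -/
theorem isTwistedCoboundary_of_relators (hf : IsTwistedCocycle 1 f) (u : Option (Fin k) → F)
    (hA : ∀ i j, cocycleLift (boundary x y) f (relatorComm x i j) = 0)
    (hB : ∀ i, cocycleLift (boundary x y) f (relatorPow p x i) = p * u (some i))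
    (hD : ∀ i, cocycleLift (boundary x y) f (relatorConj s t x y i) = (t - s) * u (some i))
    (hY : cocycleLift (boundary x y) f (relatorPowY m y) = m * u none) :
    IsTwistedCoboundary 1 f := by
  have haug : ∀ v, augmentation U (boundary x y v) = 0 := augmentation_foxBoundary _
  let T := cocycleLiftHom (boundary x y) f - augmentedSum u
  have hTd : ∀ v, T v = cocycleLift (boundary x y) f v - augmentedSum u v := fun _ => rfl
  have hT : ∀ (h : U) v, T (MonoidAlgebra.of ℤ U h • v) =
      T v + additiveExtension (f h) (boundary x y v) := fun h v => by
    rw [hTd, hTd, cocycleLift_smul _ haug hf, augmentedSum_smul, augmentation_of]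
    simp; ring
  have hTK := map_smul_of_invariant (LinearMap.ker (boundary x y)) T fun h v hv => by
    rw [hT, LinearMap.mem_ker.1 hv, map_zero, add_zero]
  -- The cycles on which the lifted cocycle agrees with the cochain `u` form a submodule containing
  -- all relators, hence all cycles by `mem_of_foxBoundary_eq_zero`.
  let N : Submodule (MonoidAlgebra ℤ U) (Option (Fin k) → MonoidAlgebra ℤ U) :=
    { carrier := {v | boundary x y v = 0 ∧ T v = 0}
      zero_mem' := ⟨map_zero _, map_zero _⟩
      add_mem' := fun {v w} hv hw => ⟨by rw [map_add, hv.1, hw.1, add_zero],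
        by rw [map_add, hv.2, hw.2, add_zero]⟩
      smul_mem' := fun r v hv => ⟨by rw [map_smul, hv.1, smul_zero],
        by rw [hTK r hv.1, hv.2, mul_zero]⟩ }
  have hN : ∀ v, boundary x y v = 0 → cocycleLift (boundary x y) f v = augmentedSum u v →
      N.mkQ v = 0 := fun v h1 h2 => by
    rw [Submodule.mkQ_apply, Submodule.Quotient.mk_eq_zero]
    exact ⟨h1, by rw [hTd, h2, sub_self]⟩
  refine isTwistedCoboundary_of_lift (χ := 1) (ε := (augmentation U).toAddMonoidHom)
    (d0 := boundary x y) (v0 := 1) (φ0 := LinearMap.id) (m := T) (fun r v => map_mul (augmentation U) r v) ?_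
    (map_one (augmentation U)) (fun _ => rfl) hf ?_ ?_
  · exact fun z => ⟨fun hz => exists_foxBoundary_eq S.closure hz, by rintro ⟨w, rfl⟩; exact haug w⟩
  · intro h v
    rw [hT]; simp
  · intro v hv
    refine (S.mem_of_foxBoundary_eq_zero (N := N) ⟨fun i j => ?_, fun i => ?_, fun i => ?_, ?_⟩ hv).2
    · rw [← map_relComm]
      exact hN _ (S.boundary_relatorComm i j) ((hA i j).trans (augmentedSum_relatorComm u i j).symm)
    · rw [← map_relPow]
      exact hN _ (S.boundary_relatorPow i) ((hB i).trans (augmentedSum_relatorPow u i).symm)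
    · rw [← map_relConj]
      exact hN _ (S.boundary_relatorConj i) ((hD i).trans (augmentedSum_relatorConj u i).symm)
    · rw [← map_relPow]
      exact hN _ S.boundary_relatorPowY (hY.trans (augmentedSum_relatorPowY u).symm)

omit S in
theorem cocycleLift_smul_of_mem_ker (hf : IsTwistedCocycle 1 f) (r : MonoidAlgebra ℤ U)
    {v : Option (Fin k) → MonoidAlgebra ℤ U} (hv : boundary x y v = 0) :
    cocycleLift (boundary x y) f (r • v) =
      (augmentation U r : F) * cocycleLift (boundary x y) f v := by
  have haug : ∀ v, augmentation U (boundary x y v) = 0 := augmentation_foxBoundary _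
  refine map_smul_of_invariant (LinearMap.ker (boundary x y)) (cocycleLiftHom (boundary x y) f)
    (fun h w hw => ?_) r hv
  rw [cocycleLiftHom_apply, cocycleLift_smul _ haug hf, LinearMap.mem_ker.1 hw, map_zero]
  simp [cocycleLiftHom_apply]

theorem mul_cocycleLift_relatorComm (hf : IsTwistedCocycle 1 f) (i j : Fin k) :
    (p : F) * cocycleLift (boundary x y) f (relatorComm x i j) = 0 := by
  have R := S.scalarRelations
  have h := gsum_smul_relComm_right (R.comm i j) (R.pow_x j)
    (Pi.single (M := fun _ : Option (Fin k) => MonoidAlgebra ℤ U) (some i) 1) (Pi.single (some j) 1)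
  have h1 := cocycleLift_smul_of_mem_ker hf (gsum p (MonoidAlgebra.of ℤ U (x j)))
    (S.boundary_relatorComm i j)
  have h2 := cocycleLift_smul_of_mem_ker hf (MonoidAlgebra.of ℤ U (x i) - 1)
    (S.boundary_relatorPow j)
  rw [map_sub, augmentation_of, map_one, sub_self, Int.cast_zero, zero_mul] at h2
  rw [augmentation_gsum, Int.cast_natCast] at h1
  rw [← h1, ← h2, relatorComm, h]
  rfl

/-- On cycles an untwisted cocycle sees scalars through their augmentation, so `relConj_relComm`
keeps only its left side. -/
theorem sub_mul_cocycleLift_relatorComm (hf : IsTwistedCocycle 1 f) (i j : Fin k) :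
    ((t : F) * t - s * s) * cocycleLift (boundary x y) f (relatorComm x i j) = 0 := by
  have R := S.scalarRelations
  have h := relConj_relComm (R.comm i j) (R.conj i) (R.conj j)
    (Pi.single (M := fun _ : Option (Fin k) => MonoidAlgebra ℤ U) (some i) 1) (Pi.single (some j) 1) (Pi.single none 1)
  rw [← sub_smul, sub_eq_add_neg ((_ - (1 : MonoidAlgebra ℤ U)) • _), ← neg_smul] at h
  have h1 := cocycleLift_smul_of_mem_ker hf
    (MonoidAlgebra.of ℤ U y * (gsum t (MonoidAlgebra.of ℤ U (x i)) *
      gsum t (MonoidAlgebra.of ℤ U (x j))) - gsum s (MonoidAlgebra.of ℤ U (x i)) *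
      gsum s (MonoidAlgebra.of ℤ U (x j))) (S.boundary_relatorComm i j)
  have h2 := cocycleLift_smul_of_mem_ker hf (MonoidAlgebra.of ℤ U (x i) ^ s - 1)
    (S.boundary_relatorConj j)
  have h3 := cocycleLift_smul_of_mem_ker hf (-(MonoidAlgebra.of ℤ U (x j) ^ s - 1))
    (S.boundary_relatorConj i)
  simp only [map_sub, map_mul, map_neg, augmentation_gsum, augmentation_of, map_pow, one_pow,
    map_one, sub_self, neg_zero, Int.cast_zero, zero_mul, one_mul] at h1 h2 h3
  push_cast at h1
  rw [← h1, relatorComm, h, cocycleLift_add]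
  exact (congrArg₂ (· + ·) h2 h3).trans (add_zero 0)

theorem mul_cocycleLift_relatorConj (hf : IsTwistedCocycle 1 f) (i : Fin k) :
    (p : F) * cocycleLift (boundary x y) f (relatorConj s t x y i) =
      (t - s) * cocycleLift (boundary x y) f (relatorPow p x i) := by
  have R := S.scalarRelations
  have h := gsum_smul_relConj (s := s) (t := t) (R.pow_x i) (R.norm i)
    (Pi.single (M := fun _ : Option (Fin k) => MonoidAlgebra ℤ U) (some i) 1) (Pi.single none 1)
  rw [← Int.cast_smul_eq_zsmul (MonoidAlgebra ℤ U), ← Int.cast_smul_eq_zsmul (MonoidAlgebra ℤ U),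
    smul_smul, ← sub_smul] at h
  have h1 := cocycleLift_smul_of_mem_ker hf (gsum p (MonoidAlgebra.of ℤ U (x i)))
    (S.boundary_relatorConj i)
  have h2 := cocycleLift_smul_of_mem_ker hf
    (((t : ℤ) : MonoidAlgebra ℤ U) * MonoidAlgebra.of ℤ U y - ((s : ℤ) : MonoidAlgebra ℤ U))
    (S.boundary_relatorPow i)
  simp only [map_sub, map_mul, augmentation_of, mul_one, Int.cast_natCast,
    map_natCast] at h2
  rw [augmentation_gsum, Int.cast_natCast] at h1
  push_cast at h2
  rw [← h1, ← h2, relatorConj, h]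
  simp only [Int.cast_natCast]
  rfl

omit S in
theorem cocycleLift_relatorComm_swap (i j : Fin k) :
    cocycleLift (boundary x y) f (relatorComm x j i) =
      -cocycleLift (boundary x y) f (relatorComm x i j) := by
  have : relatorComm x j i = -relatorComm x i j := by simp [relatorComm, relComm]
  rw [this]
  exact map_neg (cocycleLiftHom (boundary x y) f) _

omit S in
theorem cocycleLift_relatorComm_self (i : Fin k) :
    cocycleLift (boundary x y) f (relatorComm x i i) = 0 := by
  have : relatorComm x i i = 0 := by simp [relatorComm, relComm]
  rw [this, cocycleLift_zero]

/-- Away from the characteristic `p`, the last relator detects coboundaries. -/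
theorem isTwistedCoboundary_of_natCast_ne_zero (hf : IsTwistedCocycle 1 f) (hp : (p : F) ≠ 0)
    (h : (m : F) = 0 → cocycleLift (boundary x y) f (relatorPowY m y) = 0) :
    IsTwistedCoboundary 1 f := by
  -- If `m` vanishes in `F`, the quotient by `m` is the default value `0`, and `h` supplies the
  -- condition on Y.
  refine S.isTwistedCoboundary_of_relators hf (fun o => o.elim
    (cocycleLift (boundary x y) f (relatorPowY m y) / m)
    fun i => cocycleLift (boundary x y) f (relatorPow p x i) / p) (fun i j => ?_) (fun i => ?_)
    (fun i => ?_) ?_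
  · exact (mul_eq_zero.1 (S.mul_cocycleLift_relatorComm hf i j)).resolve_left hp
  · exact (mul_div_cancel₀ _ hp).symm
  · apply mul_left_cancel₀ hp
    rw [S.mul_cocycleLift_relatorConj hf, Option.elim]
    field_simp
  · by_cases hm : (m : F) = 0
    · rw [h hm, hm, zero_mul]
    · exact (mul_div_cancel₀ _ hm).symm

/-- In characteristic `p`, the commutator relators detect coboundaries. -/
theorem isTwistedCoboundary_of_natCast_eq_zero (hf : IsTwistedCocycle 1 f) (hp : (p : F) = 0)
    (hst : (t : F) - s ≠ 0) (hm : (m : F) ≠ 0)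
    (h : ∀ i j, i < j → cocycleLift (boundary x y) f (relatorComm x i j) = 0) :
    IsTwistedCoboundary 1 f := by
  -- Since `p` vanishes in `F`, the cochain is fitted to the D's; the identity `p D = (t - s) B`
  -- then makes the values on the B's vanish.
  refine S.isTwistedCoboundary_of_relators hf (fun o => o.elim
    (cocycleLift (boundary x y) f (relatorPowY m y) / m)
    fun i => cocycleLift (boundary x y) f (relatorConj s t x y i) / (t - s)) (fun i j => ?_)
    (fun i => ?_) (fun i => ?_) ?_
  · rcases lt_trichotomy i j with hij | rfl | hij
    · exact h i j hij
    · exact cocycleLift_relatorComm_self i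
    · rw [cocycleLift_relatorComm_swap, h j i hij, neg_zero]
  · have := S.mul_cocycleLift_relatorConj hf i
    rw [hp, zero_mul] at this
    rw [hp, zero_mul]
    exact (mul_eq_zero.1 this.symm).resolve_left hst
  · exact (mul_div_cancel₀ _ hst).symm
  · exact (mul_div_cancel₀ _ hm).symm

end ScalarPresentation

end CocyclesOnRelators

end

section

open Finset Module SemidirectProduct

/-! ### Cohomology dimensions with trivial coefficients. -/

section TrivialCohomology

open groupCohomology

variable {U : Type} [Group U] {F : Type} [Field F]

theorem cohomDim_zero : cohomDim F U 0 = 1 := by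
  rw [cohomDim, ((H0IsoOfIsTrivial (Rep.trivial F U F)).toLinearEquiv).finrank_eq]
  exact finrank_self F

theorem cohomDim_one : cohomDim F U 1 = finrank F (Additive U →+ F) :=
  ((H1IsoOfIsTrivial (Rep.trivial F U F)).toLinearEquiv).finrank_eq

theorem cohomDim_one_eq_zero (h : ∀ δ : Additive U →+ F, δ = 0) : cohomDim F U 1 = 0 := by
  have : Subsingleton (Additive U →+ F) := ⟨fun a b => by rw [h a, h b]⟩
  rw [cohomDim_one, finrank_zero_of_subsingleton]

theorem one_le_cohomDim_one [Finite U] {δ : Additive U →+ F} (h : δ ≠ 0) : 1 ≤ cohomDim F U 1 := by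
  let I : (Additive U →+ F) →ₗ[F] (U → F) :=
    { toFun := fun δ g => δ (Additive.ofMul g), map_add' := fun _ _ => rfl
      map_smul' := fun _ _ => rfl }
  have hI : Function.Injective I := fun a b hab => by
    ext g
    exact congrFun hab g
  have := Module.Finite.of_injective I hI
  have : Nontrivial (Additive U →+ F) := ⟨δ, 0, h⟩
  rw [cohomDim_one, Nat.one_le_iff_ne_zero]
  exact finrank_pos.ne'

theorem eNumber_two : eNumber F U 2 = cohomDim F U 2 + 2 - 2 * cohomDim F U 1 := by
  simp [eNumber, sum_range_succ, cohomDim_zero]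
  ring

theorem isTwistedCocycle_curry (z : cocycles₂ (Rep.trivial F U F)) :
    IsTwistedCocycle (K := F) (1 : U →* Fˣ) fun g h => z (g, h) := fun g h j => by
  have := (mem_cocycles₂_iff _).1 z.2 g h j
  simpa using this

theorem mem_coboundaries₂_iff_curry (f : U × U → F) :
    f ∈ coboundaries₂ (Rep.trivial F U F) ↔
      IsTwistedCoboundary (1 : U →* Fˣ) fun g h => f (g, h) := by
  constructor
  · rintro ⟨ψ, hψ⟩
    refine ⟨ψ, fun g h => ?_⟩
    rw [← hψ]
    simp [d₁₂_hom_apply]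
  · rintro ⟨ψ, hψ⟩
    refine ⟨ψ, funext fun g => ?_⟩
    rw [d₁₂_hom_apply]
    have := hψ g.1 g.2
    simpa using this.symm

theorem H2π_surjective : Function.Surjective (H2π (Rep.trivial F U F)) := fun w => by
  induction w using H2_induction_on with
  | h z => exact ⟨z, rfl⟩

theorem cohomDim_two_le [Finite U] {W : Type*} [AddCommGroup W] [Module F W] [Module.Finite F W]
    (Θ : (U → U → F) →ₗ[F] W)
    (hΘ : ∀ f, IsTwistedCocycle (1 : U →* Fˣ) f → Θ f = 0 → IsTwistedCoboundary (1 : U →* Fˣ) f) :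
    cohomDim F U 2 ≤ finrank F W := by
  let π : cocycles₂ (Rep.trivial F U F) →ₗ[F] H2 (Rep.trivial F U F) :=
    (H2π (Rep.trivial F U F)).hom
  let T : cocycles₂ (Rep.trivial F U F) →ₗ[F] W := Θ ∘ₗ
    { toFun := fun z g h => z (g, h), map_add' := fun _ _ => rfl, map_smul' := fun _ _ => rfl }
  have hfin : Module.Finite F (U × U → F) := inferInstance
  have hZ : Module.Finite F (cocycles₂ (Rep.trivial F U F)) :=
    FiniteDimensional.finiteDimensional_submodule (V := U × U → F) _
  have hker : LinearMap.ker T ≤ LinearMap.ker π := fun z hz => by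
    rw [LinearMap.mem_ker]
    exact (H2π_eq_zero_iff z).2 ((mem_coboundaries₂_iff_curry _).2
      (hΘ _ (isTwistedCocycle_curry z) hz))
  have h1 := LinearMap.finrank_range_add_finrank_ker T
  have h2 : finrank F (LinearMap.range π) + finrank F (LinearMap.ker π) =
      finrank F (cocycles₂ (Rep.trivial F U F)) := LinearMap.finrank_range_add_finrank_ker π
  have h3 := Submodule.finrank_mono hker
  have h4 := Submodule.finrank_le (LinearMap.range T)
  have h5 : finrank F (LinearMap.range π) = cohomDim F U 2 := by
    rw [LinearMap.range_eq_top.2 H2π_surjective, finrank_top]; rfl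
  omega

theorem finrank_le_cohomDim_two [Finite U] {V : Type*} [AddCommGroup V] [Module F V]
    [Module.Finite F V] (c : V →ₗ[F] (U → U → F))
    (hc : ∀ v, IsTwistedCocycle (1 : U →* Fˣ) (c v))
    (hinj : ∀ v, IsTwistedCoboundary (1 : U →* Fˣ) (c v) → v = 0) :
    finrank F V ≤ cohomDim F U 2 := by
  let π : cocycles₂ (Rep.trivial F U F) →ₗ[F] H2 (Rep.trivial F U F) :=
    (H2π (Rep.trivial F U F)).hom
  let T : V →ₗ[F] cocycles₂ (Rep.trivial F U F) :=
    { toFun := fun v => ⟨fun g => c v g.1 g.2, (mem_cocycles₂_iff _).2 fun g h j => by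
        simpa using hc v g h j⟩
      map_add' := fun v w => by rw [Subtype.ext_iff]; simp only [map_add]; rfl
      map_smul' := fun a v => by rw [Subtype.ext_iff]; simp only [map_smul]; rfl }
  have hfin : Module.Finite F (U × U → F) := inferInstance
  have hZ : Module.Finite F (cocycles₂ (Rep.trivial F U F)) :=
    FiniteDimensional.finiteDimensional_submodule (V := U × U → F) _
  have hH : Module.Finite F (H2 (Rep.trivial F U F)) := Module.Finite.of_surjective π H2π_surjective
  refine LinearMap.finrank_le_finrank_of_injective (f := π ∘ₗ T) ?_
  rw [← LinearMap.ker_eq_bot, LinearMap.ker_eq_bot']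
  intro v hv
  exact hinj v ((mem_coboundaries₂_iff_curry _).1 ((H2π_eq_zero_iff (T v)).1 hv))

/-- Evaluation of two-cochains on a chain. -/
noncomputable def cocycleEval {J : Type*} [Fintype J] [DecidableEq J]
    (d : (J → MonoidAlgebra ℤ U) →ₗ[MonoidAlgebra ℤ U] MonoidAlgebra ℤ U)
    (v : J → MonoidAlgebra ℤ U) : (U → U → F) →ₗ[F] F where
  toFun f := cocycleLift d f v
  map_add' f g := cocycleLift_add_left d f g v
  map_smul' a f := cocycleLift_smul_left d a f v

namespace ScalarPresentation

variable {p m s t k : ℕ} {x : Fin k → U} {y : U} (S : ScalarPresentation p m s t x y) [Finite U]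
include S

theorem cohomDim_two_le_one (hp : (p : F) ≠ 0) : cohomDim F U 2 ≤ 1 := by
  rw [← finrank_self F]
  exact cohomDim_two_le (cocycleEval (boundary x y) (relatorPowY m y)) fun f hf h =>
    S.isTwistedCoboundary_of_natCast_ne_zero hf hp fun _ => h

theorem cohomDim_two_eq_zero (hp : (p : F) ≠ 0) (hm : (m : F) ≠ 0) : cohomDim F U 2 = 0 := by
  rw [← Nat.le_zero, ← finrank_fin_fun F (n := 0)]
  exact cohomDim_two_le 0 fun f hf _ =>
    S.isTwistedCoboundary_of_natCast_ne_zero hf hp fun h => absurd h hm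

theorem cohomDim_two_le_choose (hp : (p : F) = 0) (hst : (t : F) - s ≠ 0) (hm : (m : F) ≠ 0) :
    cohomDim F U 2 ≤ k.choose 2 := by
  have := cohomDim_two_le (F := F) (LinearMap.pi fun q : {q : Fin k × Fin k // q.1 < q.2} =>
    cocycleEval (boundary x y) (relatorComm x q.1.1 q.1.2)) fun f hf h =>
      S.isTwistedCoboundary_of_natCast_eq_zero hf hp hst hm fun i j hij =>
        congrFun h ⟨(i, j), hij⟩
  rwa [finrank_fintype_fun_eq_card, card_subtype_lt] at this

theorem cohomDim_two_eq_zero_of_sq_ne (hp : (p : F) = 0) (hst : (t : F) - s ≠ 0)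
    (hst2 : (t : F) * t - s * s ≠ 0) (hm : (m : F) ≠ 0) : cohomDim F U 2 = 0 := by
  rw [← Nat.le_zero, ← finrank_fin_fun F (n := 0)]
  exact cohomDim_two_le 0 fun f hf _ =>
    S.isTwistedCoboundary_of_natCast_eq_zero hf hp hst hm fun i j _ =>
      (mul_eq_zero.1 (S.sub_mul_cocycleLift_relatorComm hf i j)).resolve_left hst2

/-- The class is the homomorphism killing every `x i` and sending `y` to `1`. -/
theorem one_le_cohomDim_one_of_natCast_eq_zero (hm : (m : F) = 0) : 1 ≤ cohomDim F U 1 := by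
  obtain ⟨g, -, hy⟩ := S.lift (H := Multiplicative F) (fun _ => 1) (Multiplicative.ofAdd 1)
    (fun _ _ => Commute.all _ _) (fun _ => one_pow p)
    (by rw [← ofAdd_nsmul, nsmul_one, hm, ofAdd_zero]) (fun _ => by simp)
  refine one_le_cohomDim_one (δ := MonoidHom.toAdditiveLeft g) fun h => ?_
  have h1 : g y = 1 := DFunLike.congr_fun h (Additive.ofMul y)
  rw [hy] at h1
  exact one_ne_zero (α := F) h1

theorem eNumber_two_le_three (hp : (p : F) ≠ 0) : eNumber F U 2 ≤ 3 := by
  have := S.cohomDim_two_le_one hp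
  rw [eNumber_two]
  omega

/-- If the characteristic divides `m`, a possible class in `H^2` is outweighed by the one in `H^1`,
which counts twice; otherwise `H^2` vanishes. -/
theorem eNumber_two_le_two (hp : (p : F) ≠ 0) : eNumber F U 2 ≤ 2 := by
  rw [eNumber_two]
  by_cases hm : (m : F) = 0
  · have := S.cohomDim_two_le_one hp
    have := S.one_le_cohomDim_one_of_natCast_eq_zero hm
    omega
  · rw [S.cohomDim_two_eq_zero hp hm]
    omega

theorem eNumber_rat_two (hp : p ≠ 0) (hm : m ≠ 0) : eNumber ℚ U 2 = 2 := by
  rw [eNumber_two, S.cohomDim_two_eq_zero (Nat.cast_ne_zero.2 hp) (Nat.cast_ne_zero.2 hm),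
    cohomDim_one_eq_zero fun δ => ?_]
  · rfl
  · ext g
    have h1 := map_nsmul δ (Nat.card U) (Additive.ofMul g)
    rw [← ofMul_pow, pow_card_eq_one', ofMul_one, map_zero, nsmul_eq_mul] at h1
    exact (mul_eq_zero.1 h1.symm).resolve_left (Nat.cast_ne_zero.2 Nat.card_pos.ne')

end ScalarPresentation

end TrivialCohomology

end

/-! ### Assembly of the bounds. -/

open SemidirectProduct in
theorem cohomDim_zmod_one_eq_zero {p k : ℕ} [Fact p.Prime] {C : Type} [Group C] [Finite C]
    {φ : C →* MulAut (ElemAb p k)} {a : C →* (ZMod p)ˣ} (hφ : IsScalarAction φ a)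
    (hC : (Nat.card C).Coprime p) (ha : a ≠ 1) :
    cohomDim (ZMod p) (ElemAb p k ⋊[φ] C) 1 = 0 := by
  refine cohomDim_one_eq_zero fun δ => ?_
  obtain ⟨c, hc⟩ := hφ.isTwistedPrincipal hC ha.symm
    (δ := fun g => δ (Additive.ofMul g)) fun g h => by
      simp [ofMul_mul, map_add]
  ext g
  have := hc g
  simpa using this

theorem choose_two_cast (k : ℕ) : (((k.choose 2 : ℕ) : ℤ) : ℚ) = (k : ℚ) * ((k : ℚ) - 1) / 2 := by
  rw [Int.cast_natCast, Nat.cast_choose_two]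

theorem exists_isLeast_of_mem {s : Set ℤ} {b c : ℤ} (hb : ∀ z ∈ s, b ≤ z) (hc : c ∈ s) :
    ∃ z, IsLeast s z := by
  classical
  obtain ⟨z, h1, h2⟩ := Int.exists_least_of_bdd ⟨b, hb⟩ ⟨c, hc⟩
  exact ⟨z, h1, h2⟩

theorem mainTheorem10 (p : ℕ) [Fact p.Prime] (hp : p ≠ 2) (k : ℕ) (hk : 1 < k)
    (C : Type) [Group C] [Finite C] [IsCyclic C] (hC : (Nat.card C).Coprime p)
    (φ : C →* MulAut (ElemAb p k))
    (K : Type*) [Field K] [IsAlgClosed K] [CharP K p]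
    (α : C →* Kˣ) (hφ : IsIsotypicAction φ α) :
    ∃ e₂ μ₁ μ₂ : ℤ,
      IsEInvariant 2 (ElemAb p k ⋊[φ] C) e₂ ∧
      IsSwanMu 1 (ElemAb p k ⋊[φ] C) μ₁ ∧
      IsSwanMu 2 (ElemAb p k ⋊[φ] C) μ₂ ∧
      (α ^ 2 ≠ 1 →
        e₂ = 2 ∧
        (μ₂ : ℚ) = (k : ℚ) * ((k : ℚ) - 1) / 2 ∧
        (μ₂ : ℚ) - (μ₁ : ℚ) = (k : ℚ) * ((k : ℚ) - 3) / 2) ∧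
      (α ^ 2 = 1 →
        (μ₂ : ℚ) = (k : ℚ) * ((k : ℚ) - 1) / 2 + 1 ∧
        (α ≠ 1 →
          (e₂ : ℚ) = (k : ℚ) * ((k : ℚ) - 1) / 2 + 2 ∧
          (μ₂ : ℚ) - (μ₁ : ℚ) = (k : ℚ) * ((k : ℚ) - 3) / 2 + 1)) := by
  have hprime : p.Prime := Fact.out
  have hm0 : Nat.card C ≠ 0 := Nat.card_pos.ne'
  have hmp : (Nat.card C : ZMod p) ≠ 0 := natCard_ne_zero_of_coprime hC
  obtain ⟨a, ha, hcast⟩ := hφ.exists_isScalarAction (by omega)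
  have hα2 : α ^ 2 = 1 ↔ a ^ 2 = 1 := pow_eq_one_iff_of_cast_eq hcast 2
  have hα1 : α = 1 ↔ a = 1 := by
    have := pow_eq_one_iff_of_cast_eq hcast 1
    have e1 : α ^ 1 = α := MonoidHom.ext fun g => pow_one (α g)
    have e2 : a ^ 1 = a := MonoidHom.ext fun g => pow_one (a g)
    rwa [e1, e2] at this
  have hfin : Finite (ElemAb p k ⋊[φ] C) := Finite.of_equiv _ SemidirectProduct.equivProd.symm
  have hchar : ∀ (q : ℕ) [Fact q.Prime], q ≠ p → ((p : ℕ) : ZMod q) ≠ 0 := fun q hq hqp => by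
    rw [natCast_ne_zero_iff_coprime, Nat.coprime_primes hprime hq.out]
    exact hqp.symm
  obtain ⟨c, hc⟩ := IsCyclic.exists_generator (α := C)
  by_cases h1 : a = 1
  · have hα : α = 1 := hα1.2 h1
    have hα' : α ^ 2 = 1 := hα2.2 (by rw [h1]; exact MonoidHom.ext fun g => one_pow 2)
    obtain ⟨⟨F1, hF1⟩, F2, hF2⟩ := ha.exists_resolution_trivial hk hC h1
    have S := ha.scalarPresentation hc (s := 1) (t := 1) (Nat.coprime_one_left p)
      (Nat.coprime_one_left p) (by simp [h1])
    subst h1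
    -- For the trivial action the values of `e₂` and `μ₁` are not prescribed; boundedness and
    -- nonemptiness give their existence.
    obtain ⟨e, he⟩ := exists_isLeast_of_mem
      (s := {b : ℤ | eNumber ℚ (ElemAb p k ⋊[φ] C) 2 ≤ b ∧
        ∀ (q : ℕ) [Fact q.Prime], eNumber (ZMod q) (ElemAb p k ⋊[φ] C) 2 ≤ b})
      (c := max 3 (eNumber (ZMod p) (ElemAb p k ⋊[φ] C) 2)) (fun z hz => hz.1)
      ⟨le_max_of_le_left (S.eNumber_two_le_three (Nat.cast_ne_zero.2 hprime.ne_zero)),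
        fun q _ => by
          by_cases hqp : q = p
          · subst hqp; exact le_max_right _ _
          · exact le_max_of_le_left (S.eNumber_two_le_three (hchar q hqp))⟩
    obtain ⟨μ, hμ⟩ := exists_isLeast_of_mem
      (s := Set.range fun F : FreeStepResolution (ElemAb p k ⋊[φ] C) 1 => F.signedChi)
      (b := -1) (by rintro _ ⟨F, rfl⟩; exact F.neg_one_le_signedChi_one) ⟨F1, hF1⟩
    refine ⟨e, μ, k.choose 2 + 1, he, hμ, ⟨⟨F2, hF2⟩, ?_⟩, fun h => absurd hα' h, fun _ => ⟨?_, ?_⟩⟩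
    · rintro _ ⟨F, rfl⟩
      exact ha.succ_le_signedChi_two hC F
    · rw [Int.cast_add, choose_two_cast, Int.cast_one]
    · exact fun h => absurd hα h
  · have hα : α ≠ 1 := fun h => h1 (hα1.1 h)
    obtain ⟨s, n, S, -, -, hs⟩ := ha.exists_scalarPresentation h1 hC hc
    have ht : ((s + 1 : ℕ) : ZMod p) ≠ 0 := (natCast_ne_zero_iff_coprime _).2 S.coprime_t
    have hst : ((s + 1 : ℕ) : ZMod p) - s ≠ 0 := by push_cast; simp
    have hQ : eNumber ℚ (ElemAb p k ⋊[φ] C) 2 = 2 := S.eNumber_rat_two hprime.ne_zero hm0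
    have hep : eNumber (ZMod p) (ElemAb p k ⋊[φ] C) 2 =
        cohomDim (ZMod p) (ElemAb p k ⋊[φ] C) 2 + 2 := by
      rw [eNumber_two, cohomDim_zmod_one_eq_zero ha hC h1]; simp
    have hμ1 : (∃ F : FreeStepResolution (ElemAb p k ⋊[φ] C) 1, F.signedChi = k) →
        IsSwanMu 1 (ElemAb p k ⋊[φ] C) k := fun hF =>
      ⟨hF, by rintro _ ⟨F, rfl⟩; exact ha.le_signedChi_one h1 F⟩
    -- For a nontrivial action `h^1` over `𝔽_p` is zero, so `p` contributes `h^2 + 2`, while `ℚ` and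
    -- the other primes contribute at most `2`.
    have hE : ∀ b : ℕ, cohomDim (ZMod p) (ElemAb p k ⋊[φ] C) 2 = b →
        IsEInvariant 2 (ElemAb p k ⋊[φ] C) (b + 2) := fun b hb => by
      rw [hb] at hep
      refine ⟨⟨by rw [hQ]; omega, fun q _ => ?_⟩, fun z hz => hep ▸ hz.2 p⟩
      by_cases hqp : q = p
      · subst hqp; exact hep.le
      · exact (S.eNumber_two_le_two (hchar q hqp)).trans (by omega)
    by_cases h2 : a ^ 2 = 1
    · obtain ⟨hF1, hF2⟩ := ha.exists_resolution_involutive hk hC h1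
      refine ⟨k.choose 2 + 2, k, k.choose 2 + 1, hE _ (le_antisymm ?_ ?_), hμ1 hF1, ⟨hF2, ?_⟩,
        fun h => absurd (hα2.2 h2) h, fun _ => ⟨?_, fun _ => ⟨?_, ?_⟩⟩⟩
      · exact S.cohomDim_two_le_choose (CharP.cast_eq_zero _ p) hst hmp
      · have := finrank_le_cohomDim_two (cupCocycle φ a) (fun v => ?_) fun v hv => ?_
        · rwa [Module.finrank_fintype_fun_eq_card, card_subtype_lt] at this
        · have := ha.isTwistedCocycle_cupCocycle v
          rwa [(inflateChar_eq_one_iff _).2 h2] at this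
        · rw [← (inflateChar_eq_one_iff (φ := φ) (a ^ 2)).2 h2] at hv
          exact eq_zero_of_isTwistedCoboundary_cupCocycle hv
      · rintro _ ⟨F, rfl⟩
        exact ha.le_signedChi_two hC h1 (b := 1) (Or.inr ⟨rfl, h2⟩) F
      · rw [Int.cast_add, choose_two_cast, Int.cast_one]
      · rw [Int.cast_add, choose_two_cast, Int.cast_ofNat]
      · rw [Int.cast_add, choose_two_cast, Int.cast_one, Int.cast_natCast]; ring
    · obtain ⟨hF1, hF2⟩ := ha.exists_resolution_generic hp hk hC h2
      refine ⟨2, k, k.choose 2, ?_, hμ1 hF1, ⟨hF2, ?_⟩, fun _ => ⟨rfl, choose_two_cast k, ?_⟩,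
        fun h => absurd (hα2.1 h) h2⟩
      · refine hE 0 (S.cohomDim_two_eq_zero_of_sq_ne (CharP.cast_eq_zero _ p) hst ?_ hmp)
        intro h0
        refine h2 ((pow_apply_generator_eq_one_iff hc 2).1 ?_)
        apply mul_right_cancel₀ (mul_ne_zero ht ht)
        rw [hs] at h0
        linear_combination -h0
      · rintro _ ⟨F, rfl⟩
        simpa using ha.le_signedChi_two hC h1 (b := 0) (Or.inl rfl) F
      · rw [choose_two_cast, Int.cast_natCast]; ring
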